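/- **Setting.** Let $T\subset\mathbb Z^d$ be finite, $(X_i)_{i\in T}$ real random variables on a probability space with arbitrary joint dependence, $\mathbb E[X_i]=0$, $\sigma^2:=\operatorname{Var}(\sum_{i\in T}X_i)>0$. For $J\subseteq T$ put $W(J):=\sigma^{-1}\sum_{i\in T\setminus J}X_i$, and $W:=W(\emptyset)$. Fix an integer $m\ge 1$ and a strict total order $\prec$ on $\mathbb Z^d$. Let $k\ge2$, $f\in\mathcal C^k(\mathbb R)$ and write $\partial^l f$ for the $l$-th derivative. Assume that the expectations involved exist, namely: $\mathbb E|X_i|^{k+1}<\infty$ for $i\in T$, and for all $0\le l\le k$, $0\le n\le l+1$, $i_1,\dots,i_n\in T$, the variables $X_{i_1}\cdots X_{i_n}\,\partial^lf(W(J))$ ($J\subseteq T$) and $X_{i_1}\cdots X_{i_n}\int_0^1v^r\,\partial^lf\bigl(vW(D)+(1-v)W(B)\bigr)\,dv$ ($D\subseteq B\subseteq T$, $0\le r<l$) are integrable. (Given the moments, this is automatic if $\partial^kf$ is bounded, and everything is automatic if the $X_i$ are bounded.) Let $\kappa_j(W)$ be the $j$-th cumulant of $W$. **Genograms.** An order-$k$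 genogram is a rooted tree with $k$ vertices and an integer $s_v$ (identifier) for each vertex $v$ such that: the root has $s_v=0$ and $s_v\ge-1$ for all $v$; children of the root have $s_v\ge0$; if a vertex has more than one child, the identifiers of its children are nonnegative and distinct. Genograms are considered up to isomorphism, and their vertices are labelled $v[1],\dots,v[k]$ in the unique way such that $v[1]$ is the root, $v[j+1]$ is a child of the vertex with the largest label $\le j$ which still has unlabelled children, and siblings are labelled in decreasing order of identifiers. Write $s_j$ for the identifier of $v[j]$, $p(j)$ for the label of its parent, $A(j)$ for the set of labels of its ancestors, $g(j):=\max\{l: l=1\text{ or }(l\in A(j),\,s_l\ge1)\}$ and $u(j):=\max\{l\in\{j\}\cup A(j): s_l\ge0\}$. A vertex is negative or positive if $s_j=-1$ or $s_j\ge1$ respectively. $G[j]$ denotes the genogram induced on $v[1],\dots,v[j]$. Let $\mathcal G(k)$ be the set of order-$k$ genograms, $\mathcal P_0(k)$ those with no positive vertex, $\mathcal G_0(k)=\mathcal G(k)\setminus\mathcal P_0(k)$, and $\mathcal P_1(k)$ those whose only positive vertex is $v[k]$. With $\gamma_H$ the number of leaves and $\tau_H$ the number of negative vertices of $H$, $|H|\ge2$,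 put $$b_H:=(-1)^{\gamma_H+\tau_H}\prod_{j=2}^{|H|-1}\frac1{j+1-u(j)}.$$ **Constraint sets.** For nonempty $J\subseteq T$ let $d(i,J)=\min_{j\in J}\|i-j\|_\infty$, $N(J)=\{i\in T:d(i,J)\le m\}$, and let $\operatorname{rk}(i,J)\in\{1,2,\dots\}$ be the rank of $i\in T\setminus N(J)$ when $T\setminus N(J)$ is sorted by increasing $d(\cdot,J)$, ties broken by $\prec$. For an integer $s\ge0$, $N^{(s)}(J)=N(J)\cup\{i\in T\setminus N(J):\operatorname{rk}(i,J)\le s\}$. For a genogram $G$, $B_1=T$, $D_1=\emptyset$, and for $j\ge2$, given indices $i_1,\dots,i_{j-1}$, with $N^{(s)}_j:=N^{(s)}(\{i_l:l\in A(j)\})$, $$B_j=\begin{cases}N^{(s_j)}_j\cup D_{g(j)}&s_j\ge0\\B_{u(j)}&s_j=-1\end{cases},\qquad D_j=\begin{cases}N^{(s_j-1)}_j\cup D_{g(j)}&s_j\ge1\\D_{g(j)}&s_j\le0\end{cases}.$$ **Operators.** Put $\mathcal D(Y)=Y-\mathbb E[Y]$, $\mathcal D^*(Y)=\mathbb E[Y]$,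 and for $t\ge2$, $\mathcal D^*(Y_1,\dots,Y_t)=\mathbb E[Y_1\mathcal D(Y_2,\dots,Y_t)]$, $\mathcal D(Y_1,\dots,Y_t)=Y_1\mathcal D(Y_2,\dots,Y_t)-\mathbb E[Y_1\mathcal D(Y_2,\dots,Y_t)]$. For $G\in\mathcal G(n)$ let $q_0$ be the largest $j\le n$ with $j=1$ or $p(j)\ne j-1$, and let $q_1<\dots<q_w$ be the elements of $\{t:q_0<t\le n,\ s_t\ge0\}$. Recursively, $$\mathcal E_G(Y_1,\dots,Y_n)=\mathcal E_{G[q_0-1]}(Y_1,\dots,Y_{q_0-1})\cdot\mathcal D^*\bigl(Y_{q_0}\cdots Y_{q_1-1},\;Y_{q_1}\cdots Y_{q_2-1},\;\dots,\;Y_{q_w}\cdots Y_n\bigr),$$ where the first factor is absent if $q_0=1$ (and the last factor is $\mathcal D^*(Y_{q_0}\cdots Y_n)$ if $w=0$). **Sums.** For $G\in\mathcal G(n)$, $$\mathcal S(G)=\sigma^{-n}\sum_{i_1\in B_1\setminus D_1}\cdots\sum_{i_n\in B_n\setminus D_n}\mathcal E_G(X_{i_1},\dots,X_{i_n}),$$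 and for $n\ge2$, $$\mathcal U_f(G)=\sigma^{-(n-1)}\sum_{i_1\in B_1\setminus D_1}\cdots\sum_{i_{n-1}\in B_{n-1}\setminus D_{n-1}}\mathcal E_G(X_{i_1},\dots,X_{i_{n-1}},\Delta_f(G)),$$ where $\Delta_f(G)=\partial^{n-2}f(W(B_n))-\partial^{n-2}f(W(D_n))$ if $u(n)=n$, and otherwise $$\Delta_f(G)=\int_0^1(n-u(n))v^{n-1-u(n)}\Bigl(\partial^{n-2}f\bigl(vW(D_n)+(1-v)W(B_n)\bigr)-\partial^{n-2}f(W(D_n))\Bigr)dv.$$ **Statement.** Only finitely many of the numbers $\mathcal U_f(H)$, $H\in\mathcal G(k+2)\cup\mathcal G(k+1)$, and $\mathcal S(H)$, $H\in\mathcal G(k+1)$, are nonzero, and $$\mathbb E[Wf(W)]=\sum_{j=1}^{k}\frac{\kappa_{j+1}(W)}{j!}\mathbb E[\partial^jf(W)]+\sum_{H\in\mathcal G(k+2)}b_H\,\mathcal U_f(H)$$ $$=\sum_{j=1}^{k-1}\frac{\kappa_{j+1}(W)}{j!}\mathbb E[\partial^jf(W)]+\frac{\widetilde\kappa_{k+1}}{k!}\mathbb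 E[\partial^kf(W)]+\sum_{H\in\mathcal P_0(k+2)\sqcup\mathcal P_1(k+2)\sqcup\mathcal G_0(k+1)}b_H\,\mathcal U_f(H),$$ where $$\widetilde\kappa_{k+1}:=\kappa_{k+1}(W)+\sum_{H\in\mathcal G_0(k+1)}\frac{k!\,b_H}{k+2-u(k+1)}\,\mathcal S(H).$$ -/

import Mathlib

open MeasureTheory ProbabilityTheory

open scoped Classical

noncomputable section

/-! ## Genograms -/

/-- An order-`k` genogram: a rooted tree on `k` vertices, each vertex carrying an integer (its
identifier).  Genograms are taken up to isomorphism: every genogram has exactly one *compatible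
labeling* `v[1], …, v[k]` of its vertices, and we record the genogram through this labeling.
`p j` is the label of the parent of `v[j]` (`2 ≤ j ≤ k`), and `s j` is the identifier of `v[j]`
(`1 ≤ j ≤ k`).  Both functions are set to `0` at all other arguments, so that equality of
`Genogram`s is equality of labelled trees with identifiers. -/
@[ext]
structure Genogram (k : ℕ) where
  /-- label of the parent -/
  p : ℕ → ℕ
  /-- identifier -/
  s : ℕ → ℤ
  p_out : ∀ j, j ∉ Finset.Icc 2 k → p j = 0
  s_out : ∀ j, j ∉ Finset.Icc 1 k → s j = 0
  /-- `v[1]` is the root; every other vertex has a parent, which has a smaller label. -/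
  p_mem : ∀ j ∈ Finset.Icc 2 k, 1 ≤ p j ∧ p j < j
  /-- Genogram condition (a): the root has identifier `0`, all identifiers are `≥ -1`. -/
  s_root : s 1 = 0
  s_ge : ∀ j ∈ Finset.Icc 2 k, -1 ≤ s j
  /-- Genogram condition (b): children of the root have nonnegative identifiers. -/
  s_child_root : ∀ j ∈ Finset.Icc 2 k, p j = 1 → 0 ≤ s j
  /-- Genogram condition (c): if a vertex has more than one child, then the identifiers of its
  children are nonnegative and mutually different. -/
  s_siblings : ∀ j ∈ Finset.Icc 2 k, ∀ h ∈ Finset.Icc 2 k, j ≠ h → p j = p h →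
    0 ≤ s j ∧ s j ≠ s h
  /-- Labeling condition (a), depth-first traversal: `v[j+1]` is a child of the vertex with the
  largest label `≤ j` that still has children not among `v[1], …, v[j]`. -/
  depth_first : ∀ j, 1 ≤ j → j + 1 ≤ k →
    IsGreatest {q : ℕ | q ≤ j ∧ ∃ l ∈ Finset.Icc (j + 1) k, p l = q} (p (j + 1))
  /-- Labeling condition (b): among siblings, larger identifiers get smaller labels. -/
  sibling_order : ∀ j ∈ Finset.Icc 2 k, ∀ h ∈ Finset.Icc 2 k, j ≠ h → p j = p h →
    (s h < s j ↔ j < h)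

namespace Genogram

variable {k : ℕ}

/-- `A(j)`: the labels of the ancestors of `v[j]`, i.e. what one gets by passing to the parent
one or more times (parents have smaller labels). -/
def ancestors (G : Genogram k) (j : ℕ) : Finset ℕ :=
  (Finset.Ico 1 j).filter fun l => ∃ n : ℕ, G.p^[n + 1] j = l

/-- `g(j) = sup {l : l = 1, or l ∈ A(j) and s_l ≥ 1}`, the label of the progenitor of `v[j]`. -/
def g (G : Genogram k) (j : ℕ) : ℕ :=
  (insert 1 ((G.ancestors j).filter fun l => 1 ≤ G.s l)).sup id

/-- `u(j) = sup {l ∈ {j} ∪ A(j) : s_l ≥ 0}`. -/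
def u (G : Genogram k) (j : ℕ) : ℕ :=
  ((insert j (G.ancestors j)).filter fun l => 0 ≤ G.s l).sup id

/-- `γ_G`, the number of leaves (vertices without children). -/
def leaves (G : Genogram k) : ℕ :=
  ((Finset.Icc 1 k).filter fun j => ∀ h ∈ Finset.Icc 2 k, G.p h ≠ j).card

/-- `τ_G`, the number of negative vertices. -/
def negatives (G : Genogram k) : ℕ :=
  ((Finset.Icc 1 k).filter fun j => G.s j = -1).card

/-- The coefficient `b_G = (-1)^(γ_G + τ_G) ∏_{j=2}^{|G|-1} 1 / (j + 1 - u(j))` (the product is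
empty if `|G| = 2`). -/
def b (G : Genogram k) : ℝ :=
  (-1) ^ (G.leaves + G.negatives) *
    ∏ j ∈ Finset.Icc 2 (k - 1), 1 / ((j : ℝ) + 1 - (G.u j : ℝ))

/-- Order-`k` genograms without positive vertex. -/
def P₀ (k : ℕ) : Set (Genogram k) := {G | ∀ j ∈ Finset.Icc 1 k, G.s j ≤ 0}

/-- Order-`k` genograms with at least one positive vertex. -/
def G₀ (k : ℕ) : Set (Genogram k) := (P₀ k)ᶜ

/-- Order-`k` genograms whose only positive vertex is `v[k]`. -/
def P₁ (k : ℕ) : Set (Genogram k) :=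
  {G | (∀ j ∈ Finset.Icc 1 (k - 1), G.s j ≤ 0) ∧ 1 ≤ G.s k}

theorem g_lt (G : Genogram k) {j : ℕ} (hj : 1 < j) : G.g j < j := by
  unfold g
  rw [Finset.sup_lt_iff (by simpa using (by omega : 0 < j))]
  intro l hl
  simp only [Finset.mem_insert, Finset.mem_filter, ancestors, Finset.mem_Ico] at hl
  simp only [id]
  omega

theorem u_lt (G : Genogram k) {j : ℕ} (hj : 1 < j) (hs : ¬ 0 ≤ G.s j) : G.u j < j := by
  unfold u
  rw [Finset.sup_lt_iff (by simpa using (by omega : 0 < j))]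
  intro l hl
  simp only [Finset.mem_insert, Finset.mem_filter, ancestors, Finset.mem_Ico] at hl
  simp only [id]
  rcases hl with ⟨rfl | h, h0⟩
  · exact absurd h0 hs
  · omega

end Genogram

/-! ## Distances and neighborhoods in the index set `T ⊆ ℤ^d` -/

section Lattice

variable {d : ℕ}

/-- The distance on `ℤ^d` coming from the maximum norm, as a natural number. -/
def maxDist (i j : Fin d → ℤ) : ℕ := Finset.univ.sup fun a => (i a - j a).natAbs

theorem maxDist_eq_norm (i j : Fin d → ℤ) : (maxDist i j : ℝ) = ‖i - j‖ := by
  have h : ((maxDist i j : NNReal)) = ‖i - j‖₊ := by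
    rw [Pi.nnnorm_def, maxDist, Finset.apply_sup_eq_sup_comp (fun n : ℕ => (n : NNReal))
      (fun x y => by simp) (by simp)]
    refine Finset.sup_congr rfl fun a _ => ?_
    apply NNReal.eq
    simp [Int.norm_eq_abs, Nat.cast_natAbs]
  have h' := congrArg NNReal.toReal h
  simpa using h'

/-- `d(i, J) = min_{j ∈ J} ‖i - j‖` (used for nonempty `J` only). -/
def setDist (i : Fin d → ℤ) (J : Finset (Fin d → ℤ)) : ℕ :=
  sInf ((fun j => maxDist i j) '' (J : Set (Fin d → ℤ)))

/-- `N(J)`, the `m`-neighborhood of `J` in `T`. -/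
def nbhd (T : Finset (Fin d → ℤ)) (m : ℕ) (J : Finset (Fin d → ℤ)) : Finset (Fin d → ℤ) :=
  T.filter fun i => setDist i J ≤ m

/-- `A^{(l)}(J)`, the elements of `T` at distance exactly `l` from `J`. -/
def shell (T : Finset (Fin d → ℤ)) (l : ℕ) (J : Finset (Fin d → ℤ)) : Finset (Fin d → ℤ) :=
  T.filter fun i => setDist i J = l

/-- `rk(i, J)` for `i ∈ T \ N(J)`: elements of `T \ N(J)` are ranked `1, 2, …` by their distance
to `J`, ties being broken by the strict total order `prec` on `ℤ^d`. -/
def rk (T : Finset (Fin d → ℤ)) (m : ℕ) (prec : (Fin d → ℤ) → (Fin d → ℤ) → Prop)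
    (i : Fin d → ℤ) (J : Finset (Fin d → ℤ)) : ℕ :=
  ∑ l ∈ Finset.Ico (m + 1) (setDist i J), (shell T l J).card +
    ((shell T (setDist i J) J).filter fun i' => i' = i ∨ prec i' i).card

/-- `N^{(s)}(J) = {i ∈ T : i ∈ N(J) or rk(i, J) ≤ s}`. -/
def nbhdRk (T : Finset (Fin d → ℤ)) (m : ℕ) (prec : (Fin d → ℤ) → (Fin d → ℤ) → Prop)
    (s : ℤ) (J : Finset (Fin d → ℤ)) : Finset (Fin d → ℤ) :=
  T.filter fun i => i ∈ nbhd T m J ∨ (rk T m prec i J : ℤ) ≤ s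

namespace Genogram

variable {k : ℕ}

/-- The set `{i_l : l ∈ A(j)}`. -/
def ancestorIndices (G : Genogram k) (i : ℕ → Fin d → ℤ) (j : ℕ) : Finset (Fin d → ℤ) :=
  (G.ancestors j).image i

/-- The inner constraint set `D_j` of the running index `i_j`; it depends on `i` only through
`i_1, …, i_{j-1}`. -/
def D (T : Finset (Fin d → ℤ)) (m : ℕ) (prec : (Fin d → ℤ) → (Fin d → ℤ) → Prop)
    (G : Genogram k) (i : ℕ → Fin d → ℤ) (j : ℕ) : Finset (Fin d → ℤ) :=
  if _h : 1 < j then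
    if 1 ≤ G.s j then
      nbhdRk T m prec (G.s j - 1) (G.ancestorIndices i j) ∪ D T m prec G i (G.g j)
    else D T m prec G i (G.g j)
  else ∅
termination_by j
decreasing_by all_goals exact G.g_lt _h

/-- The outer constraint set `B_j` of the running index `i_j`; it depends on `i` only through
`i_1, …, i_{j-1}`. -/
def B (T : Finset (Fin d → ℤ)) (m : ℕ) (prec : (Fin d → ℤ) → (Fin d → ℤ) → Prop)
    (G : Genogram k) (i : ℕ → Fin d → ℤ) (j : ℕ) : Finset (Fin d → ℤ) :=
  if _h : 1 < j then
    if _hs : 0 ≤ G.s j then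
      nbhdRk T m prec (G.s j) (G.ancestorIndices i j) ∪ D T m prec G i (G.g j)
    else B T m prec G i (G.u j)
  else T
termination_by j
decreasing_by exact G.u_lt _h _hs

end Genogram

/-- The nested sum `∑_{i_1 ∈ C_1} ∑_{i_2 ∈ C_2} ⋯ ∑_{i_n ∈ C_n} F(i_1, …, i_n)`, where `C_j` may
depend on `i_1, …, i_{j-1}`.  Entries of the tuple `i` that are not (yet) running are `0`. -/
def nestedSum (C : ℕ → (ℕ → Fin d → ℤ) → Finset (Fin d → ℤ)) :
    ℕ → ((ℕ → Fin d → ℤ) → ℝ) → ℝ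
  | 0, F => F 0
  | n + 1, F =>
    nestedSum C n fun i => ∑ x ∈ C (n + 1) i, F (Function.update i (n + 1) x)

end Lattice

/-! ## The generalized covariance operator and the operators `ℰ_G` -/

section Operators

variable {Ω : Type*} [MeasurableSpace Ω]

/-- The operator `𝒟`: `𝒟(Y) = Y - E[Y]` and
`𝒟(Y_1, …, Y_t) = Y_1 𝒟(Y_2, …, Y_t) - E[Y_1 𝒟(Y_2, …, Y_t)]`.
(With the convention `1` for the empty sequence, the second rule contains the first.) -/
def opD (P : Measure Ω) : List (Ω → ℝ) → Ω → ℝ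
  | [] => fun _ => 1
  | Y :: L => fun ω => Y ω * opD P L ω - ∫ ω', Y ω' * opD P L ω' ∂P

/-- The generalized covariance `𝒟*`: `𝒟*(Y) = E[Y]` and
`𝒟*(Y_1, …, Y_t) = E[Y_1 𝒟(Y_2, …, Y_t)]`. -/
def opDstar (P : Measure Ω) : List (Ω → ℝ) → ℝ
  | [] => 1
  | Y :: L => ∫ ω, Y ω * opD P L ω ∂P

namespace Genogram

variable {k : ℕ}

/-- `q_0` for the sub-genogram `G[n]`: the largest `j ≤ n` with `j = 1` or `p(j) ≠ j - 1`, the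
label of the first vertex of the last branch. -/
def q₀ (G : Genogram k) (n : ℕ) : ℕ :=
  ((Finset.Icc 1 n).filter fun j => j = 1 ∨ G.p j ≠ j - 1).sup id

theorem q₀_le (G : Genogram k) (n : ℕ) : G.q₀ n ≤ n := by
  unfold q₀
  refine Finset.sup_le fun l hl => ?_
  simp only [Finset.mem_filter, Finset.mem_Icc] at hl
  exact hl.1.2

/-- The arguments `Y_{q_0} ⋯ Y_{q_1 - 1}, Y_{q_1} ⋯ Y_{q_2 - 1}, …, Y_{q_w} ⋯ Y_n` of the last
`𝒟*` factor for `G[n]`, where `q_1 < ⋯ < q_w` are the `t ∈ {q_0 + 1, …, n}` with `s_t ≥ 0`: the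
product with first factor `Y_a` runs over the `t ∈ {a, …, n}` such that none of
`v[a+1], …, v[t]` is nonnegative. -/
def lastBranch (G : Genogram k) (Y : ℕ → Ω → ℝ) (n : ℕ) : List (Ω → ℝ) :=
  (((Finset.Icc (G.q₀ n) n).filter fun a => a = G.q₀ n ∨ 0 ≤ G.s a).sort (· ≤ ·)).map
    fun a => fun ω =>
      ∏ t ∈ (Finset.Icc a n).filter fun t => ∀ r ∈ Finset.Ioc a t, G.s r < 0, Y t ω

/-- `ℰ_{G[n]}(Y_1, …, Y_n)` for the sub-genogram `G[n]` induced by the first `n` vertices: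
`ℰ_{G[q_0 - 1]}(Y_1, …, Y_{q_0 - 1})` (absent if `q_0 = 1`) times the `𝒟*` factor of the last
branch. -/
def opESub (P : Measure Ω) (G : Genogram k) (Y : ℕ → Ω → ℝ) (n : ℕ) : ℝ :=
  if _h : n = 0 then 1
  else opESub P G Y (G.q₀ n - 1) * opDstar P (G.lastBranch Y n)
termination_by n
decreasing_by
  have := G.q₀_le n
  omega

/-- `ℰ_G(Y_1, …, Y_k)`. -/
def opE (P : Measure Ω) (G : Genogram k) (Y : ℕ → Ω → ℝ) : ℝ := opESub P G Y k

end Genogram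

/-! ## The normalized sum and the sums `𝒮(G)` and `𝒰_f(G)` -/

variable {d : ℕ}

/-- `σ = √Var(∑_{i ∈ T} X_i)`. -/
def sigma (P : Measure Ω) (T : Finset (Fin d → ℤ)) (X : (Fin d → ℤ) → Ω → ℝ) : ℝ :=
  √(variance (fun ω => ∑ i ∈ T, X i ω) P)

/-- `W(J) = σ⁻¹ ∑_{i ∈ T \ J} X_i`; in particular `W = W(∅)`. -/
def normSum (P : Measure Ω) (T : Finset (Fin d → ℤ)) (X : (Fin d → ℤ) → Ω → ℝ)
    (J : Finset (Fin d → ℤ)) (ω : Ω) : ℝ :=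
  (sigma P T X)⁻¹ * ∑ i ∈ T \ J, X i ω

/-- The `n`-th cumulant of a real random variable `Y`: the `n`-th derivative at `t = 0` of
`log E[exp(i t Y)]`, divided by `i^n` (a real number whenever `Y` has a finite `n`-th moment). -/
def cumulant (P : Measure Ω) (Y : Ω → ℝ) (n : ℕ) : ℝ :=
  (iteratedDeriv n (fun t : ℝ => Complex.log (charFun (P.map Y) t)) 0 / Complex.I ^ n).re

namespace Genogram

variable {k : ℕ}

/-- `𝒮(G) = σ^{-k} ∑_{i_1 ∈ B_1 \ D_1} ⋯ ∑_{i_k ∈ B_k \ D_k} ℰ_G(X_{i_1}, …, X_{i_k})`. -/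
def S (P : Measure Ω) (T : Finset (Fin d → ℤ)) (X : (Fin d → ℤ) → Ω → ℝ) (m : ℕ)
    (prec : (Fin d → ℤ) → (Fin d → ℤ) → Prop) (G : Genogram k) : ℝ :=
  ((sigma P T X) ^ k)⁻¹ *
    nestedSum (fun j i => G.B T m prec i j \ G.D T m prec i j) k fun i =>
      G.opE P fun j => X (i j)

/-- The adjusted `f`-difference `Δ_f(G)` for `k = |G| ≥ 2`, as a function of
`i_1, …, i_{k-1}`. -/
def fDiff (P : Measure Ω) (T : Finset (Fin d → ℤ)) (X : (Fin d → ℤ) → Ω → ℝ) (m : ℕ)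
    (prec : (Fin d → ℤ) → (Fin d → ℤ) → Prop) (f : ℝ → ℝ) (G : Genogram k)
    (i : ℕ → Fin d → ℤ) (ω : Ω) : ℝ :=
  let x := normSum P T X (G.B T m prec i k) ω
  let y := normSum P T X (G.D T m prec i k) ω
  if G.u k = k then iteratedDeriv (k - 2) f x - iteratedDeriv (k - 2) f y
  else ∫ v in (0 : ℝ)..1, ((k : ℝ) - (G.u k : ℝ)) * v ^ (k - 1 - G.u k) *
    (iteratedDeriv (k - 2) f (v * y + (1 - v) * x) - iteratedDeriv (k - 2) f y)

/-- `𝒰_f(G) = σ^{-(k-1)} ∑_{i_1 ∈ B_1 \ D_1} ⋯ ∑_{i_{k-1} ∈ B_{k-1} \ D_{k-1}}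
ℰ_G(X_{i_1}, …, X_{i_{k-1}}, Δ_f(G))` for `k = |G| ≥ 2`. -/
def U (P : Measure Ω) (T : Finset (Fin d → ℤ)) (X : (Fin d → ℤ) → Ω → ℝ) (m : ℕ)
    (prec : (Fin d → ℤ) → (Fin d → ℤ) → Prop) (f : ℝ → ℝ) (G : Genogram k) : ℝ :=
  ((sigma P T X) ^ (k - 1))⁻¹ *
    nestedSum (fun j i => G.B T m prec i j \ G.D T m prec i j) (k - 1) fun i =>
      G.opE P fun j => if j = k then G.fDiff P T X m prec f i else X (i j)

end Genogram

/-- `κ̃_{k+1} = κ_{k+1}(W) + ∑_{H} k! b_H / (k + 2 - u(k+1, H)) 𝒮(H)`, the sum over the genograms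
`H` of order `k + 1` with at least one positive vertex. -/
def modifiedCumulant (P : Measure Ω) (T : Finset (Fin d → ℤ)) (X : (Fin d → ℤ) → Ω → ℝ) (m : ℕ)
    (prec : (Fin d → ℤ) → (Fin d → ℤ) → Prop) (k : ℕ) : ℝ :=
  cumulant P (normSum P T X ∅) (k + 1) +
    ∑ᶠ H ∈ Genogram.G₀ (k + 1),
      (k.factorial : ℝ) * H.b / ((k : ℝ) + 2 - (H.u (k + 1) : ℝ)) * H.S P T X m prec

/-- The expectations which enter the sums built from `f` and from genograms of order at most
`k + 2` exist: for `l ≤ k`, products of at most `l + 1` of the `X_i` remain integrable after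
multiplication by `f^{(l)}(W(J))`, or by one of the integrals `∫₀¹ v^r f^{(l)}(v W(D) +
(1 - v) W(B)) dv`, `r < l`, which occur in the adjusted `f`-differences. -/
def ExpectationsExist (P : Measure Ω) (T : Finset (Fin d → ℤ)) (X : (Fin d → ℤ) → Ω → ℝ)
    (k : ℕ) (f : ℝ → ℝ) : Prop :=
  ∀ l ≤ k, ∀ n ≤ l + 1, ∀ i : Fin n → Fin d → ℤ, (∀ a, i a ∈ T) →
    (∀ J ⊆ T, Integrable
      (fun ω => (∏ a, X (i a) ω) * iteratedDeriv l f (normSum P T X J ω)) P) ∧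
    (∀ r < l, ∀ B ⊆ T, ∀ D ⊆ B, Integrable
      (fun ω => (∏ a, X (i a) ω) * ∫ v in (0 : ℝ)..1, v ^ r *
        iteratedDeriv l f (v * normSum P T X D ω + (1 - v) * normSum P T X B ω)) P)

end Operators

end

/-!
The identity rests on one expansion step. Fix a genogram `G` of order `n ≥ 2` and indices
`i_1, …, i_{n-1}`.

* The operators `ℰ_G` are linear in their last argument: there is a random variable `A_n`, the
  *weight* of the last vertex, with `ℰ_G(Y_1, …, Y_n) = E[A_n Y_n]`
  (`Genogram.opESub_eq_integral`). If a vertex is added to `G`, the new weight is `A_n Y_n` for a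
  negative child of `v[n]`, the centred variable `A_n Y_n - E[A_n Y_n]` for a nonnegative child, and
  the constant `E[A_n Y_n]` if a new branch starts at an earlier vertex.
* The fundamental theorem of calculus, or an integration by parts if `u(n) < n`, writes the adjusted
  difference `Δ_f(G)` as a sum over `i_n ∈ B_n \ D_n` of `X_{i_n}` times an average of `f^{(n-1)}`
  over the segment between `W(B_n)` and `W(D_n)` (`fDiff_eq`). Splitting off the value
  `f^{(n-1)}(W(D_n))` leaves exactly the adjusted difference of `G` with a negative child of `v[n]`.
* Write `a = A_n X_{i_n}`. The remaining term is `E[a F] = E[(a - E a) F] + E[a] E[F]`, where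
  `F = f^{(n-1)}(W(D_n))`. In the first summand `D_n` is enlarged step by step to `T`, where `F`
  becomes constant; the increments are the terms of the nonnegative children of `v[n]`
  (`sum_slotTerm_child`). In the second summand `D_n` is reduced step by step to the empty set,
  along the path from `v[n]` to the root; the increments are the terms of the new branches
  (`sum_slotTerm_branch`). What is left is `E[a] E[f^{(n-1)}(W)]`, which sums to
  `𝒮(G) E[f^{(n-1)}(W)]`.

The places where a vertex can be added to `G` are exactly the ones met here
(`Genogram.sum_extensions`), and the coefficients `b` are made for the signs and for the factor
`1 / (n + 1 - u(n))`. So `b_G 𝒰_f(G)` is the sum of `b_H 𝒰_f(H)` over the one-vertex extensions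
`H` of `G`, minus `b_G / (n + 1 - u(n)) 𝒮(G) E[f^{(n-1)}(W)]` (`b_mul_U_eq`). Starting with
`E[W f(W)] = ∑_{G ∈ 𝒢(2)} b_G 𝒰_f(G)` and iterating gives the first formula, with coefficients
that do not depend on `f`. They are identified as `κ_{j+1}(W) / j!` by taking `f(x) = x ^ l`: then
the remainder vanishes, and the formula becomes the recursion which determines the cumulants from
the moments (`genogramCoeff_eq_cumulant`). The second formula results if, in the last step, only the
genograms without positive vertex are expanded.

The sums over genograms are carried out over identifiers bounded by a number `M` beyond which
`N^{(s)}(J) = T`; a genogram with a larger identifier contributes nothing, since then `B_j = D_j`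
for some `j`.
-/

noncomputable section

/-! ### Paths to the root -/

namespace Genogram

variable {k n : ℕ}

theorem p_le (G : Genogram k) (a : ℕ) : G.p a ≤ a - 1 := by
  by_cases h : a ∈ Finset.Icc 2 k
  · have := G.p_mem a h
    omega
  · rw [G.p_out a h]
    omega

theorem iterate_p_lt (G : Genogram k) {a : ℕ} (ha : 1 ≤ a) (t : ℕ) : G.p^[t + 1] a < a := by
  induction t with
  | zero =>
    have := G.p_le a
    simp only [zero_add, Function.iterate_one]
    omega
  | succ t ih =>
    rw [Function.iterate_succ_apply']
    have := G.p_le (G.p^[t + 1] a)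
    omega

theorem ancestors_lt (G : Genogram k) {j l : ℕ} (h : l ∈ G.ancestors j) : 1 ≤ l ∧ l < j := by
  simpa using (Finset.mem_filter.1 h).1

theorem ancestors_one (G : Genogram k) : G.ancestors 1 = ∅ := by
  simp [ancestors]

theorem ancestors_eq (G : Genogram k) {j : ℕ} (hj : j ∈ Finset.Icc 2 k) :
    G.ancestors j = insert (G.p j) (G.ancestors (G.p j)) := by
  have hp := G.p_mem j hj
  ext l
  simp only [ancestors, Finset.mem_insert, Finset.mem_filter, Finset.mem_Ico]
  constructor
  · rintro ⟨⟨h1, h2⟩, t, ht⟩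
    cases t with
    | zero => left; simpa using ht.symm
    | succ t =>
      right
      rw [Function.iterate_succ_apply] at ht
      exact ⟨⟨h1, ht ▸ G.iterate_p_lt hp.1 t⟩, t, ht⟩
  · rintro (rfl | ⟨⟨h1, h2⟩, t, ht⟩)
    · exact ⟨hp, 0, rfl⟩
    · refine ⟨⟨h1, by omega⟩, t + 1, ?_⟩
      rw [Function.iterate_succ_apply]
      exact ht

/-- The labels on the path from the root to `v[j]`, both ends included. -/
def lineage (G : Genogram k) (j : ℕ) : Finset ℕ := insert j (G.ancestors j)

theorem mem_lineage_self (G : Genogram k) (j : ℕ) : j ∈ G.lineage j :=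
  Finset.mem_insert_self _ _

theorem lineage_one (G : Genogram k) : G.lineage 1 = {1} := by
  simp [lineage, ancestors_one]

theorem lineage_eq (G : Genogram k) {j : ℕ} (hj : j ∈ Finset.Icc 2 k) :
    G.lineage j = insert j (G.lineage (G.p j)) := by
  rw [lineage, ancestors_eq G hj, lineage]

theorem ancestors_eq_lineage (G : Genogram k) {j : ℕ} (hj : j ∈ Finset.Icc 2 k) :
    G.ancestors j = G.lineage (G.p j) := by
  rw [ancestors_eq G hj, lineage]

theorem lineage_bounds (G : Genogram k) {j c : ℕ} (hj : 1 ≤ j) (h : c ∈ G.lineage j) :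
    1 ≤ c ∧ c ≤ j := by
  rcases Finset.mem_insert.1 h with rfl | h
  · exact ⟨hj, le_rfl⟩
  · have := G.ancestors_lt h
    omega

/-- Every statement about labels that passes from parents to children holds for all labels. -/
theorem parent_induction (G : Genogram k) {C : ℕ → Prop} (h1 : C 1)
    (hs : ∀ j ∈ Finset.Icc 2 k, C (G.p j) → C j) {j : ℕ} (hj : j ∈ Finset.Icc 1 k) : C j := by
  induction j using Nat.strong_induction_on with
  | _ j ih =>
    rw [Finset.mem_Icc] at hj
    by_cases h : j = 1
    · rw [h]; exact h1
    · have hj' : j ∈ Finset.Icc 2 k := Finset.mem_Icc.2 (by omega)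
      have := G.p_mem j hj'
      exact hs j hj' (ih _ this.2 (Finset.mem_Icc.2 (by omega)))

theorem parent_mem_lineage (G : Genogram k) {j c : ℕ} (hj : j ∈ Finset.Icc 1 k)
    (hc : c ∈ G.lineage j) (h2 : 2 ≤ c) : G.p c ∈ G.lineage j := by
  revert hc
  refine G.parent_induction (C := fun j => c ∈ G.lineage j → G.p c ∈ G.lineage j) ?_ ?_ hj
  · rw [lineage_one, Finset.mem_singleton]; omega
  · intro j hj ih hc
    rw [G.lineage_eq hj, Finset.mem_insert] at hc ⊢
    rcases hc with rfl | hc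
    · exact Or.inr (G.mem_lineage_self _)
    · exact Or.inr (ih hc)

/-- Depth-first labelling: all vertices labelled after a vertex `c` on the path to `v[j]`, up to
`v[j]` itself, are descendants of `v[c]`; in particular their parents are not labelled before
`c`. -/
theorem le_parent_of_mem_lineage (G : Genogram k) {j c h : ℕ} (hj : j ∈ Finset.Icc 1 k)
    (hc : c ∈ G.lineage j) (hch : c < h) (hhj : h ≤ j) : c ≤ G.p h := by
  revert hc hch hhj h
  refine G.parent_induction
    (C := fun j => ∀ {h}, c ∈ G.lineage j → c < h → h ≤ j → c ≤ G.p h) ?_ ?_ hj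
  · intro h hc h1 h2
    rw [lineage_one, Finset.mem_singleton] at hc
    omega
  · intro j hj ih h hc h1 h2
    rw [G.lineage_eq hj, Finset.mem_insert] at hc
    rcases hc with rfl | hc
    · omega
    have hp := G.p_mem j hj
    rw [Finset.mem_Icc] at hj
    by_cases hh : h ≤ G.p j
    · exact ih hc h1 hh
    · have hcp := (G.lineage_bounds hp.1 hc).2
      have hg := (G.depth_first (h - 1) (by omega) (by omega)).2
        (show G.p j ∈ _ from ⟨by omega, j, Finset.mem_Icc.2 (by omega), rfl⟩)
      rw [show h - 1 + 1 = h by omega] at hg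
      omega

/-- If no vertex labelled after `q`, up to `j`, has its parent labelled before `q`, then the path
from `v[j]` to the root passes through a child of `v[q]`. -/
theorem exists_child_of_forall_le (G : Genogram k) {j q : ℕ} (hj : j ∈ Finset.Icc 1 k)
    (hq : 1 ≤ q) (hqj : q < j) (hall : ∀ h, q < h → h ≤ j → q ≤ G.p h) :
    ∃ c ∈ G.lineage j, 2 ≤ c ∧ G.p c = q := by
  revert hqj hall
  refine G.parent_induction (C := fun j => q < j → (∀ h, q < h → h ≤ j → q ≤ G.p h) →
    ∃ c ∈ G.lineage j, 2 ≤ c ∧ G.p c = q) ?_ ?_ hj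
  · omega
  · intro j hj ih hqj hall
    have hp := G.p_mem j hj
    rcases (hall j hqj le_rfl).eq_or_lt with h | h
    · exact ⟨j, G.mem_lineage_self j, by omega, h.symm⟩
    · obtain ⟨c, hc, h2, hcq⟩ := ih h fun h h1 h2 => hall h h1 (by omega)
      exact ⟨c, by rw [G.lineage_eq hj]; exact Finset.mem_insert_of_mem hc, h2, hcq⟩

/-- A vertex on the path to the last vertex has the smallest identifier among its siblings. -/
theorem s_le_of_sibling (G : Genogram n) {c h : ℕ} (hn : 1 ≤ n) (hc : c ∈ G.lineage n)
    (h2 : 2 ≤ c) (hh : h ∈ Finset.Icc 2 n) (hp : G.p h = G.p c) : h ≤ c ∧ G.s c ≤ G.s h := by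
  have hcn := (G.lineage_bounds hn hc).2
  have hcm : c ∈ Finset.Icc 2 n := Finset.mem_Icc.2 ⟨h2, hcn⟩
  have hpc := G.p_mem c hcm
  have hle : h ≤ c := by
    by_contra hlt
    have := G.le_parent_of_mem_lineage (Finset.mem_Icc.2 ⟨hn, le_rfl⟩) hc (not_le.1 hlt)
      (Finset.mem_Icc.1 hh).2
    omega
  refine ⟨hle, ?_⟩
  rcases hle.eq_or_lt with rfl | hlt
  · exact le_rfl
  · exact ((G.sibling_order h hh c hcm hlt.ne hp).2 hlt).le

/-! ### Recursions along the parent map -/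

theorem g_eq (G : Genogram k) {j : ℕ} (hj : j ∈ Finset.Icc 2 k) :
    G.g j = if 1 ≤ G.s (G.p j) then G.p j else G.g (G.p j) := by
  have hp := G.p_mem j hj
  unfold g
  rw [ancestors_eq G hj, Finset.filter_insert]
  split_ifs with h
  · refine le_antisymm (Finset.sup_le fun l hl => ?_) ?_
    · simp only [Finset.mem_insert, Finset.mem_filter] at hl
      rcases hl with rfl | rfl | ⟨hl, -⟩
      · exact hp.1
      · exact le_rfl
      · exact (G.ancestors_lt hl).2.le
    · exact Finset.le_sup (f := id) (by simp : G.p j ∈ _)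
  · rfl

theorem g_one (G : Genogram k) : G.g 1 = 1 := by simp [g, ancestors_one]

theorem u_of_nonneg (G : Genogram k) {j : ℕ} (hs : 0 ≤ G.s j) : G.u j = j := by
  unfold u
  refine le_antisymm (Finset.sup_le fun l hl => ?_) ?_
  · simp only [Finset.mem_insert, Finset.mem_filter] at hl
    rcases hl with ⟨rfl | hl, -⟩
    · exact le_rfl
    · exact (G.ancestors_lt hl).2.le
  · exact Finset.le_sup (f := id) (by simp [hs] : j ∈ _)

theorem u_of_neg (G : Genogram k) {j : ℕ} (hj : j ∈ Finset.Icc 2 k) (hs : ¬ 0 ≤ G.s j) :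
    G.u j = G.u (G.p j) := by
  unfold u
  rw [Finset.filter_insert, if_neg hs, ancestors_eq G hj]

theorem u_one (G : Genogram k) : G.u 1 = 1 := G.u_of_nonneg G.s_root.ge

theorem two_le_u (G : Genogram k) {j : ℕ} (hj : j ∈ Finset.Icc 2 k) : 2 ≤ G.u j ∧ G.u j ≤ j := by
  have hj1 : j ∈ Finset.Icc 1 k := by rw [Finset.mem_Icc] at hj ⊢; omega
  have h2 : 2 ≤ j := (Finset.mem_Icc.1 hj).1
  clear hj
  revert h2
  refine G.parent_induction (C := fun j => 2 ≤ j → 2 ≤ G.u j ∧ G.u j ≤ j) (by omega) ?_ hj1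
  intro j hj ih h2
  by_cases hs : 0 ≤ G.s j
  · rw [G.u_of_nonneg hs]; omega
  · rw [G.u_of_neg hj hs]
    have hp := G.p_mem j hj
    have hp1 : G.p j ≠ 1 := fun h => hs (G.s_child_root j hj h)
    have := ih (by omega)
    omega

section

variable {d : ℕ} (T : Finset (Fin d → ℤ)) (m : ℕ) (prec : (Fin d → ℤ) → (Fin d → ℤ) → Prop)

theorem D_one (G : Genogram k) (i : ℕ → Fin d → ℤ) : G.D T m prec i 1 = ∅ := by
  rw [D]; simp

theorem B_one (G : Genogram k) (i : ℕ → Fin d → ℤ) : G.B T m prec i 1 = T := by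
  rw [B]; simp

/-- The progenitor can be replaced by the parent in the recursion for the inner sets. -/
theorem D_g (G : Genogram k) (i : ℕ → Fin d → ℤ) {j : ℕ} (hj : j ∈ Finset.Icc 2 k) :
    G.D T m prec i (G.g j) = G.D T m prec i (G.p j) := by
  have hp := G.p_mem j hj
  rw [g_eq G hj]
  split_ifs with h
  · rfl
  · rcases hp.1.eq_or_lt with h1 | h1
    · rw [← h1, g_one]
    · conv_rhs => rw [D]
      rw [dif_pos h1, if_neg h]

theorem D_eq (G : Genogram k) (i : ℕ → Fin d → ℤ) {j : ℕ} (hj : j ∈ Finset.Icc 2 k) :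
    G.D T m prec i j =
      if 1 ≤ G.s j then
        nbhdRk T m prec (G.s j - 1) (G.ancestorIndices i j) ∪ G.D T m prec i (G.p j)
      else G.D T m prec i (G.p j) := by
  conv_lhs => rw [D]
  rw [dif_pos (by rw [Finset.mem_Icc] at hj; omega), D_g T m prec G i hj]

theorem B_u (G : Genogram k) (i : ℕ → Fin d → ℤ) {j : ℕ} (hj : j ∈ Finset.Icc 1 k) :
    G.B T m prec i (G.u j) = G.B T m prec i j := by
  rw [Finset.mem_Icc] at hj
  by_cases hs : 0 ≤ G.s j
  · rw [G.u_of_nonneg hs]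
  · have h1 : 1 < j := by
      rcases hj.1.eq_or_lt with h | h
      · rw [← h, G.s_root] at hs; exact absurd le_rfl hs
      · exact h
    conv_rhs => rw [B]
    rw [dif_pos h1, dif_neg hs]

theorem B_eq (G : Genogram k) (i : ℕ → Fin d → ℤ) {j : ℕ} (hj : j ∈ Finset.Icc 2 k) :
    G.B T m prec i j =
      if 0 ≤ G.s j then
        nbhdRk T m prec (G.s j) (G.ancestorIndices i j) ∪ G.D T m prec i (G.p j)
      else G.B T m prec i (G.p j) := by
  have hp := G.p_mem j hj
  have hj2 := Finset.mem_Icc.1 hj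
  conv_lhs => rw [B]
  rw [dif_pos (by omega), D_g T m prec G i hj]
  split_ifs with hs
  · rfl
  · rw [G.u_of_neg hj hs, B_u T m prec G i (Finset.mem_Icc.2 (by omega))]

theorem nbhdRk_subset (s : ℤ) (J : Finset (Fin d → ℤ)) : nbhdRk T m prec s J ⊆ T :=
  Finset.filter_subset _ _

theorem nbhdRk_mono {s t : ℤ} (h : s ≤ t) (J : Finset (Fin d → ℤ)) :
    nbhdRk T m prec s J ⊆ nbhdRk T m prec t J := by
  intro x
  simp only [nbhdRk, Finset.mem_filter]
  rintro ⟨h1, h2⟩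
  exact ⟨h1, h2.imp_right fun h' => h'.trans h⟩

theorem D_subset (G : Genogram k) (i : ℕ → Fin d → ℤ) {j : ℕ} (hj : j ∈ Finset.Icc 1 k) :
    G.D T m prec i j ⊆ T := by
  refine G.parent_induction (C := fun j => G.D T m prec i j ⊆ T) ?_ ?_ hj
  · rw [D_one]; exact Finset.empty_subset _
  · intro j hj ih
    rw [D_eq T m prec G i hj]
    split_ifs
    · exact Finset.union_subset (nbhdRk_subset _ _ _ _ _) ih
    · exact ih

theorem B_subset (G : Genogram k) (i : ℕ → Fin d → ℤ) {j : ℕ} (hj : j ∈ Finset.Icc 1 k) :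
    G.B T m prec i j ⊆ T := by
  refine G.parent_induction (C := fun j => G.B T m prec i j ⊆ T) ?_ ?_ hj
  · rw [B_one]
  · intro j hj ih
    rw [B_eq T m prec G i hj]
    have hp := G.p_mem j hj
    rw [Finset.mem_Icc] at hj
    split_ifs
    · exact Finset.union_subset (nbhdRk_subset _ _ _ _ _)
        (D_subset T m prec G i (Finset.mem_Icc.2 (by omega)))
    · exact ih

theorem D_subset_B (G : Genogram k) (i : ℕ → Fin d → ℤ) {j : ℕ} (hj : j ∈ Finset.Icc 1 k) :
    G.D T m prec i j ⊆ G.B T m prec i j := by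
  refine G.parent_induction (C := fun j => G.D T m prec i j ⊆ G.B T m prec i j) ?_ ?_ hj
  · rw [D_one]; exact Finset.empty_subset _
  · intro j hj ih
    rw [B_eq T m prec G i hj, D_eq T m prec G i hj]
    split_ifs with h1 h2
    · exact Finset.union_subset_union_left (nbhdRk_mono _ _ _ (by omega) _)
    · omega
    · exact Finset.subset_union_right
    · exact ih

/-- The constraint sets at `j` depend on the first vertices of the genogram and on the indices
before `j` only. -/
theorem constraints_congr {k' : ℕ} (G : Genogram k) (G' : Genogram k') (hn : n ≤ k) (hn' : n ≤ k')
    (hp : ∀ j ≤ n, G.p j = G'.p j) (hs : ∀ j ≤ n, G.s j = G'.s j) {j : ℕ}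
    (hj : j ∈ Finset.Icc 1 n) :
    G.lineage j = G'.lineage j ∧ G.u j = G'.u j ∧
    ∀ i i' : ℕ → Fin d → ℤ, (∀ l ∈ Finset.Ico 1 j, i l = i' l) →
      G.ancestorIndices i j = G'.ancestorIndices i' j ∧
      G.D T m prec i j = G'.D T m prec i' j ∧ G.B T m prec i j = G'.B T m prec i' j := by
  induction j using Nat.strong_induction_on with
  | _ j ih =>
  rw [Finset.mem_Icc] at hj
  by_cases h1 : j = 1
  · subst h1
    simp only [lineage_one, u_one, D_one, B_one, ancestorIndices, ancestors_one]
    simp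
  have hjk : j ∈ Finset.Icc 2 k := Finset.mem_Icc.2 (by omega)
  have hjk' : j ∈ Finset.Icc 2 k' := Finset.mem_Icc.2 (by omega)
  have hpj := G.p_mem j hjk
  obtain ⟨ih1, ih2, ih3⟩ := ih (G.p j) hpj.2 (Finset.mem_Icc.2 (by omega))
  have hpe := hp j hj.2
  have hse := hs j hj.2
  refine ⟨?_, ?_, ?_⟩
  · rw [G.lineage_eq hjk, G'.lineage_eq hjk', ih1, hpe]
  · by_cases h0 : 0 ≤ G.s j
    · rw [G.u_of_nonneg h0, G'.u_of_nonneg (hse ▸ h0)]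
    · rw [G.u_of_neg hjk h0, G'.u_of_neg hjk' (hse ▸ h0), ih2, hpe]
  · intro i i' hi
    obtain ⟨-, h4, h5⟩ := ih3 i i' fun l hl => hi l (by rw [Finset.mem_Ico] at hl ⊢; omega)
    have h3 : G.ancestorIndices i j = G'.ancestorIndices i' j := by
      unfold ancestorIndices
      rw [G.ancestors_eq_lineage hjk, G'.ancestors_eq_lineage hjk', ih1, ← hpe, ← ih1]
      refine Finset.image_congr fun l hl => hi l ?_
      have := G.lineage_bounds hpj.1 hl
      rw [Finset.mem_Ico]; omega
    refine ⟨h3, ?_, ?_⟩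
    · rw [D_eq T m prec G i hjk, D_eq T m prec G' i' hjk', h3, h4, hpe, hse]
    · rw [B_eq T m prec G i hjk, B_eq T m prec G' i' hjk', h3, h4, h5, hpe, hse]

end

/-! ### Removing and adding the last vertex -/

/-- The genogram induced on all vertices but the last one. -/
def restrict (G : Genogram (n + 1)) : Genogram n where
  p j := if j ≤ n then G.p j else 0
  s j := if j ≤ n then G.s j else 0
  p_out j hj := by
    split_ifs with h
    · refine G.p_out j fun h' => hj ?_
      rw [Finset.mem_Icc] at h' ⊢; omega
    · rfl
  s_out j hj := by
    split_ifs with h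
    · refine G.s_out j fun h' => hj ?_
      rw [Finset.mem_Icc] at h' ⊢; omega
    · rfl
  p_mem j hj := by
    rw [Finset.mem_Icc] at hj
    rw [if_pos hj.2]
    exact G.p_mem j (Finset.mem_Icc.2 (by omega))
  s_root := by
    split_ifs
    · exact G.s_root
    · rfl
  s_ge j hj := by
    rw [Finset.mem_Icc] at hj
    rw [if_pos hj.2]
    exact G.s_ge j (Finset.mem_Icc.2 (by omega))
  s_child_root j hj := by
    rw [Finset.mem_Icc] at hj
    rw [if_pos hj.2, if_pos hj.2]
    exact G.s_child_root j (Finset.mem_Icc.2 (by omega))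
  s_siblings j hj h hh := by
    rw [Finset.mem_Icc] at hj hh
    rw [if_pos hj.2, if_pos hj.2, if_pos hh.2, if_pos hh.2]
    exact G.s_siblings j (Finset.mem_Icc.2 (by omega)) h (Finset.mem_Icc.2 (by omega))
  depth_first j h1 h2 := by
    rw [if_pos h2]
    obtain ⟨ha, hb⟩ := G.depth_first j h1 (by omega)
    refine ⟨⟨ha.1, j + 1, Finset.mem_Icc.2 (by omega), if_pos h2⟩, ?_⟩
    rintro q ⟨hq, l, hl, rfl⟩
    rw [Finset.mem_Icc] at hl
    rw [if_pos hl.2] at hq ⊢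
    exact hb ⟨hq, l, Finset.mem_Icc.2 (by omega), rfl⟩
  sibling_order j hj h hh := by
    rw [Finset.mem_Icc] at hj hh
    rw [if_pos hj.2, if_pos hj.2, if_pos hh.2, if_pos hh.2]
    exact G.sibling_order j (Finset.mem_Icc.2 (by omega)) h (Finset.mem_Icc.2 (by omega))

theorem restrict_p (G : Genogram (n + 1)) {j : ℕ} (hj : j ≤ n) : G.restrict.p j = G.p j :=
  if_pos hj

theorem restrict_s (G : Genogram (n + 1)) {j : ℕ} (hj : j ≤ n) : G.restrict.s j = G.s j :=
  if_pos hj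

/-- The places at which a last vertex can be added to a genogram: as a child of the last vertex,
or as a child of an earlier vertex on the path to the last vertex, with an identifier that is
nonnegative and smaller than that of the child `v[c]` on this path. -/
def IsSlot (G : Genogram n) (q : ℕ) (s : ℤ) : Prop :=
  (q = n ∧ -1 ≤ s ∧ (n = 1 → 0 ≤ s)) ∨ ∃ c ∈ G.lineage n, 2 ≤ c ∧ G.p c = q ∧ 0 ≤ s ∧ s < G.s c

/-- The last vertex of a genogram occupies one of the admissible places. -/
theorem isSlot_last (G : Genogram (n + 1)) (hn : 1 ≤ n) :
    G.restrict.IsSlot (G.p (n + 1)) (G.s (n + 1)) := by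
  have hlast : n + 1 ∈ Finset.Icc 2 (n + 1) := Finset.mem_Icc.2 (by omega)
  have hp := G.p_mem _ hlast
  by_cases hq : G.p (n + 1) = n
  · exact Or.inl ⟨hq, G.s_ge _ hlast, fun h => G.s_child_root _ hlast (by omega)⟩
  · right
    obtain ⟨c, hc, h2, hcp⟩ := G.restrict.exists_child_of_forall_le (j := n) (q := G.p (n + 1))
      (Finset.mem_Icc.2 ⟨hn, le_rfl⟩) hp.1 (by omega) (by
        intro h h1 h2
        rw [G.restrict_p h2]
        have := (G.depth_first (h - 1) (by omega) (by omega)).2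
          (show G.p (n + 1) ∈ _ from ⟨by omega, n + 1, Finset.mem_Icc.2 (by omega), rfl⟩)
        rwa [show h - 1 + 1 = h by omega] at this)
    have hcn := (G.restrict.lineage_bounds hn hc).2
    have hcm : c ∈ Finset.Icc 2 (n + 1) := Finset.mem_Icc.2 (by omega)
    rw [G.restrict_p hcn] at hcp
    refine ⟨c, hc, h2, by rw [G.restrict_p hcn, hcp], ?_, ?_⟩
    · exact (G.s_siblings _ hlast c hcm (by omega) hcp.symm).1
    · rw [G.restrict_s hcn]
      exact (G.sibling_order c hcm _ hlast (by omega) hcp).2 (by omega)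

/-- Every admissible place can be filled. -/
theorem exists_extension (G : Genogram n) (hn : 1 ≤ n) {q : ℕ} {s : ℤ} (h : G.IsSlot q s) :
    ∃ G' : Genogram (n + 1), G'.restrict = G ∧ G'.p (n + 1) = q ∧ G'.s (n + 1) = s := by
  have hnn : n ∈ Finset.Icc 1 n := Finset.mem_Icc.2 ⟨hn, le_rfl⟩
  have hq : q ∈ G.lineage n := by
    rcases h with ⟨rfl, -⟩ | ⟨c, hc, h2, rfl, -⟩
    · exact G.mem_lineage_self _
    · exact G.parent_mem_lineage hnn hc h2
  have hqb := G.lineage_bounds hn hq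
  have hsge : -1 ≤ s := by
    rcases h with ⟨-, h, -⟩ | ⟨c, hc, h2, -, h, -⟩ <;> omega
  have hroot : q = 1 → 0 ≤ s := by
    rcases h with ⟨rfl, -, h⟩ | ⟨c, hc, h2, -, h, -⟩
    · exact h
    · exact fun _ => h
  -- an older sibling of the new vertex has a larger identifier
  have hsib : ∀ j ∈ Finset.Icc 2 n, G.p j = q → 0 ≤ s ∧ s < G.s j := by
    intro j hj hjq
    rcases h with ⟨rfl, -, -⟩ | ⟨c, hc, h2, rfl, h0, hlt⟩
    · have := G.p_mem j hj
      rw [Finset.mem_Icc] at hj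
      omega
    · exact ⟨h0, hlt.trans_le (G.s_le_of_sibling hn hc h2 hj hjq).2⟩
  have key : ∀ j, j ∈ Finset.Icc 2 (n + 1) → j = n + 1 ∨ (j ≠ n + 1 ∧ j ∈ Finset.Icc 2 n) := by
    intro j hj
    rw [Finset.mem_Icc] at hj
    rw [Finset.mem_Icc]
    omega
  refine ⟨{ p := fun j => if j = n + 1 then q else G.p j
            s := fun j => if j = n + 1 then s else G.s j
            p_out := ?_, s_out := ?_, p_mem := ?_, s_root := ?_, s_ge := ?_, s_child_root := ?_
            s_siblings := ?_, depth_first := ?_, sibling_order := ?_ }, ?_, ?_, ?_⟩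
  · intro j hj
    rw [Finset.mem_Icc] at hj
    rw [if_neg (by omega)]
    exact G.p_out j (by rw [Finset.mem_Icc]; omega)
  · intro j hj
    rw [Finset.mem_Icc] at hj
    rw [if_neg (by omega)]
    exact G.s_out j (by rw [Finset.mem_Icc]; omega)
  · intro j hj
    rcases key j hj with rfl | ⟨h1, h2⟩
    · rw [if_pos rfl]; omega
    · rw [if_neg h1]; exact G.p_mem j h2
  · rw [if_neg (by omega)]; exact G.s_root
  · intro j hj
    rcases key j hj with rfl | ⟨h1, h2⟩
    · rw [if_pos rfl]; exact hsge
    · rw [if_neg h1]; exact G.s_ge j h2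
  · intro j hj
    rcases key j hj with rfl | ⟨h1, h2⟩
    · rw [if_pos rfl, if_pos rfl]; exact hroot
    · rw [if_neg h1, if_neg h1]; exact G.s_child_root j h2
  · intro j hj h hh hne heq
    rcases key j hj with rfl | ⟨h1, h2⟩ <;> rcases key h hh with rfl | ⟨h3, h4⟩
    · exact absurd rfl hne
    · rw [if_pos rfl, if_neg h3] at heq ⊢
      have := hsib h h4 heq.symm
      exact ⟨this.1, this.2.ne⟩
    · rw [if_neg h1, if_pos rfl] at heq ⊢
      have := hsib j h2 heq
      exact ⟨this.1.trans this.2.le, this.2.ne'⟩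
    · rw [if_neg h1, if_neg h3] at heq ⊢
      exact G.s_siblings j h2 h h4 hne heq
  · intro j h1 h2
    by_cases hjn : j = n
    · subst hjn
      rw [if_pos rfl]
      refine ⟨⟨hqb.2, j + 1, Finset.mem_Icc.2 (by omega), if_pos rfl⟩, ?_⟩
      rintro r ⟨-, l, hl, rfl⟩
      rw [Finset.mem_Icc] at hl
      rw [if_pos (by omega)]
    · rw [if_neg (by omega)]
      obtain ⟨ha, hb⟩ := G.depth_first j h1 (by omega)
      refine ⟨⟨ha.1, j + 1, Finset.mem_Icc.2 (by omega), if_neg (by omega)⟩, ?_⟩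
      rintro r ⟨hr, l, hl, rfl⟩
      rw [Finset.mem_Icc] at hl
      by_cases hln : l = n + 1
      · rw [if_pos hln] at hr ⊢
        exact G.le_parent_of_mem_lineage hnn hq (by omega) (by omega)
      · rw [if_neg hln] at hr ⊢
        exact hb ⟨hr, l, Finset.mem_Icc.2 (by omega), rfl⟩
  · intro j hj h hh hne heq
    rcases key j hj with rfl | ⟨h1, h2⟩ <;> rcases key h hh with rfl | ⟨h3, h4⟩
    · exact absurd rfl hne
    · rw [if_pos rfl, if_neg h3] at heq ⊢
      have := hsib h h4 heq.symm
      rw [Finset.mem_Icc] at h4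
      constructor <;> intro <;> omega
    · rw [if_neg h1, if_pos rfl] at heq ⊢
      have := hsib j h2 heq
      rw [Finset.mem_Icc] at h2
      constructor <;> intro <;> omega
    · rw [if_neg h1, if_neg h3] at heq ⊢
      exact G.sibling_order j h2 h h4 hne heq
  · ext j
    · by_cases hj : j ≤ n
      · rw [restrict_p _ hj]
        exact if_neg (by omega)
      · rw [p_out _ j (by rw [Finset.mem_Icc]; omega), G.p_out j (by rw [Finset.mem_Icc]; omega)]
    · by_cases hj : j ≤ n
      · rw [restrict_s _ hj]
        exact if_neg (by omega)
      · rw [s_out _ j (by rw [Finset.mem_Icc]; omega), G.s_out j (by rw [Finset.mem_Icc]; omega)]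
  · exact if_pos rfl
  · exact if_pos rfl

theorem eq_of_restrict_eq {G G' : Genogram (n + 1)} (h : G.restrict = G'.restrict)
    (hp : G.p (n + 1) = G'.p (n + 1)) (hs : G.s (n + 1) = G'.s (n + 1)) : G = G' := by
  ext j
  · rcases le_or_gt j n with hj | hj
    · rw [← G.restrict_p hj, ← G'.restrict_p hj, h]
    · rcases (Nat.succ_le_of_lt hj).eq_or_lt with rfl | hj'
      · exact hp
      · rw [G.p_out j (by rw [Finset.mem_Icc]; omega), G'.p_out j (by rw [Finset.mem_Icc]; omega)]
  · rcases le_or_gt j n with hj | hj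
    · rw [← G.restrict_s hj, ← G'.restrict_s hj, h]
    · rcases (Nat.succ_le_of_lt hj).eq_or_lt with rfl | hj'
      · exact hs
      · rw [G.s_out j (by rw [Finset.mem_Icc]; omega), G'.s_out j (by rw [Finset.mem_Icc]; omega)]

/-! ### The coefficients `b` -/

theorem leaves_child (G : Genogram (n + 1)) (hn : 1 ≤ n) (hp : G.p (n + 1) = n) :
    G.leaves = G.restrict.leaves := by
  unfold leaves
  refine Finset.card_nbij' (fun j => if j = n + 1 then n else j)
    (fun j => if j = n then n + 1 else j) ?_ ?_ ?_ ?_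
  all_goals
    intro j hj
    simp only [Finset.coe_filter, Set.mem_ofPred_eq, Finset.mem_Icc] at hj ⊢
  · split_ifs with h
    · refine ⟨by omega, fun l hl => ?_⟩
      rw [restrict_p _ hl.2]
      have := G.p_mem l (Finset.mem_Icc.2 (by omega))
      omega
    · refine ⟨by omega, fun l hl => ?_⟩
      rw [restrict_p _ hl.2]
      exact hj.2 l (by omega)
  · split_ifs with h
    · refine ⟨by omega, fun l hl => ?_⟩
      have := G.p_mem l (Finset.mem_Icc.2 (by omega))
      omega
    · refine ⟨by omega, fun l hl => ?_⟩
      by_cases hln : l = n + 1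
      · rw [hln, hp]; exact fun h' => h h'.symm
      · rw [← restrict_p G (by omega : l ≤ n)]
        exact hj.2 l (by omega)
  · have := hj.2 (n + 1) (by omega)
    split_ifs <;> omega
  · split_ifs <;> omega

theorem leaves_branch (G : Genogram (n + 1)) (hn : 1 ≤ n) (hp : G.p (n + 1) ≠ n) :
    G.leaves = G.restrict.leaves + 1 := by
  unfold leaves
  have hp1 := G.p_mem (n + 1) (Finset.mem_Icc.2 (by omega))
  rw [← Finset.card_insert_of_notMem (a := n + 1) (by simp)]
  congr 1
  ext j
  simp only [Finset.mem_insert, Finset.mem_filter, Finset.mem_Icc]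
  constructor
  · rintro ⟨h1, h2⟩
    by_cases hj : j = n + 1
    · exact Or.inl hj
    · refine Or.inr ⟨by omega, fun h hh => ?_⟩
      rw [restrict_p _ hh.2]
      exact h2 h (by omega)
  · rintro (rfl | ⟨h1, h2⟩)
    · refine ⟨by omega, fun h hh => ?_⟩
      have := G.p_mem h (Finset.mem_Icc.2 (by omega))
      omega
    · refine ⟨by omega, fun h hh => ?_⟩
      by_cases hh' : h = n + 1
      · -- the parent of the new vertex is not a leaf, since the vertex labelled next is its child
        subst hh'
        rintro rfl
        have hd := G.depth_first (G.p (n + 1)) (by omega) (by omega)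
        have h3 := hd.1.1
        have h4 := hd.2 (show G.p (n + 1) ∈ _ from
          ⟨le_rfl, n + 1, Finset.mem_Icc.2 (by omega), rfl⟩)
        refine h2 (G.p (n + 1) + 1) (by omega) ?_
        rw [restrict_p _ (by omega)]
        omega
      · rw [← restrict_p G (by omega : h ≤ n)]
        exact h2 h (by omega)

theorem negatives_eq (G : Genogram (n + 1)) :
    G.negatives = G.restrict.negatives + if G.s (n + 1) = -1 then 1 else 0 := by
  have h1 : (Finset.Icc 1 n).filter (fun j => G.s j = -1) =
      (Finset.Icc 1 n).filter (fun j => G.restrict.s j = -1) :=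
    Finset.filter_congr fun j hj => by rw [restrict_s _ (Finset.mem_Icc.1 hj).2]
  unfold negatives
  rw [← Finset.insert_Icc_right_eq_Icc_add_one (by omega), Finset.filter_insert, h1]
  split_ifs
  · rw [Finset.card_insert_of_notMem (by simp)]
  · rw [add_zero]

theorem u_restrict (G : Genogram (n + 1)) {j : ℕ} (hj : j ∈ Finset.Icc 1 n) :
    G.u j = G.restrict.u j :=
  -- `u` does not depend on the lattice, so the empty index set serves
  (constraints_congr (d := 0) ∅ 0 (fun _ _ => False) G G.restrict (by omega) le_rfl
    (fun _ h => (G.restrict_p h).symm) (fun _ h => (G.restrict_s h).symm) hj).2.1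

/-- Adding a vertex multiplies the coefficient by `1 / (n + 1 - u(n))`, up to a sign: negative
vertices and new branches change the sign. -/
theorem b_eq (G : Genogram (n + 1)) (hn : 2 ≤ n) :
    G.b = (if G.p (n + 1) = n ∧ 0 ≤ G.s (n + 1) then 1 else -1) *
      (G.restrict.b / ((n : ℝ) + 1 - G.restrict.u n)) := by
  unfold b
  have hsn := G.isSlot_last (by omega)
  have hprod : ∏ j ∈ Finset.Icc 2 (n + 1 - 1), 1 / ((j : ℝ) + 1 - (G.u j : ℝ)) =
      (∏ j ∈ Finset.Icc 2 (n - 1), 1 / ((j : ℝ) + 1 - (G.restrict.u j : ℝ))) *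
        (1 / ((n : ℝ) + 1 - G.restrict.u n)) := by
    obtain ⟨n, rfl⟩ : ∃ m, n = m + 1 := ⟨n - 1, by omega⟩
    rw [Nat.add_sub_cancel, Nat.add_sub_cancel, Finset.prod_Icc_succ_top (by omega)]
    congr 1
    · refine Finset.prod_congr rfl fun j hj => ?_
      rw [Finset.mem_Icc] at hj
      rw [u_restrict G (Finset.mem_Icc.2 (by omega))]
    · rw [u_restrict G (Finset.mem_Icc.2 (by omega))]
  rw [hprod, negatives_eq]
  by_cases hp : G.p (n + 1) = n
  · rw [leaves_child G (by omega) hp]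
    by_cases hs : 0 ≤ G.s (n + 1)
    · rw [if_pos (show _ ∧ _ from ⟨hp, hs⟩), if_neg (by omega : ¬ G.s (n + 1) = -1)]
      ring
    · have := G.s_ge (n + 1) (Finset.mem_Icc.2 (by omega))
      rw [if_neg (fun h : _ ∧ _ => hs h.2), if_pos (by omega : G.s (n + 1) = -1)]
      ring
  · have hs : 0 ≤ G.s (n + 1) := by
      rcases hsn with ⟨h, -⟩ | ⟨c, -, -, -, h, -⟩
      · exact absurd h hp
      · exact h
    rw [leaves_branch G (by omega) hp, if_neg (fun h : _ ∧ _ => hp h.1),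
      if_neg (by omega : ¬ G.s (n + 1) = -1)]
    ring

end Genogram

/-! ### The operators `ℰ_G` as weighted expectations -/

/-- The product of the random variables `Y t`, `t ∈ S`. -/
def blockProd {Ω : Type*} (Y : ℕ → Ω → ℝ) (S : Finset ℕ) (ω : Ω) : ℝ := ∏ t ∈ S, Y t ω

theorem blockProd_union {Ω : Type*} {Y : ℕ → Ω → ℝ} {S S' : Finset ℕ} (h : Disjoint S S') (ω : Ω) :
    blockProd Y (S ∪ S') ω = blockProd Y S ω * blockProd Y S' ω :=
  Finset.prod_union h

theorem blockProd_singleton {Ω : Type*} (Y : ℕ → Ω → ℝ) (j : ℕ) : blockProd Y {j} = Y j := by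
  funext ω
  exact Finset.prod_singleton _ _

section Lists

variable {Ω : Type*} [MeasurableSpace Ω] {P : Measure Ω} {Y : ℕ → Ω → ℝ} {U : Finset ℕ}

/-- `𝒟(Y_1, …, Y_t)` is a linear combination of the products `Y_1 ⋯ Y_j`, so that only products of
the variables have to be integrable. -/
theorem integrable_blockProd_mul_opD (hU : ∀ S ⊆ U, Integrable (blockProd Y S) P) :
    ∀ (L : List (Finset ℕ)) (R : Finset ℕ), (R :: L).Pairwise Disjoint → (∀ S ∈ R :: L, S ⊆ U) →
      Integrable (fun ω => blockProd Y R ω * opD P (L.map (blockProd Y)) ω) P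
  | [], R, _, hs => by
    simpa [opD] using hU R (hs R (by simp))
  | S :: L, R, hd, hs => by
    have hR := hs R (by simp)
    have hS := hs S (by simp)
    rw [List.pairwise_cons, List.pairwise_cons] at hd
    have hRS : Disjoint R S := hd.1 S (by simp)
    have h1 := integrable_blockProd_mul_opD hU L (R ∪ S)
      (List.pairwise_cons.2 ⟨fun S' hS' =>
        Finset.disjoint_union_left.2 ⟨hd.1 S' (by simp [hS']), hd.2.1 S' hS'⟩, hd.2.2⟩)
      (by
        intro S' hS'
        rcases List.mem_cons.1 hS' with rfl | h
        · exact Finset.union_subset hR hS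
        · exact hs S' (by simp [h]))
    refine (h1.sub ((hU R hR).mul_const
      (∫ ω', blockProd Y S ω' * opD P (L.map (blockProd Y)) ω' ∂P))).congr
      (Filter.Eventually.of_forall fun ω => ?_)
    simp only [Pi.sub_apply, blockProd_union hRS, List.map_cons, opD]
    ring

/-- Merging the last two arguments of `𝒟` and `𝒟*` costs the expectation of the last argument
times the operator without it. -/
theorem opD_append_pair (hU : ∀ S ⊆ U, Integrable (blockProd Y S) P) (S S' : Finset ℕ) :
    ∀ L : List (Finset ℕ), (L ++ [S, S']).Pairwise Disjoint → (∀ R ∈ L ++ [S, S'], R ⊆ U) →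
      opDstar P ((L ++ [S, S']).map (blockProd Y)) =
        opDstar P ((L ++ [S ∪ S']).map (blockProd Y)) -
          (∫ ω, blockProd Y S' ω ∂P) * opDstar P ((L ++ [S]).map (blockProd Y)) ∧
      ∀ ω, opD P ((L ++ [S, S']).map (blockProd Y)) ω =
        opD P ((L ++ [S ∪ S']).map (blockProd Y)) ω -
          (∫ ω, blockProd Y S' ω ∂P) * opD P ((L ++ [S]).map (blockProd Y)) ω
  | [], hd, hs => by
    have hdis : Disjoint S S' := by simpa using hd
    have hS := hs S (by simp)
    have hS' := hs S' (by simp)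
    have h1 := hU _ (Finset.union_subset hS hS')
    have h2 := hU _ hS
    have key : ∫ ω, blockProd Y S ω * (blockProd Y S' ω - ∫ ω', blockProd Y S' ω' ∂P) ∂P =
        (∫ ω, blockProd Y (S ∪ S') ω ∂P) -
          (∫ ω', blockProd Y S' ω' ∂P) * ∫ ω, blockProd Y S ω ∂P := by
      rw [← integral_const_mul, ← integral_sub h1 (h2.const_mul _)]
      refine integral_congr_ae (Filter.Eventually.of_forall fun ω => ?_)
      simp only [blockProd_union hdis]
      ring
    constructor
    · simpa [opDstar, opD] using key
    · intro ω
      simp only [List.nil_append, List.map_cons, List.map_nil, opD, mul_one, key,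
        blockProd_union hdis]
      ring
  | R :: L, hd, hs => by
    rw [List.cons_append, List.pairwise_cons] at hd
    have hs' : ∀ R ∈ L ++ [S, S'], R ⊆ U := fun R' h => hs R' (by
      rw [List.cons_append]; exact List.mem_cons_of_mem _ h)
    obtain ⟨-, ih⟩ := opD_append_pair hU S S' L hd.2 hs'
    have hRU : R ⊆ U := hs R (by simp)
    have hSU : S ⊆ U := hs' S (by simp)
    have hSU' : S' ⊆ U := hs' S' (by simp)
    have hdL := List.pairwise_append.1 hd.2
    have h1 : Integrable (fun ω => blockProd Y R ω *
        opD P ((L ++ [S ∪ S']).map (blockProd Y)) ω) P := by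
      refine integrable_blockProd_mul_opD hU _ _ ?_ ?_
      · refine List.pairwise_cons.2 ⟨?_, List.pairwise_append.2 ⟨hdL.1, by simp, ?_⟩⟩
        · intro A hA
          rcases List.mem_append.1 hA with h | h
          · exact hd.1 A (by simp [h])
          · rw [List.mem_singleton.1 h]
            exact Finset.disjoint_union_right.2 ⟨hd.1 S (by simp), hd.1 S' (by simp)⟩
        · intro A hA B hB
          rw [List.mem_singleton.1 hB]
          exact Finset.disjoint_union_right.2
            ⟨hdL.2.2 A hA S (by simp), hdL.2.2 A hA S' (by simp)⟩
      · intro A hA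
        rcases List.mem_cons.1 hA with rfl | hA
        · exact hRU
        rcases List.mem_append.1 hA with h | h
        · exact hs' A (by simp [h])
        · rw [List.mem_singleton.1 h]
          exact Finset.union_subset hSU hSU'
    have h2 : Integrable (fun ω => blockProd Y R ω *
        opD P ((L ++ [S]).map (blockProd Y)) ω) P := by
      refine integrable_blockProd_mul_opD hU _ _ ?_ ?_
      · refine List.pairwise_cons.2 ⟨?_, List.pairwise_append.2 ⟨hdL.1, by simp, ?_⟩⟩
        · intro A hA
          refine hd.1 A ?_
          simp only [List.mem_append, List.mem_cons] at hA ⊢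
          tauto
        · intro A hA B hB
          rw [List.mem_singleton.1 hB]
          exact hdL.2.2 A hA S (by simp)
      · intro A hA
        rcases List.mem_cons.1 hA with rfl | hA
        · exact hRU
        refine hs' A ?_
        simp only [List.mem_append, List.mem_cons] at hA ⊢
        tauto
    have key : ∫ ω, blockProd Y R ω * opD P ((L ++ [S, S']).map (blockProd Y)) ω ∂P =
        (∫ ω, blockProd Y R ω * opD P ((L ++ [S ∪ S']).map (blockProd Y)) ω ∂P) -
        (∫ ω, blockProd Y S' ω ∂P) *
          ∫ ω, blockProd Y R ω * opD P ((L ++ [S]).map (blockProd Y)) ω ∂P := by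
      rw [← integral_const_mul, ← integral_sub h1 (h2.const_mul _)]
      refine integral_congr_ae (Filter.Eventually.of_forall fun ω => ?_)
      simp only [ih]
      ring
    constructor
    · simpa only [List.cons_append, List.map_cons, opDstar] using key
    · intro ω
      simp only [List.cons_append, List.map_cons, opD]
      rw [key, ih]
      ring

end Lists

namespace Genogram

variable {k n : ℕ}

/-- The labels of the last branch of `G[n]`, cut before each nonnegative vertex: the sets of
labels whose products are the arguments of the last factor `𝒟*`. -/
def blocks (G : Genogram k) (n : ℕ) : List (Finset ℕ) :=
  (((Finset.Icc (G.q₀ n) n).filter fun a => a = G.q₀ n ∨ 0 ≤ G.s a).sort (· ≤ ·)).map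
    fun a => (Finset.Icc a n).filter fun t => ∀ r ∈ Finset.Ioc a t, G.s r < 0

theorem lastBranch_eq_blocks {Ω : Type*} (G : Genogram k) (Y : ℕ → Ω → ℝ) (n : ℕ) :
    G.lastBranch Y n = (G.blocks n).map (blockProd Y) := by
  unfold lastBranch blocks
  rw [List.map_map]
  rfl

theorem q₀_new (G : Genogram k) (h : n = 0 ∨ G.p (n + 1) ≠ n) : G.q₀ (n + 1) = n + 1 := by
  refine le_antisymm (G.q₀_le _) ?_
  unfold q₀
  refine Finset.le_sup (f := id) ?_
  rw [Finset.mem_filter, Finset.mem_Icc]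
  refine ⟨by omega, ?_⟩
  rcases h with rfl | h
  · simp
  · right; simpa using h

theorem q₀_child (G : Genogram k) (hn : 1 ≤ n) (h : G.p (n + 1) = n) :
    G.q₀ (n + 1) = G.q₀ n := by
  unfold q₀
  rw [← Finset.insert_Icc_right_eq_Icc_add_one (by omega), Finset.filter_insert, if_neg]
  rintro (h' | h')
  · omega
  · rw [h] at h'; omega

theorem q₀_pos (G : Genogram k) (hn : 1 ≤ n) : 1 ≤ G.q₀ n := by
  unfold q₀
  refine Finset.le_sup (f := id) (b := 1) ?_
  rw [Finset.mem_filter, Finset.mem_Icc]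
  exact ⟨⟨le_rfl, hn⟩, Or.inl rfl⟩

theorem blocks_new (G : Genogram k) (h : n = 0 ∨ G.p (n + 1) ≠ n) :
    G.blocks (n + 1) = [{n + 1}] := by
  unfold blocks
  rw [q₀_new G h, Finset.Icc_self, Finset.filter_singleton, if_pos (Or.inl rfl),
    Finset.sort_singleton, List.map_singleton, Finset.Icc_self, Finset.filter_singleton, if_pos]
  simp

theorem sort_insert_top (s : Finset ℕ) (a : ℕ) (h : ∀ b ∈ s, b < a) :
    (insert a s).sort (· ≤ ·) = s.sort (· ≤ ·) ++ [a] := by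
  have ha : a ∉ s := fun h' => lt_irrefl _ (h a h')
  refine List.Perm.eq_of_pairwise (le := (· ≤ ·)) (fun _ _ _ _ => le_antisymm)
    (Finset.pairwise_sort _ _) ?_ ?_
  · refine List.pairwise_append.2 ⟨Finset.pairwise_sort _ _, by simp, ?_⟩
    intro x hx y hy
    rw [List.mem_singleton.1 hy]
    exact (h x ((Finset.mem_sort _).1 hx)).le
  · refine (List.perm_ext_iff_of_nodup (Finset.sort_nodup _ _) ?_).2 ?_
    · refine List.nodup_append.2 ⟨Finset.sort_nodup _ _, by simp, ?_⟩
      intro x hx y hy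
      rw [List.mem_singleton.1 hy]
      exact (h x ((Finset.mem_sort _).1 hx)).ne
    · intro x
      simp [or_comm]

theorem blocks_nonneg (G : Genogram k) (hn : 1 ≤ n) (hp : G.p (n + 1) = n)
    (hs : 0 ≤ G.s (n + 1)) : G.blocks (n + 1) = G.blocks n ++ [{n + 1}] := by
  unfold blocks
  have hq := G.q₀_le n
  rw [q₀_child G hn hp, ← Finset.insert_Icc_right_eq_Icc_add_one (by omega),
    Finset.filter_insert, if_pos (Or.inr hs), sort_insert_top, List.map_append]
  · congr 1
    · refine List.map_congr_left fun a ha => ?_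
      rw [Finset.mem_sort, Finset.mem_filter, Finset.mem_Icc] at ha
      ext t
      simp only [Finset.mem_filter, Finset.mem_Icc, Finset.mem_Ioc]
      constructor
      · rintro ⟨h1, h2⟩
        refine ⟨⟨h1.1, ?_⟩, h2⟩
        by_contra ht
        have := h2 (n + 1) (by omega)
        omega
      · rintro ⟨h1, h2⟩
        exact ⟨by omega, h2⟩
    · rw [List.map_singleton, Finset.Icc_self, Finset.filter_singleton, if_pos]
      simp
  · intro b hb
    rw [Finset.mem_filter, Finset.mem_Icc] at hb
    omega

theorem blocks_neg (G : Genogram k) (hn : 1 ≤ n) (hp : G.p (n + 1) = n)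
    (hs : G.s (n + 1) < 0) :
    G.blocks (n + 1) = (G.blocks n).map fun S => if n ∈ S then insert (n + 1) S else S := by
  unfold blocks
  have hq := G.q₀_le n
  have hq1 := G.q₀_pos hn
  rw [q₀_child G hn hp, ← Finset.insert_Icc_right_eq_Icc_add_one (by omega),
    Finset.filter_insert, if_neg (by omega), List.map_map]
  refine List.map_congr_left fun a ha => ?_
  rw [Finset.mem_sort, Finset.mem_filter, Finset.mem_Icc] at ha
  have hiff : (∀ r ∈ Finset.Ioc a (n + 1), G.s r < 0) ↔ ∀ r ∈ Finset.Ioc a n, G.s r < 0 := by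
    simp only [Finset.mem_Ioc]
    constructor
    · intro h r hr
      exact h r (by omega)
    · intro h r hr
      by_cases hrn : r = n + 1
      · rw [hrn]; exact hs
      · exact h r (by omega)
  simp only [Function.comp]
  rw [← Finset.insert_Icc_right_eq_Icc_add_one (by omega : a ≤ n + 1), Finset.filter_insert]
  simp only [hiff, Finset.mem_filter, Finset.mem_Icc, ha.1.2, le_refl, and_self, true_and]

/-- The blocks of a branch are disjoint, and the last one contains the last label. -/
theorem exists_blocks_eq_append (G : Genogram k) (hn : 1 ≤ n) :
    ∃ (L : List (Finset ℕ)) (S : Finset ℕ), G.blocks n = L ++ [S] ∧ n ∈ S ∧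
      (L ++ [S]).Pairwise Disjoint ∧ ∀ R ∈ L ++ [S], R ⊆ Finset.Icc 1 n := by
  induction n, hn using Nat.le_induction with
  | base =>
    exact ⟨[], {1}, by rw [List.nil_append]; exact blocks_new G (Or.inl rfl), by simp, by simp,
      by simp⟩
  | succ n hn ih =>
    by_cases hp : G.p (n + 1) = n
    swap
    · refine ⟨[], {n + 1}, by rw [List.nil_append]; exact blocks_new G (Or.inr hp), by simp,
        by simp, by simp⟩
    obtain ⟨L, S, hL, hnS, hd, hsub⟩ := ih
    have hsub' : ∀ R ∈ L ++ [S], R ⊆ Finset.Icc 1 (n + 1) := fun R hR =>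
      (hsub R hR).trans (Finset.Icc_subset_Icc_right (by omega))
    have hnot : ∀ R ∈ L ++ [S], n + 1 ∉ R := fun R hR h => by
      have := Finset.mem_Icc.1 (hsub R hR h)
      omega
    by_cases hs : 0 ≤ G.s (n + 1)
    · refine ⟨L ++ [S], {n + 1}, by rw [blocks_nonneg G hn hp hs, hL], by simp, ?_, ?_⟩
      · refine List.pairwise_append.2 ⟨hd, by simp, ?_⟩
        intro R hR R' hR'
        rw [List.mem_singleton.1 hR', Finset.disjoint_singleton_right]
        exact hnot R hR
      · intro R hR
        rcases List.mem_append.1 hR with h | h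
        · exact hsub' R h
        · rw [List.mem_singleton.1 h]; simp
    · obtain ⟨hd1, -, hd2⟩ := List.pairwise_append.1 hd
      refine ⟨L, insert (n + 1) S, ?_, by simp, ?_, ?_⟩
      · rw [blocks_neg G hn hp (not_le.1 hs), hL, List.map_append]
        congr 1
        · conv_rhs => rw [← List.map_id L]
          refine List.map_congr_left fun R hR => ?_
          rw [if_neg, id]
          exact fun h => Finset.disjoint_left.1 (hd2 R hR S (by simp)) h hnS
        · rw [List.map_singleton, if_pos hnS]
      · refine List.pairwise_append.2 ⟨hd1, by simp, ?_⟩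
        intro R hR R' hR'
        rw [List.mem_singleton.1 hR', Finset.disjoint_insert_right]
        exact ⟨hnot R (by simp [hR]), hd2 R hR S (by simp)⟩
      · intro R hR
        rcases List.mem_append.1 hR with h | h
        · exact hsub' R (by simp [h])
        · rw [List.mem_singleton.1 h]
          exact Finset.insert_subset (by simp) (hsub' S (by simp))

section

variable {Ω : Type*} [MeasurableSpace Ω] (P : Measure Ω)

theorem opESub_zero (G : Genogram k) (Y : ℕ → Ω → ℝ) : G.opESub P Y 0 = 1 := by
  rw [opESub, dif_pos rfl]

theorem opESub_pos (G : Genogram k) (Y : ℕ → Ω → ℝ) (hn : 1 ≤ n) :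
    G.opESub P Y n = G.opESub P Y (G.q₀ n - 1) *
      opDstar P ((G.blocks n).map (blockProd Y)) := by
  rw [opESub, dif_neg (by omega), lastBranch_eq_blocks]

theorem opESub_congr (G : Genogram k) {Y Y' : ℕ → Ω → ℝ} (h : ∀ j ∈ Finset.Icc 1 n, Y j = Y' j) :
    G.opESub P Y n = G.opESub P Y' n := by
  induction n using Nat.strong_induction_on with
  | _ n ih =>
  rcases Nat.eq_zero_or_pos n with rfl | hn
  · rw [opESub_zero, opESub_zero]
  have hq := G.q₀_le n
  have hq1 := G.q₀_pos hn
  rw [opESub_pos P G Y hn, opESub_pos P G Y' hn]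
  congr 1
  · refine ih _ (by omega) fun j hj => h j ?_
    rw [Finset.mem_Icc] at hj ⊢; omega
  · congr 1
    obtain ⟨L, S, hL, -, -, hsub⟩ := G.exists_blocks_eq_append hn
    rw [hL]
    refine List.map_congr_left fun R hR => ?_
    funext ω
    exact Finset.prod_congr rfl fun t ht => by rw [h t (hsub R hR ht)]

/-- The weight `A_n` with `ℰ_G(Y_1, …, Y_n) = E[A_n Y_n]`, a function of `Y_1, …, Y_{n-1}`.
Passing to the next vertex multiplies it by `Y_n`, followed by centring if the new vertex is a
nonnegative child of `v[n]`, and by taking the expectation if it starts a new branch. Labels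
begin with `1`; the value at `0` is irrelevant. -/
def weight (G : Genogram k) (Y : ℕ → Ω → ℝ) : ℕ → Ω → ℝ
  | 0 => fun _ => 1
  | n + 1 =>
    if n = 0 then fun _ => 1
    else if G.p (n + 1) = n then
      if 0 ≤ G.s (n + 1) then
        fun ω => weight G Y n ω * Y n ω - ∫ ω', weight G Y n ω' * Y n ω' ∂P
      else fun ω => weight G Y n ω * Y n ω
    else fun _ => ∫ ω', weight G Y n ω' * Y n ω' ∂P

theorem weight_congr {k' : ℕ} (G : Genogram k) (G' : Genogram k')
    {Y Y' : ℕ → Ω → ℝ} (hp : ∀ j ≤ n, G.p j = G'.p j) (hs : ∀ j ≤ n, G.s j = G'.s j)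
    (hY : ∀ j ∈ Finset.Ico 1 n, Y j = Y' j) :
    G.weight P Y n = G'.weight P Y' n := by
  induction n with
  | zero => rfl
  | succ n ih =>
    rw [weight, weight]
    split_ifs with h0 h1 h2 h3 h4 h5
    · rfl
    all_goals first
      | (exfalso; rw [hp _ le_rfl] at h1; contradiction)
      | (exfalso; rw [hs _ le_rfl] at h2; contradiction)
      | rw [ih (fun j hj => hp j (by omega)) (fun j hj => hs j (by omega))
          (fun j hj => hY j (by rw [Finset.mem_Ico] at hj ⊢; omega)),
          hY n (by rw [Finset.mem_Ico]; omega)]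

variable {P}

/-- A random variable can be multiplied with the weight if it can be multiplied with the products
of the `Y_j` which the weight consists of. -/
theorem integrable_weight_mul (G : Genogram k) {Y : ℕ → Ω → ℝ} {Z : Ω → ℝ}
    (h : ∀ S ⊆ Finset.Ico 1 n, Integrable (fun ω => blockProd Y S ω * Z ω) P) :
    Integrable (fun ω => G.weight P Y n ω * Z ω) P := by
  induction n generalizing Z with
  | zero =>
    have := h ∅ (by simp)
    simpa [weight, blockProd] using this
  | succ n ih =>
    have hZ : Integrable Z P := by simpa [blockProd] using h ∅ (by simp)
    by_cases h0 : n = 0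
    · subst h0
      simpa [weight] using hZ
    have h2 : Integrable (fun ω => G.weight P Y n ω * (Y n ω * Z ω)) P := by
      refine ih fun S hS => ?_
      have hnS : n ∉ S := fun h => by simpa using hS h
      refine (h (insert n S) ?_).congr (Filter.Eventually.of_forall fun ω => ?_)
      · refine Finset.insert_subset (by simp; omega) (hS.trans ?_)
        exact Finset.Ico_subset_Ico_right (by omega)
      · simp only [blockProd, Finset.prod_insert hnS]
        ring
    rw [weight, if_neg h0]
    split_ifs
    · refine (h2.sub (hZ.const_mul (∫ ω', G.weight P Y n ω' * Y n ω' ∂P))).congr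
        (Filter.Eventually.of_forall fun ω => ?_)
      simp only [Pi.sub_apply]
      ring
    · refine h2.congr (Filter.Eventually.of_forall fun ω => ?_)
      simp only []
      ring
    · exact hZ.const_mul _

/-- `ℰ_G(Y_1, …, Y_n) = E[A_n Y_n]`. A negative vertex merges `Y_n` and `Y_{n+1}` into one variable;
for a nonnegative child this merging overcounts by the product of the expectations, which is the
effect of centring; a new branch gives that product itself. -/
theorem opESub_eq_integral (G : Genogram k) (hn : 1 ≤ n) {Y : ℕ → Ω → ℝ}
    (hY : ∀ S ⊆ Finset.Icc 1 n, Integrable (blockProd Y S) P) :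
    G.opESub P Y n = ∫ ω, G.weight P Y n ω * Y n ω ∂P := by
  induction n, hn using Nat.le_induction generalizing Y with
  | base =>
    rw [opESub_pos P G Y le_rfl, q₀_new G (Or.inl rfl), blocks_new G (Or.inl rfl)]
    simp [opESub_zero, opDstar, opD, weight, blockProd]
  | succ n hn ih =>
    have hsub : Finset.Icc 1 n ⊆ Finset.Icc 1 (n + 1) := Finset.Icc_subset_Icc_right (by omega)
    have ihY := ih fun S hS => hY S (hS.trans hsub)
    rw [weight, if_neg (by omega), opESub_pos P G Y (by omega)]
    by_cases hp : G.p (n + 1) = n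
    swap
    · rw [if_neg hp, q₀_new G (Or.inr hp), blocks_new G (Or.inr hp), Nat.add_sub_cancel, ihY,
        integral_const_mul]
      simp [opDstar, opD, blockProd]
    rw [if_pos hp, q₀_child G hn hp]
    obtain ⟨L, S, hL, hnS, hd, hLs⟩ := G.exists_blocks_eq_append hn
    obtain ⟨-, -, hd2⟩ := List.pairwise_append.1 hd
    have hnot : ∀ R ∈ L ++ [S], n + 1 ∉ R := fun R hR h => by
      have := Finset.mem_Icc.1 (hLs R hR h)
      omega
    -- merging the last two variables into one
    set Y' : ℕ → Ω → ℝ := Function.update Y n fun ω => Y n ω * Y (n + 1) ω with hY'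
    have hne : ∀ j, j ≠ n → Y' j = Y j := fun j hj => Function.update_of_ne hj _ _
    have hprod : ∀ R, n ∉ R → blockProd Y' R = blockProd Y R := fun R hR => by
      funext ω
      exact Finset.prod_congr rfl fun t ht => by rw [hne t fun h => hR (h ▸ ht)]
    have hprodn : ∀ R, n ∈ R → n + 1 ∉ R → blockProd Y' R = blockProd Y (insert (n + 1) R) := by
      intro R hR hR'
      funext ω
      unfold blockProd
      rw [Finset.prod_insert hR', ← Finset.mul_prod_erase R _ hR, ← Finset.mul_prod_erase R _ hR,
        Finset.prod_congr rfl fun t ht => by rw [hne t (Finset.ne_of_mem_erase ht)], hY',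
        Function.update_self]
      ring
    have ih' : G.opESub P Y (G.q₀ n - 1) *
        opDstar P ((L ++ [insert (n + 1) S]).map (blockProd Y)) =
        ∫ ω, G.weight P Y n ω * Y n ω * Y (n + 1) ω ∂P := by
      have h := ih (Y := Y') fun R hR => by
        by_cases hnR : n ∈ R
        · rw [hprodn R hnR fun h => by simpa using hR h]
          exact hY _ (Finset.insert_subset (by simp) (hR.trans hsub))
        · rw [hprod R hnR]
          exact hY _ (hR.trans hsub)
      have hq := G.q₀_pos hn
      have hq' := G.q₀_le n
      have hmap : (L ++ [S]).map (blockProd Y') = (L ++ [insert (n + 1) S]).map (blockProd Y) := by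
        rw [List.map_append, List.map_append]
        congr 1
        · refine List.map_congr_left fun R hR => hprod R fun h => ?_
          exact Finset.disjoint_left.1 (hd2 R hR S (by simp)) h hnS
        · rw [List.map_singleton, List.map_singleton, hprodn S hnS (hnot S (by simp))]
      rw [opESub_pos P G Y' hn, hL, hmap, opESub_congr P G (Y' := Y) (fun j hj => hne j (by
        rw [Finset.mem_Icc] at hj; omega)), weight_congr P G G (Y' := Y) (fun _ _ => rfl)
        (fun _ _ => rfl) (fun j hj => hne j (by rw [Finset.mem_Ico] at hj; omega))] at h
      rw [h]
      refine integral_congr_ae (Filter.Eventually.of_forall fun ω => ?_)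
      simp only [hY', Function.update_self]
      ring
    by_cases hs : 0 ≤ G.s (n + 1)
    swap
    · rw [if_neg hs, ← ih', blocks_neg G hn hp (not_le.1 hs), hL, List.map_append]
      congr 4
      · conv_rhs => rw [← List.map_id L]
        refine List.map_congr_left fun R hR => ?_
        rw [if_neg, id]
        exact fun h => Finset.disjoint_left.1 (hd2 R hR S (by simp)) h hnS
      · rw [List.map_singleton, if_pos hnS]
    · rw [if_pos hs, blocks_nonneg G hn hp hs, hL, List.append_assoc, List.singleton_append,
        (opD_append_pair hY S {n + 1} L ?_ ?_).1]
      · have hi : Integrable (fun ω => G.weight P Y n ω * Y n ω * Y (n + 1) ω) P := by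
          simp only [mul_assoc]
          refine G.integrable_weight_mul fun R hR => ?_
          have h1 : n ∉ R := fun h => by simpa using hR h
          have h2 : n + 1 ∉ R := fun h => by simpa using hR h
          refine (hY (insert n (insert (n + 1) R)) ?_).congr
            (Filter.Eventually.of_forall fun ω => ?_)
          · intro t ht
            simp only [Finset.mem_insert] at ht
            rw [Finset.mem_Icc]
            rcases ht with rfl | rfl | ht
            · omega
            · omega
            · have := Finset.mem_Ico.1 (hR ht)
              omega
          · unfold blockProd
            rw [Finset.prod_insert (by simp [h1]), Finset.prod_insert h2]
            ring
        have hi1 : Integrable (Y (n + 1)) P := by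
          simpa only [blockProd_singleton] using hY {n + 1} (by simp)
        rw [Finset.union_comm, ← Finset.insert_eq, mul_sub, ih', mul_left_comm, ← hL,
          ← opESub_pos P G Y hn, ihY]
        simp only [sub_mul]
        rw [integral_sub hi (hi1.const_mul _), integral_const_mul]
        simp [blockProd, mul_comm]
      · rw [show L ++ [S, {n + 1}] = (L ++ [S]) ++ [{n + 1}] by simp]
        refine List.pairwise_append.2 ⟨hd, by simp, ?_⟩
        intro R hR R' hR'
        rw [List.mem_singleton.1 hR', Finset.disjoint_singleton_right]
        exact hnot R hR
      · intro R hR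
        rw [show L ++ [S, {n + 1}] = (L ++ [S]) ++ [{n + 1}] by simp] at hR
        rcases List.mem_append.1 hR with h | h
        · exact (hLs R h).trans hsub
        · rw [List.mem_singleton.1 h]; simp

end

end Genogram

/-! ### Nested sums -/

section NestedSum

variable {d n : ℕ} {C C' : ℕ → (ℕ → Fin d → ℤ) → Finset (Fin d → ℤ)} {T : Finset (Fin d → ℤ)}
  {F F' : (ℕ → Fin d → ℤ) → ℝ}

theorem update_mem_of_mem {i : ℕ → Fin d → ℤ} (hi : ∀ l ∈ Finset.Icc 1 n, i l ∈ T)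
    {x : Fin d → ℤ} (hx : x ∈ T) :
    ∀ l ∈ Finset.Icc 1 (n + 1), Function.update i (n + 1) x l ∈ T := by
  intro l hl
  rw [Finset.mem_Icc] at hl
  by_cases h : l = n + 1
  · rw [h, Function.update_self]; exact hx
  · rw [Function.update_of_ne h]
    exact hi l (Finset.mem_Icc.2 (by omega))

theorem nestedSum_congr (hC : ∀ j ∈ Finset.Icc 1 n, ∀ i, C j i ⊆ T)
    (hCC : ∀ j ∈ Finset.Icc 1 n, ∀ i, C j i = C' j i)
    (hF : ∀ i, (∀ l ∈ Finset.Icc 1 n, i l ∈ T) → F i = F' i) :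
    nestedSum C n F = nestedSum C' n F' := by
  induction n generalizing F F' with
  | zero => exact hF 0 (by simp)
  | succ n ih =>
    have hsub : Finset.Icc 1 n ⊆ Finset.Icc 1 (n + 1) := Finset.Icc_subset_Icc_right (by omega)
    refine ih (fun j hj => hC j (hsub hj)) (fun j hj => hCC j (hsub hj)) fun i hi => ?_
    rw [hCC _ (by simp)]
    refine Finset.sum_congr rfl fun x hx => hF _ (update_mem_of_mem hi ?_)
    rw [← hCC _ (by simp)] at hx
    exact hC _ (by simp) i hx

theorem nestedSum_eq_zero (hC : ∀ j ∈ Finset.Icc 1 n, ∀ i, C j i ⊆ T)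
    {j : ℕ} (hj : j ∈ Finset.Icc 1 n)
    (h0 : ∀ i, (∀ l ∈ Finset.Ico 1 j, i l ∈ T) → C j i = ∅) : nestedSum C n F = 0 := by
  induction n generalizing F with
  | zero => simp at hj
  | succ n ih =>
    have hsub : Finset.Icc 1 n ⊆ Finset.Icc 1 (n + 1) := Finset.Icc_subset_Icc_right (by omega)
    rw [Finset.mem_Icc] at hj
    by_cases hjn : j = n + 1
    · subst hjn
      rw [nestedSum]
      have : ∀ n, nestedSum C n (fun _ => (0 : ℝ)) = 0 := fun n => by
        induction n with
        | zero => rfl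
        | succ n ih => simpa [nestedSum] using ih
      rw [← this n]
      refine nestedSum_congr (T := T) (fun j hj => hC j (hsub hj)) (fun _ _ _ => rfl) fun i hi => ?_
      rw [h0 i fun l hl => hi l (by rw [Finset.mem_Ico] at hl; rw [Finset.mem_Icc]; omega),
        Finset.sum_empty]
    · exact ih (fun j hj => hC j (hsub hj)) (Finset.mem_Icc.2 (by omega))

theorem nestedSum_finsetSum {ι : Type*} (s : Finset ι) (F : ι → (ℕ → Fin d → ℤ) → ℝ) :
    nestedSum C n (fun i => ∑ a ∈ s, F a i) = ∑ a ∈ s, nestedSum C n (F a) := by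
  induction n generalizing F with
  | zero => rfl
  | succ n ih =>
    simp only [nestedSum]
    rw [← ih]
    congr 1
    funext i
    exact Finset.sum_comm

theorem nestedSum_const_mul (c : ℝ) : nestedSum C n (fun i => c * F i) = c * nestedSum C n F := by
  induction n generalizing F with
  | zero => rfl
  | succ n ih =>
    simp only [nestedSum]
    rw [← ih]
    congr 1
    funext i
    exact (Finset.mul_sum _ _ _).symm

theorem nestedSum_add :
    nestedSum C n (fun i => F i + F' i) = nestedSum C n F + nestedSum C n F' := by
  induction n generalizing F F' with
  | zero => rfl
  | succ n ih =>
    simp only [nestedSum]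
    rw [← ih]
    congr 1
    funext i
    exact Finset.sum_add_distrib

end NestedSum

/-! ### Integrability of products -/

section Integrability

variable {Ω : Type*} [MeasurableSpace Ω] (P : Measure Ω) {d : ℕ} (T : Finset (Fin d → ℤ))
  (X : (Fin d → ℤ) → Ω → ℝ)

/-- The random variable `Z` is still integrable after multiplication by at most `r` of the
`X_i`, `i ∈ T`. -/
def IntegrableMul (r : ℕ) (Z : Ω → ℝ) : Prop :=
  ∀ n ≤ r, ∀ i : Fin n → Fin d → ℤ, (∀ a, i a ∈ T) →
    Integrable (fun ω => (∏ a, X (i a) ω) * Z ω) P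

variable {P T X} {r : ℕ} {Z Z' : Ω → ℝ}

theorem IntegrableMul.integrable (h : IntegrableMul P T X r Z) : Integrable Z P := by
  simpa using h 0 (Nat.zero_le _) Fin.elim0 fun a => a.elim0

theorem IntegrableMul.mono {r' : ℕ} (h : IntegrableMul P T X r Z) (hr : r' ≤ r) :
    IntegrableMul P T X r' Z := fun n hn => h n (hn.trans hr)

theorem IntegrableMul.blockProd_mul (h : IntegrableMul P T X r Z) {i : ℕ → Fin d → ℤ} {S : Finset ℕ}
    (hS : S.card ≤ r) (hi : ∀ j ∈ S, i j ∈ T) :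
    Integrable (fun ω => blockProd (fun j => X (i j)) S ω * Z ω) P := by
  refine (h S.card hS (fun a => i (S.equivFin.symm a)) fun a => hi _ (S.equivFin.symm a).2).congr
    (Filter.Eventually.of_forall fun ω => ?_)
  refine congrArg (· * Z ω) ?_
  exact (S.equivFin.symm.prod_comp fun t : S => X (i t) ω).trans
    (Finset.prod_coe_sort S fun t => X (i t) ω)

theorem IntegrableMul.factor_mul (h : IntegrableMul P T X (r + 1) Z) {x : Fin d → ℤ}
    (hx : x ∈ T) : IntegrableMul P T X r (fun ω => X x ω * Z ω) := by
  intro n hn i hi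
  refine (h (n + 1) (by omega) (Fin.cons x i) (Fin.cases hx hi)).congr
    (Filter.Eventually.of_forall fun ω => ?_)
  simp only [Fin.prod_univ_succ, Fin.cons_zero, Fin.cons_succ]
  ring

theorem IntegrableMul.const_mul (h : IntegrableMul P T X r Z) (c : ℝ) :
    IntegrableMul P T X r (fun ω => c * Z ω) := by
  intro n hn i hi
  refine ((h n hn i hi).const_mul c).congr (Filter.Eventually.of_forall fun ω => ?_)
  simp only []
  ring

theorem IntegrableMul.sub (h : IntegrableMul P T X r Z) (h' : IntegrableMul P T X r Z') :
    IntegrableMul P T X r (fun ω => Z ω - Z' ω) := by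
  intro n hn i hi
  refine ((h n hn i hi).sub (h' n hn i hi)).congr (Filter.Eventually.of_forall fun ω => ?_)
  simp only [Pi.sub_apply]
  ring

theorem IntegrableMul.weight_mul {k n : ℕ} (h : IntegrableMul P T X r Z) (hn : n ≤ r + 1)
    (G : Genogram k) {i : ℕ → Fin d → ℤ} (hi : ∀ l ∈ Finset.Ico 1 n, i l ∈ T) :
    Integrable (fun ω => G.weight P (fun j => X (i j)) n ω * Z ω) P := by
  refine G.integrable_weight_mul fun S hS => h.blockProd_mul ?_ fun j hj => hi j (hS hj)
  have := Finset.card_le_card hS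
  rw [Nat.card_Ico] at this
  omega

/-- `ℰ_G(X_{i_1}, …, X_{i_{n-1}}, Z) = E[A_n Z]`. -/
theorem opE_eq_integral {n : ℕ} (hn : 1 ≤ n) (G : Genogram n)
    (h1 : IntegrableMul P T X (n - 1) fun _ => 1) (h : IntegrableMul P T X (n - 1) Z)
    {i : ℕ → Fin d → ℤ} (hi : ∀ l ∈ Finset.Ico 1 n, i l ∈ T) :
    G.opE P (fun j => if j = n then Z else X (i j)) =
      ∫ ω, G.weight P (fun j => X (i j)) n ω * Z ω ∂P := by
  rw [Genogram.opE, Genogram.opESub_eq_integral G hn, if_pos rfl,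
    Genogram.weight_congr P G G (fun _ _ => rfl) (fun _ _ => rfl)
      (Y' := fun j => X (i j)) fun j hj => if_neg (Finset.mem_Ico.1 hj).2.ne]
  intro S hS
  have hmem : ∀ j ∈ S.erase n, j ∈ Finset.Ico 1 n := fun j hj => by
    have h1 := Finset.mem_erase.1 hj
    have h2 := Finset.mem_Icc.1 (hS h1.2)
    rw [Finset.mem_Ico]; omega
  have hcard : (S.erase n).card ≤ n - 1 := by
    simpa using Finset.card_le_card (show S.erase n ⊆ Finset.Ico 1 n from hmem)
  have hprod : ∀ ω, blockProd (fun j => if j = n then Z else X (i j)) (S.erase n) ω =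
      blockProd (fun j => X (i j)) (S.erase n) ω := fun ω =>
    Finset.prod_congr rfl fun t ht => congrFun (if_neg (Finset.mem_erase.1 ht).1) ω
  by_cases hnS : n ∈ S
  · refine (h.blockProd_mul hcard fun j hj => hi j (hmem j hj)).congr
      (Filter.Eventually.of_forall fun ω => ?_)
    simp only [← hprod]
    unfold blockProd
    rw [← Finset.mul_prod_erase S _ hnS, mul_comm]
    exact congrArg (· * _) (congrFun (if_pos rfl).symm ω)
  · refine (h1.blockProd_mul hcard fun j hj => hi j (hmem j hj)).congr
      (Filter.Eventually.of_forall fun ω => ?_)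
    simp only [mul_one, ← hprod]
    rw [Finset.erase_eq_of_notMem hnS]

end Integrability

/-! ### Telescoping sums over identifiers -/

section Telescoping

variable {d n k : ℕ} (T : Finset (Fin d → ℤ)) (m : ℕ)
  (prec : (Fin d → ℤ) → (Fin d → ℤ) → Prop)

/-- Ranks are bounded, uniformly in `J ⊆ T`. -/
theorem exists_nbhdRk_eq : ∃ M : ℕ, ∀ J ⊆ T, ∀ s : ℤ, (M : ℤ) ≤ s → nbhdRk T m prec s J = T := by
  refine ⟨T.powerset.sup fun J => T.sup fun i => rk T m prec i J, fun J hJ s hs => ?_⟩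
  refine Finset.filter_true_of_mem fun i hi => Or.inr (le_trans ?_ hs)
  rw [Nat.cast_le]
  exact (Finset.le_sup (f := fun i => rk T m prec i J) hi).trans
    (Finset.le_sup (f := fun J => T.sup fun i => rk T m prec i J) (Finset.mem_powerset.2 hJ))

/-- The inner constraint set of a vertex with identifier `s`, ancestor indices `J` and parental
inner constraint set `D`. For `s ≥ 0` the outer constraint set is the value at `s + 1`. -/
def innerSet (s : ℤ) (J D : Finset (Fin d → ℤ)) : Finset (Fin d → ℤ) :=
  if 1 ≤ s then nbhdRk T m prec (s - 1) J ∪ D else D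

theorem innerSet_subset {s : ℤ} {J D : Finset (Fin d → ℤ)} (hD : D ⊆ T) :
    innerSet T m prec s J D ⊆ T := by
  unfold innerSet
  split_ifs
  · exact Finset.union_subset (Genogram.nbhdRk_subset _ _ _ _ _) hD
  · exact hD

theorem sum_innerSet (Φ : Finset (Fin d → ℤ) → ℝ) (J D : Finset (Fin d → ℤ)) (t : ℤ) :
    ∑ s ∈ Finset.Ico 0 t, (Φ (nbhdRk T m prec s J ∪ D) - Φ (innerSet T m prec s J D)) =
      Φ (innerSet T m prec t J D) - Φ D := by
  rcases le_or_gt t 0 with ht | ht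
  · rw [Finset.Ico_eq_empty (by omega), Finset.sum_empty, innerSet, if_neg (by omega), sub_self]
  obtain ⟨t, rfl⟩ := Int.eq_ofNat_of_zero_le ht.le
  clear ht
  induction t with
  | zero => simp [innerSet]
  | succ t ih =>
    have : Finset.Ico (0 : ℤ) ((t + 1 : ℕ) : ℤ) = insert (t : ℤ) (Finset.Ico 0 (t : ℤ)) := by
      ext x; simp only [Finset.mem_Ico, Finset.mem_insert]; push_cast; omega
    rw [this, Finset.sum_insert (by simp), ih]
    nth_rw 3 [innerSet]
    rw [if_pos (by push_cast; omega)]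
    push_cast
    rw [add_sub_cancel_right]
    ring

namespace Genogram

theorem D_eq_innerSet (G : Genogram k) (i : ℕ → Fin d → ℤ) {j : ℕ} (hj : j ∈ Finset.Icc 2 k) :
    G.D T m prec i j =
      innerSet T m prec (G.s j) ((G.lineage (G.p j)).image i) (G.D T m prec i (G.p j)) := by
  rw [D_eq T m prec G i hj, innerSet, ancestorIndices, G.ancestors_eq_lineage hj]

/-- The vertices other than the root on the path from the root to `v[j]`. -/
def chain (G : Genogram k) (j : ℕ) : Finset ℕ := (G.lineage j).filter (2 ≤ ·)

theorem chain_one (G : Genogram k) : G.chain 1 = ∅ := by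
  simp [chain, lineage_one]

theorem chain_eq (G : Genogram k) {j : ℕ} (hj : j ∈ Finset.Icc 2 k) :
    G.chain j = insert j (G.chain (G.p j)) := by
  rw [chain, G.lineage_eq hj, Finset.filter_insert, if_pos (Finset.mem_Icc.1 hj).1, chain]

/-- The inner constraint set of a vertex arises from the empty set by running through the
identifiers below those of its ancestors and of the vertex itself. -/
theorem sum_chain (G : Genogram k) (i : ℕ → Fin d → ℤ) (Φ : Finset (Fin d → ℤ) → ℝ) {j : ℕ}
    (hj : j ∈ Finset.Icc 1 k) :
    ∑ c ∈ G.chain j, ∑ s ∈ Finset.Ico 0 (G.s c),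
      (Φ (nbhdRk T m prec s ((G.lineage (G.p c)).image i) ∪ G.D T m prec i (G.p c)) -
        Φ (innerSet T m prec s ((G.lineage (G.p c)).image i) (G.D T m prec i (G.p c)))) =
      Φ (G.D T m prec i j) - Φ ∅ := by
  refine G.parent_induction (C := fun j => ∑ c ∈ G.chain j, ∑ s ∈ Finset.Ico 0 (G.s c),
      (Φ (nbhdRk T m prec s ((G.lineage (G.p c)).image i) ∪ G.D T m prec i (G.p c)) -
        Φ (innerSet T m prec s ((G.lineage (G.p c)).image i) (G.D T m prec i (G.p c)))) =
      Φ (G.D T m prec i j) - Φ ∅) ?_ ?_ hj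
  · rw [chain_one, Finset.sum_empty, D_one, sub_self]
  · intro j hj ih
    have hp := G.p_mem j hj
    have hnot : j ∉ G.chain (G.p j) := fun h => by
      have := G.lineage_bounds hp.1 (Finset.mem_filter.1 h).1
      omega
    rw [G.chain_eq hj, Finset.sum_insert hnot, ih, sum_innerSet, ← D_eq_innerSet T m prec G i hj]
    ring

end Genogram

end Telescoping

/-! ### Genograms with bounded identifiers -/

namespace Genogram

variable {n : ℕ}

theorem finite_bounded (n : ℕ) (M : ℕ) : {G : Genogram n | ∀ j, G.s j ≤ M}.Finite := by
  refine Set.Finite.of_finite_image (f := fun G => ((fun j : Fin (n + 1) => G.p j),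
    fun j : Fin (n + 1) => G.s j)) ?_ ?_
  · refine ((Set.Finite.pi' (t := fun _ => Set.Icc 0 n) fun _ : Fin (n + 1) =>
      Set.finite_Icc 0 n).prod (Set.Finite.pi' (t := fun _ => Set.Icc (-1) (M : ℤ))
        fun _ : Fin (n + 1) => Set.finite_Icc _ _)).subset ?_
    rintro _ ⟨G, hG, rfl⟩
    refine ⟨fun j => ⟨Nat.zero_le _, (G.p_le j).trans (by omega)⟩, fun j => ⟨?_, hG j⟩⟩
    change -1 ≤ G.s j
    by_cases hj : (j : ℕ) ∈ Finset.Icc 2 n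
    · exact G.s_ge _ hj
    · by_cases h1 : (j : ℕ) = 1
      · rw [h1, G.s_root]; omega
      · rw [G.s_out _ (by rw [Finset.mem_Icc] at hj ⊢; omega)]; omega
  · intro G _ G' _ h
    obtain ⟨h1, h2⟩ := Prod.mk.inj h
    ext j
    · by_cases hj : j ≤ n
      · exact congrFun h1 ⟨j, by omega⟩
      · rw [G.p_out j (by rw [Finset.mem_Icc]; omega), G'.p_out j (by rw [Finset.mem_Icc]; omega)]
    · by_cases hj : j ≤ n
      · exact congrFun h2 ⟨j, by omega⟩
      · rw [G.s_out j (by rw [Finset.mem_Icc]; omega), G'.s_out j (by rw [Finset.mem_Icc]; omega)]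

/-- The genograms of order `n` with identifiers at most `M`. -/
def bounded (n M : ℕ) : Finset (Genogram n) := (finite_bounded n M).toFinset

theorem mem_bounded {M : ℕ} {G : Genogram n} : G ∈ bounded n M ↔ ∀ j, G.s j ≤ M := by
  simp [bounded]

theorem restrict_mem_bounded {M : ℕ} {G : Genogram (n + 1)} (h : G ∈ bounded (n + 1) M) :
    G.restrict ∈ bounded n M := by
  rw [mem_bounded] at h ⊢
  intro j
  rcases le_or_gt j n with hj | hj
  · rw [restrict_s _ hj]; exact h j
  · rw [s_out _ j (by rw [Finset.mem_Icc]; omega)]; omega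

/-- A sum over all ways to add a last vertex: as a child of the last vertex, or as a younger
sibling of a vertex on the path to the last vertex. -/
theorem sum_extensions {M : ℕ} (G : Genogram n) (hn : 1 ≤ n) (hG : G ∈ bounded n M)
    (φ : ℕ → ℤ → ℝ) :
    ∑ G' ∈ (bounded (n + 1) M).filter (fun G' => G'.restrict = G),
        φ (G'.p (n + 1)) (G'.s (n + 1)) =
      ∑ s ∈ Finset.Icc (if n = 1 then 0 else -1) (M : ℤ), φ n s +
        ∑ c ∈ G.chain n, ∑ s ∈ Finset.Ico 0 (G.s c), φ (G.p c) s := by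
  rw [mem_bounded] at hG
  set lo : ℤ := if n = 1 then 0 else -1 with hlo
  have hinj : Function.Injective fun s : ℤ => (n, s) := fun a b h => (Prod.mk.inj h).2
  have hinj' : ∀ c, Function.Injective fun s : ℤ => (G.p c, s) := fun c a b h =>
    (Prod.mk.inj h).2
  have hcn : ∀ c ∈ G.chain n, c ∈ Finset.Icc 2 n := fun c hc => by
    have h := Finset.mem_filter.1 hc
    have := G.lineage_bounds hn h.1
    exact Finset.mem_Icc.2 ⟨h.2, this.2⟩
  calc _ = ∑ x ∈ (Finset.Icc lo (M : ℤ)).image (fun s => (n, s)) ∪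
        (G.chain n).biUnion (fun c => (Finset.Ico 0 (G.s c)).image fun s => (G.p c, s)),
        φ x.1 x.2 := by
        refine Finset.sum_bij (fun G' _ => (G'.p (n + 1), G'.s (n + 1))) ?_ ?_ ?_ ?_
        · intro G' hG'
          rw [Finset.mem_filter, mem_bounded] at hG'
          obtain ⟨h1, rfl⟩ := hG'
          simp only [Finset.mem_union, Finset.mem_image, Finset.mem_biUnion, Finset.mem_Icc,
            Finset.mem_Ico, Prod.mk.injEq]
          rcases G'.isSlot_last hn with ⟨h2, h3, h4⟩ | ⟨c, hc, h2, h3, h4, h5⟩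
          · refine Or.inl ⟨_, ⟨?_, h1 _⟩, h2.symm, rfl⟩
            rw [hlo]
            split_ifs with h
            · exact h4 h
            · exact h3
          · exact Or.inr ⟨c, Finset.mem_filter.2 ⟨hc, h2⟩, _, ⟨h4, h5⟩, h3, rfl⟩
        · intro G₁ h₁ G₂ h₂ h
          obtain ⟨h3, h4⟩ := Prod.mk.inj h
          exact eq_of_restrict_eq ((Finset.mem_filter.1 h₁).2.trans
            (Finset.mem_filter.1 h₂).2.symm) h3 h4
        · rintro ⟨q, s⟩ hx
          have hslot : G.IsSlot q s ∧ s ≤ M := by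
            simp only [Finset.mem_union, Finset.mem_image, Finset.mem_biUnion, Finset.mem_Icc,
              Finset.mem_Ico, Prod.mk.injEq] at hx
            rcases hx with ⟨s, ⟨h1, h2⟩, rfl, rfl⟩ | ⟨c, hc, s, ⟨h1, h2⟩, rfl, rfl⟩
            · refine ⟨Or.inl ⟨rfl, ?_, fun h => ?_⟩, h2⟩
              · rw [hlo] at h1; split_ifs at h1 <;> omega
              · rw [hlo, if_pos h] at h1; exact h1
            · have := Finset.mem_filter.1 hc
              exact ⟨Or.inr ⟨c, this.1, this.2, rfl, h1, h2⟩, h2.le.trans (hG c)⟩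
          obtain ⟨G', h1, h2, h3⟩ := G.exists_extension hn hslot.1
          refine ⟨G', ?_, by rw [h2, h3]⟩
          rw [Finset.mem_filter, mem_bounded]
          refine ⟨fun j => ?_, h1⟩
          by_cases hj : j ≤ n
          · rw [← restrict_s _ hj, h1]; exact hG j
          · by_cases hj' : j = n + 1
            · rw [hj', h3]; exact hslot.2
            · rw [s_out _ j (by rw [Finset.mem_Icc]; omega)]; omega
        · intro G' _
          rfl
    _ = _ := by
        rw [Finset.sum_union, Finset.sum_image hinj.injOn, Finset.sum_biUnion]
        · congr 1
          exact Finset.sum_congr rfl fun c _ => Finset.sum_image (hinj' c).injOn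
        · intro c hc c' hc' hne
          rw [Function.onFun, Finset.disjoint_left]
          simp only [Finset.mem_image, not_exists, not_and]
          rintro _ ⟨s, -, rfl⟩ s' - h
          have hp := (Prod.mk.inj h).1
          have h1 := G.s_le_of_sibling hn (Finset.mem_filter.1 hc).1 (Finset.mem_filter.1 hc).2
            (hcn c' hc') hp
          have h2 := G.s_le_of_sibling hn (Finset.mem_filter.1 hc').1 (Finset.mem_filter.1 hc').2
            (hcn c hc) hp.symm
          exact hne (by omega)
        · rw [Finset.disjoint_left]
          simp only [Finset.mem_image, Finset.mem_biUnion, not_exists, not_and]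
          rintro _ ⟨s, -, rfl⟩ c hc s' - h
          have hp := (Prod.mk.inj h).1
          have h1 := G.p_mem c (hcn c hc)
          have h2 := Finset.mem_Icc.1 (hcn c hc)
          omega

end Genogram

/-! ### Taylor expansion along a segment -/

section Taylor

variable {F F' : ℝ → ℝ} (hF : ∀ x, HasDerivAt F (F' x) x) (hF' : Continuous F') (x y : ℝ) (r : ℕ)
include hF hF'

theorem sub_eq_integral_segment :
    F x - F y = -(y - x) * ∫ v in (0 : ℝ)..1, v ^ 0 * F' (v * y + (1 - v) * x) := by
  have h : ∀ v ∈ Set.uIcc (0 : ℝ) 1, HasDerivAt (fun v : ℝ => F (v * y + (1 - v) * x))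
      (F' (v * y + (1 - v) * x) * (y - x)) v := fun v _ => by
    refine (hF _).comp v ?_
    have := ((hasDerivAt_id v).mul_const y).add (((hasDerivAt_id v).const_sub 1).mul_const x)
    exact this.congr_deriv (by ring)
  have := intervalIntegral.integral_eq_sub_of_hasDerivAt h
    (Continuous.intervalIntegrable (by fun_prop) _ _)
  rw [intervalIntegral.integral_mul_const] at this
  simp only [pow_zero, one_mul, zero_mul, sub_zero, sub_self, zero_add, add_zero] at this ⊢
  linarith

/-- Integration by parts. -/
theorem integral_segment_sub :
    ∫ v in (0 : ℝ)..1, ((r : ℝ) + 1) * v ^ r * (F (v * y + (1 - v) * x) - F y) =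
      -(y - x) * ∫ v in (0 : ℝ)..1, v ^ (r + 1) * F' (v * y + (1 - v) * x) := by
  have hFc : Continuous F := continuous_iff_continuousAt.2 fun x => (hF x).continuousAt
  have h : ∀ v ∈ Set.uIcc (0 : ℝ) 1,
      HasDerivAt (fun v : ℝ => v ^ (r + 1) * (F (v * y + (1 - v) * x) - F y))
      (((r : ℝ) + 1) * v ^ r * (F (v * y + (1 - v) * x) - F y) +
        v ^ (r + 1) * F' (v * y + (1 - v) * x) * (y - x)) v := fun v _ => by
    have h1 : HasDerivAt (fun v : ℝ => v * y + (1 - v) * x) (y - x) v := by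
      have := ((hasDerivAt_id v).mul_const y).add (((hasDerivAt_id v).const_sub 1).mul_const x)
      exact this.congr_deriv (by ring)
    have h2 := (hasDerivAt_pow (r + 1) v).mul ((((hF _).comp v h1)).sub_const (F y))
    refine h2.congr_deriv ?_
    simp only [Nat.add_sub_cancel, Function.comp]
    push_cast
    ring
  have := intervalIntegral.integral_eq_sub_of_hasDerivAt h
    (Continuous.intervalIntegrable (by fun_prop) _ _)
  rw [intervalIntegral.integral_add (Continuous.intervalIntegrable (by fun_prop) _ _)
    (Continuous.intervalIntegrable (by fun_prop) _ _), intervalIntegral.integral_mul_const] at this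
  simp only [one_pow, one_mul, sub_self, zero_mul, add_zero, mul_zero, ne_eq,
    Nat.succ_ne_zero, not_false_eq_true, zero_pow] at this
  linarith

end Taylor

theorem integral_segment_eq {F : ℝ → ℝ} (hF : Continuous F) (x y : ℝ) (r : ℕ) :
    ∫ v in (0 : ℝ)..1, ((r : ℝ) + 1) * v ^ r * (F (v * y + (1 - v) * x) - F y) =
      ((r : ℝ) + 1) * (∫ v in (0 : ℝ)..1, v ^ r * F (v * y + (1 - v) * x)) - F y := by
  have h1 : ∀ v : ℝ, ((r : ℝ) + 1) * v ^ r * (F (v * y + (1 - v) * x) - F y) =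
      ((r : ℝ) + 1) * (v ^ r * F (v * y + (1 - v) * x)) - ((r : ℝ) + 1) * F y * v ^ r :=
    fun v => by ring
  simp only [h1]
  rw [intervalIntegral.integral_sub (Continuous.intervalIntegrable (by fun_prop) _ _)
    (Continuous.intervalIntegrable (by fun_prop) _ _), intervalIntegral.integral_const_mul,
    intervalIntegral.integral_const_mul, integral_pow]
  have : (r : ℝ) + 1 ≠ 0 := by positivity
  simp only [one_pow, ne_eq, Nat.succ_ne_zero, not_false_eq_true, zero_pow, sub_zero]
  congr 1
  field_simp

/-! ### The adjusted differences -/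

section Remainder

variable {Ω : Type*} [MeasurableSpace Ω] {P : Measure Ω} {d : ℕ} {T : Finset (Fin d → ℤ)}
  {X : (Fin d → ℤ) → Ω → ℝ} {m : ℕ} {prec : (Fin d → ℤ) → (Fin d → ℤ) → Prop} {f : ℝ → ℝ}
  {K n : ℕ}

theorem normSum_sub {B D : Finset (Fin d → ℤ)} (hB : B ⊆ T) (hD : D ⊆ B) (ω : Ω) :
    normSum P T X D ω - normSum P T X B ω = (sigma P T X)⁻¹ * ∑ x ∈ B \ D, X x ω := by
  have h1 : T \ D = (T \ B) ∪ (B \ D) := by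
    ext x
    have h1 := @hB x
    have h2 := @hD x
    simp only [Finset.mem_sdiff, Finset.mem_union]
    tauto
  unfold normSum
  rw [h1, Finset.sum_union]
  · ring
  · rw [Finset.disjoint_left]
    simp only [Finset.mem_sdiff]
    tauto

variable (P T X f) in
/-- The weighted average over a segment of the differences of `f^{(l)}`. -/
def segmentDiff (l r : ℕ) (B D : Finset (Fin d → ℤ)) (ω : Ω) : ℝ :=
  ∫ v in (0 : ℝ)..1, ((r : ℝ) + 1) * v ^ r *
    (iteratedDeriv l f (v * normSum P T X D ω + (1 - v) * normSum P T X B ω) -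
      iteratedDeriv l f (normSum P T X D ω))

theorem fDiff_eq_ite (G : Genogram n) (hn : 2 ≤ n) (i : ℕ → Fin d → ℤ) :
    G.fDiff P T X m prec f i =
      if G.u n = n then fun ω =>
        iteratedDeriv (n - 2) f (normSum P T X (G.B T m prec i n) ω) -
          iteratedDeriv (n - 2) f (normSum P T X (G.D T m prec i n) ω)
      else segmentDiff P T X f (n - 2) (n - 1 - G.u n) (G.B T m prec i n) (G.D T m prec i n) := by
  funext ω
  have hu := G.two_le_u (Finset.mem_Icc.2 ⟨hn, le_rfl⟩)
  unfold Genogram.fDiff segmentDiff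
  split_ifs with h
  · rfl
  · have hc : (n : ℝ) - G.u n = ((n - 1 - G.u n : ℕ) : ℝ) + 1 := by
      have : ((n - 1 - G.u n + 1 + G.u n : ℕ) : ℝ) = n := congrArg _ (by omega)
      push_cast at this
      linarith
    simp only [hc]

section Smooth

variable (hf : ContDiff ℝ (K : ℕ∞) f)
include hf

theorem continuous_iteratedDeriv_of_le {l : ℕ} (hl : l ≤ K) : Continuous (iteratedDeriv l f) :=
  hf.continuous_iteratedDeriv l (by exact_mod_cast hl)

theorem hasDerivAt_iteratedDeriv {l : ℕ} (hl : l < K) (x : ℝ) :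
    HasDerivAt (iteratedDeriv l f) (iteratedDeriv (l + 1) f x) x := by
  rw [iteratedDeriv_succ]
  exact (hf.differentiable_iteratedDeriv l (by exact_mod_cast hl) x).hasDerivAt

/-- The fundamental theorem of calculus produces the factor `X_{i_n}` and the derivative of the
next order, the latter already split into the difference attached to a negative child of the last
vertex and its value at the inner constraint set. -/
theorem fDiff_eq (G : Genogram n) (hn : 2 ≤ n) (hnK : n ≤ K + 1) (i : ℕ → Fin d → ℤ) (ω : Ω) :
    G.fDiff P T X m prec f i ω =
      -((n : ℝ) + 1 - G.u n)⁻¹ * ((sigma P T X)⁻¹ *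
        ∑ x ∈ G.B T m prec i n \ G.D T m prec i n, X x ω) *
        (segmentDiff P T X f (n - 1) (n - G.u n) (G.B T m prec i n) (G.D T m prec i n) ω +
          iteratedDeriv (n - 1) f (normSum P T X (G.D T m prec i n) ω)) := by
  have hnn : n ∈ Finset.Icc 1 n := Finset.mem_Icc.2 (by omega)
  have hu := G.two_le_u (Finset.mem_Icc.2 ⟨hn, le_rfl⟩)
  have hF : ∀ x, HasDerivAt (iteratedDeriv (n - 2) f) (iteratedDeriv (n - 1) f x) x := fun x => by
    have := hasDerivAt_iteratedDeriv hf (show n - 2 < K by omega) x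
    rwa [show n - 2 + 1 = n - 1 by omega] at this
  have hF' := continuous_iteratedDeriv_of_le hf (show n - 1 ≤ K by omega)
  have hc : (n : ℝ) + 1 - G.u n = ((n - G.u n : ℕ) : ℝ) + 1 := by
    rw [Nat.cast_sub hu.2]; ring
  rw [← normSum_sub (Genogram.B_subset T m prec G i hnn) (Genogram.D_subset_B T m prec G i hnn),
    segmentDiff, integral_segment_eq hF', sub_add_cancel, hc, fDiff_eq_ite G hn]
  have hpos : ((n - G.u n : ℕ) : ℝ) + 1 ≠ 0 := by positivity
  split_ifs with h
  · simp only []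
    rw [sub_eq_integral_segment hF hF', show n - G.u n = 0 by omega]
    push_cast
    ring
  · rw [segmentDiff, integral_segment_sub hF hF', show n - 1 - G.u n + 1 = n - G.u n by omega]
    field_simp

variable (hint : ExpectationsExist P T X K f)
include hint

omit hf in
theorem integrableMul_iteratedDeriv {l : ℕ} (hl : l ≤ K) {J : Finset (Fin d → ℤ)} (hJ : J ⊆ T) :
    IntegrableMul P T X (l + 1) fun ω => iteratedDeriv l f (normSum P T X J ω) :=
  fun n hn i hi => (hint l hl n hn i hi).1 J hJ

theorem integrableMul_segmentDiff {l r : ℕ} (hl : l ≤ K) (hr : r < l)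
    {B D : Finset (Fin d → ℤ)} (hB : B ⊆ T) (hD : D ⊆ B) :
    IntegrableMul P T X (l + 1) (segmentDiff P T X f l r B D) := by
  have h1 : IntegrableMul P T X (l + 1) fun ω => ∫ v in (0 : ℝ)..1, v ^ r *
      iteratedDeriv l f (v * normSum P T X D ω + (1 - v) * normSum P T X B ω) :=
    fun n hn i hi => (hint l hl n hn i hi).2 r hr B hB D hD
  have h2 := (h1.const_mul ((r : ℝ) + 1)).sub
    (integrableMul_iteratedDeriv hint hl (hD.trans hB))
  have h3 : segmentDiff P T X f l r B D = _ :=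
    funext fun ω => integral_segment_eq (continuous_iteratedDeriv_of_le hf hl) _ _ r
  rw [h3]
  exact h2

theorem integrableMul_fDiff (G : Genogram n) (hn : 2 ≤ n) (hnK : n ≤ K + 2)
    (i : ℕ → Fin d → ℤ) : IntegrableMul P T X (n - 1) (G.fDiff P T X m prec f i) := by
  have hnn : n ∈ Finset.Icc 1 n := Finset.mem_Icc.2 (by omega)
  have hu := G.two_le_u (Finset.mem_Icc.2 ⟨hn, le_rfl⟩)
  have hB := Genogram.B_subset T m prec G i hnn
  have hD := Genogram.D_subset_B T m prec G i hnn
  rw [fDiff_eq_ite G hn, show n - 1 = n - 2 + 1 by omega]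
  split_ifs with h
  · exact (integrableMul_iteratedDeriv hint (by omega) hB).sub
      (integrableMul_iteratedDeriv hint (by omega) (hD.trans hB))
  · exact integrableMul_segmentDiff hf hint (by omega) (by omega) hB hD

end Smooth

end Remainder

/-! ### The expansion of a single term -/

section Step

variable {Ω : Type*} [MeasurableSpace Ω] (P : Measure Ω) {d : ℕ} (T : Finset (Fin d → ℤ))
  (X : (Fin d → ℤ) → Ω → ℝ) (m : ℕ) (prec : (Fin d → ℤ) → (Fin d → ℤ) → Prop) (f : ℝ → ℝ)
  {K n M : ℕ}

namespace Genogram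

/-- The random variable `A_n X_{i_n}`, with the weight `A_n` of the last vertex. -/
def fullWeight (G : Genogram n) (i : ℕ → Fin d → ℤ) (ω : Ω) : ℝ :=
  G.weight P (fun j => X (i j)) n ω * X (i n) ω

/-- The expectation `ℰ_{G'}(X_{i_1}, …, X_{i_n}, Δ_f(G'))` for the genogram `G'` arising from `G` by
adding a last vertex with parent `q` and identifier `s`. -/
def slotTerm (G : Genogram n) (i : ℕ → Fin d → ℤ) (q : ℕ) (s : ℤ) : ℝ :=
  ∫ ω, (if q = n then
      if 0 ≤ s then G.fullWeight P X i ω - ∫ ω', G.fullWeight P X i ω' ∂P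
      else G.fullWeight P X i ω
    else ∫ ω', G.fullWeight P X i ω' ∂P) *
    (if 0 ≤ s then
      iteratedDeriv (n - 1) f
        (normSum P T X (nbhdRk T m prec s ((G.lineage q).image i) ∪ G.D T m prec i q) ω) -
      iteratedDeriv (n - 1) f
        (normSum P T X (innerSet T m prec s ((G.lineage q).image i) (G.D T m prec i q)) ω)
    else segmentDiff P T X f (n - 1) (n - G.u n) (G.B T m prec i n) (G.D T m prec i n) ω) ∂P

variable {P T X m prec f}

theorem integral_weight_mul_fDiff (G : Genogram (n + 1)) (hn : 1 ≤ n) (i : ℕ → Fin d → ℤ) :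
    ∫ ω, G.weight P (fun j => X (i j)) (n + 1) ω * G.fDiff P T X m prec f i ω ∂P =
      G.restrict.slotTerm P T X m prec f i (G.p (n + 1)) (G.s (n + 1)) := by
  have hlast : n + 1 ∈ Finset.Icc 2 (n + 1) := Finset.mem_Icc.2 (by omega)
  have hp := G.p_mem _ hlast
  have hcon : ∀ {j}, j ∈ Finset.Icc 1 n → _ := fun hj =>
    constraints_congr T m prec G G.restrict (by omega) le_rfl
      (fun _ h => (G.restrict_p h).symm) (fun _ h => (G.restrict_s h).symm) hj
  have hq : G.p (n + 1) ∈ Finset.Icc 1 n := Finset.mem_Icc.2 (by omega)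
  have hw : G.weight P (fun j => X (i j)) n = G.restrict.weight P (fun j => X (i j)) n :=
    weight_congr P G G.restrict (fun _ h => (G.restrict_p h).symm)
      (fun _ h => (G.restrict_s h).symm) fun _ _ => rfl
  unfold slotTerm fullWeight
  refine integral_congr_ae (Filter.Eventually.of_forall fun ω => ?_)
  simp only [weight, if_neg (show n ≠ 0 by omega), hw]
  congr 1
  · split_ifs <;> rfl
  · rw [fDiff_eq_ite G (by omega)]
    by_cases hs : 0 ≤ G.s (n + 1)
    · rw [if_pos (G.u_of_nonneg hs), if_pos hs, B_eq T m prec G i hlast, if_pos hs,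
        D_eq_innerSet T m prec G i hlast, ancestorIndices, G.ancestors_eq_lineage hlast,
        (hcon hq).1, ((hcon hq).2.2 i i fun _ _ => rfl).2.1]
      rfl
    · have hpn : G.p (n + 1) = n := by
        rcases G.isSlot_last hn with ⟨h, -⟩ | ⟨c, -, -, -, h, -⟩
        · exact h
        · exact absurd h hs
      have hnn : n ∈ Finset.Icc 1 n := Finset.mem_Icc.2 ⟨hn, le_rfl⟩
      have hu : G.u (n + 1) = G.restrict.u n := by
        rw [G.u_of_neg hlast hs, hpn, (hcon hnn).2.1]
      have hun : G.restrict.u n ≤ n := by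
        by_cases h2 : 2 ≤ n
        · exact (G.restrict.two_le_u (Finset.mem_Icc.2 ⟨h2, le_rfl⟩)).2
        · obtain rfl : n = 1 := by omega
          rw [u_one]
      have h3 := (hcon hnn).2.2 i i fun _ _ => rfl
      rw [if_neg (by omega), if_neg hs, hu, B_eq T m prec G i hlast, if_neg hs,
        D_eq T m prec G i hlast, if_neg (by omega), hpn, h3.2.1, h3.2.2]
      rfl

end Genogram

theorem lineage_image_subset (G : Genogram n) {i : ℕ → Fin d → ℤ}
    (hi : ∀ l ∈ Finset.Icc 1 n, i l ∈ T) {q : ℕ} (hq : q ∈ Finset.Icc 1 n) :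
    (G.lineage q).image i ⊆ T := by
  intro x hx
  obtain ⟨l, hl, rfl⟩ := Finset.mem_image.1 hx
  have := G.lineage_bounds (Finset.mem_Icc.1 hq).1 hl
  rw [Finset.mem_Icc] at hq
  exact hi l (Finset.mem_Icc.2 (by omega))

variable {P T X m prec f}

section Pointwise

variable (hf : ContDiff ℝ (K : ℕ∞) f) (hint : ExpectationsExist P T X K f)
  (G : Genogram n) (hn : 1 ≤ n) (hnK : n ≤ K + 1)
  {i : ℕ → Fin d → ℤ} (hi : ∀ l ∈ Finset.Icc 1 n, i l ∈ T)

section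

include hint hn hnK

/-- Attaching all new branches: a telescoping sum along the path to the last vertex. -/
theorem sum_slotTerm_branch :
    ∑ c ∈ G.chain n, ∑ s ∈ Finset.Ico 0 (G.s c), G.slotTerm P T X m prec f i (G.p c) s =
      (∫ ω, G.fullWeight P X i ω ∂P) *
        ((∫ ω, iteratedDeriv (n - 1) f (normSum P T X (G.D T m prec i n) ω) ∂P) -
          ∫ ω, iteratedDeriv (n - 1) f (normSum P T X ∅ ω) ∂P) := by
  have hnn : n ∈ Finset.Icc 1 n := Finset.mem_Icc.2 ⟨hn, le_rfl⟩
  have hΦi : ∀ J ⊆ T, Integrable (fun ω => iteratedDeriv (n - 1) f (normSum P T X J ω)) P :=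
    fun J hJ => (integrableMul_iteratedDeriv hint (by omega) hJ).integrable
  rw [← Genogram.sum_chain T m prec G i
    (fun J => ∫ ω, iteratedDeriv (n - 1) f (normSum P T X J ω) ∂P) hnn, Finset.mul_sum]
  refine Finset.sum_congr rfl fun c hc => ?_
  rw [Finset.mul_sum]
  refine Finset.sum_congr rfl fun s hs => ?_
  obtain ⟨hc1, hc2⟩ := Finset.mem_filter.1 hc
  have hcb := G.lineage_bounds hn hc1
  have hp := G.p_mem c (Finset.mem_Icc.2 ⟨hc2, hcb.2⟩)
  have hDT := G.D_subset T m prec i (j := G.p c) (Finset.mem_Icc.2 (by omega))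
  rw [← integral_sub, ← integral_const_mul, Genogram.slotTerm]
  · refine integral_congr_ae (Filter.Eventually.of_forall fun ω => ?_)
    simp only [if_neg (show G.p c ≠ n by omega), if_pos (Finset.mem_Ico.1 hs).1]
  · exact hΦi _ (Finset.union_subset (Genogram.nbhdRk_subset _ _ _ _ _) hDT)
  · exact hΦi _ (innerSet_subset T m prec hDT)

end

include hn hi

theorem integrable_fullWeight_mul {Z : Ω → ℝ} (h : IntegrableMul P T X n Z) :
    Integrable (fun ω => G.fullWeight P X i ω * Z ω) P := by
  have h' : IntegrableMul P T X (n - 1 + 1) Z := by rwa [Nat.sub_add_cancel hn]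
  have := (h'.factor_mul (hi n (Finset.mem_Icc.2 ⟨hn, le_rfl⟩))).weight_mul (by omega) G
    (i := i) (n := n) fun l hl => hi l (by rw [Finset.mem_Ico] at hl; rw [Finset.mem_Icc]; omega)
  refine this.congr (Filter.Eventually.of_forall fun ω => ?_)
  simp only [Genogram.fullWeight]
  ring

include hint hnK

variable [IsProbabilityMeasure P]

/-- Attaching all nonnegative children to the last vertex: a telescoping sum, whose upper end
`f^{(n-1)}(W(T))` is constant and therefore uncorrelated to everything. -/
theorem sum_slotTerm_child (h1 : Integrable (G.fullWeight P X i) P)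
    (hM : ∀ J ⊆ T, ∀ s : ℤ, (M : ℤ) ≤ s → nbhdRk T m prec s J = T) :
    ∑ s ∈ Finset.Icc (0 : ℤ) M, G.slotTerm P T X m prec f i n s =
      (∫ ω, G.fullWeight P X i ω ∂P) *
        (∫ ω, iteratedDeriv (n - 1) f (normSum P T X (G.D T m prec i n) ω) ∂P) -
      ∫ ω, G.fullWeight P X i ω *
        iteratedDeriv (n - 1) f (normSum P T X (G.D T m prec i n) ω) ∂P := by
  have hnn : n ∈ Finset.Icc 1 n := Finset.mem_Icc.2 ⟨hn, le_rfl⟩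
  have hDT := G.D_subset T m prec i hnn
  set e := ∫ ω, G.fullWeight P X i ω ∂P with he
  set Φ : Finset (Fin d → ℤ) → ℝ := fun J => ∫ ω, (G.fullWeight P X i ω - e) *
    iteratedDeriv (n - 1) f (normSum P T X J ω) ∂P with hΦ
  have hmul : ∀ J ⊆ T, IntegrableMul P T X n fun ω =>
      iteratedDeriv (n - 1) f (normSum P T X J ω) := fun J hJ =>
    (integrableMul_iteratedDeriv hint (by omega) hJ).mono (by omega)
  have hΦi : ∀ J ⊆ T, Integrable (fun ω => (G.fullWeight P X i ω - e) *
      iteratedDeriv (n - 1) f (normSum P T X J ω)) P := fun J hJ => by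
    simp only [sub_mul]
    exact (integrable_fullWeight_mul G hn hi (hmul J hJ)).sub
      ((hmul J hJ).integrable.const_mul e)
  have hterm : ∀ s ∈ Finset.Ico (0 : ℤ) ((M : ℤ) + 1), G.slotTerm P T X m prec f i n s =
      Φ (nbhdRk T m prec s ((G.lineage n).image i) ∪ G.D T m prec i n) -
        Φ (innerSet T m prec s ((G.lineage n).image i) (G.D T m prec i n)) := by
    intro s hs
    rw [Finset.mem_Ico] at hs
    rw [Genogram.slotTerm, hΦ, ← integral_sub]
    · refine integral_congr_ae (Filter.Eventually.of_forall fun ω => ?_)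
      simp only [if_true, if_pos hs.1]
      ring
    · exact hΦi _ (Finset.union_subset (Genogram.nbhdRk_subset _ _ _ _ _) hDT)
    · exact hΦi _ (innerSet_subset T m prec hDT)
  have hIcc : Finset.Icc (0 : ℤ) M = Finset.Ico (0 : ℤ) ((M : ℤ) + 1) := by
    ext x; simp only [Finset.mem_Icc, Finset.mem_Ico]; omega
  have hT : Φ T = 0 := by
    simp only [hΦ, normSum, Finset.sdiff_self, Finset.sum_empty, mul_zero]
    rw [integral_mul_const, integral_sub h1 (integrable_const e), ← he]
    simp
  have hD : Φ (G.D T m prec i n) =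
      (∫ ω, G.fullWeight P X i ω *
        iteratedDeriv (n - 1) f (normSum P T X (G.D T m prec i n) ω) ∂P) -
      e * ∫ ω, iteratedDeriv (n - 1) f (normSum P T X (G.D T m prec i n) ω) ∂P := by
    simp only [hΦ, sub_mul]
    rw [integral_sub (integrable_fullWeight_mul G hn hi (hmul _ hDT))
      ((hmul _ hDT).integrable.const_mul e), integral_const_mul]
  rw [hIcc, Finset.sum_congr rfl hterm, sum_innerSet, innerSet, if_pos (by omega),
    add_sub_cancel_right, hM _ (lineage_image_subset T G hi hnn) _ le_rfl,
    Finset.union_eq_left.2 hDT, hT, hD]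
  ring

include hf

/-- The signed sum over all ways to add a last vertex. -/
theorem sum_slotTerm (h2 : 2 ≤ n) (h1 : IntegrableMul P T X n fun _ => 1)
    (hM : ∀ J ⊆ T, ∀ s : ℤ, (M : ℤ) ≤ s → nbhdRk T m prec s J = T) :
    ∫ ω, G.fullWeight P X i ω *
      (segmentDiff P T X f (n - 1) (n - G.u n) (G.B T m prec i n) (G.D T m prec i n) ω +
        iteratedDeriv (n - 1) f (normSum P T X (G.D T m prec i n) ω)) ∂P =
    -(∑ s ∈ Finset.Icc (-1) (M : ℤ), (if n = n ∧ 0 ≤ s then 1 else -1) *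
        G.slotTerm P T X m prec f i n s +
      ∑ c ∈ G.chain n, ∑ s ∈ Finset.Ico 0 (G.s c), (if G.p c = n ∧ 0 ≤ s then 1 else -1) *
        G.slotTerm P T X m prec f i (G.p c) s) +
    (∫ ω, G.fullWeight P X i ω ∂P) * ∫ ω, iteratedDeriv (n - 1) f (normSum P T X ∅ ω) ∂P := by
  have hnn : n ∈ Finset.Icc 1 n := Finset.mem_Icc.2 ⟨hn, le_rfl⟩
  have hu := G.two_le_u (Finset.mem_Icc.2 ⟨h2, le_rfl⟩)
  have hBT := G.B_subset T m prec i hnn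
  have hDB := G.D_subset_B T m prec i hnn
  have hw : Integrable (G.fullWeight P X i) P := by
    simpa using integrable_fullWeight_mul G hn hi h1
  have hIcc : Finset.Icc (-1) (M : ℤ) = insert (-1) (Finset.Icc 0 (M : ℤ)) := by
    ext x; simp only [Finset.mem_Icc, Finset.mem_insert]; omega
  have hneg : G.slotTerm P T X m prec f i n (-1) = ∫ ω, G.fullWeight P X i ω *
      segmentDiff P T X f (n - 1) (n - G.u n) (G.B T m prec i n) (G.D T m prec i n) ω ∂P := by
    rw [Genogram.slotTerm]
    refine integral_congr_ae (Filter.Eventually.of_forall fun ω => ?_)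
    simp
  have hchild : ∑ s ∈ Finset.Icc 0 (M : ℤ), (if n = n ∧ 0 ≤ s then 1 else -1) *
      G.slotTerm P T X m prec f i n s =
      ∑ s ∈ Finset.Icc 0 (M : ℤ), G.slotTerm P T X m prec f i n s :=
    Finset.sum_congr rfl fun s hs => by
      rw [if_pos (show n = n ∧ 0 ≤ s from ⟨rfl, (Finset.mem_Icc.1 hs).1⟩), one_mul]
  have hbranch : ∑ c ∈ G.chain n, ∑ s ∈ Finset.Ico 0 (G.s c),
      (if G.p c = n ∧ 0 ≤ s then 1 else -1) * G.slotTerm P T X m prec f i (G.p c) s =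
      -∑ c ∈ G.chain n, ∑ s ∈ Finset.Ico 0 (G.s c), G.slotTerm P T X m prec f i (G.p c) s := by
    rw [← Finset.sum_neg_distrib]
    refine Finset.sum_congr rfl fun c hc => ?_
    obtain ⟨hc1, hc2⟩ := Finset.mem_filter.1 hc
    have hcb := G.lineage_bounds hn hc1
    have hp := G.p_mem c (Finset.mem_Icc.2 ⟨hc2, hcb.2⟩)
    rw [← Finset.sum_neg_distrib]
    refine Finset.sum_congr rfl fun s _ => ?_
    rw [if_neg (show ¬(G.p c = n ∧ 0 ≤ s) from fun h => by omega), neg_one_mul]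
  rw [hIcc, Finset.sum_insert (by simp), hchild, hbranch, sum_slotTerm_branch hint G hn hnK,
    sum_slotTerm_child hint G hn hnK hi hw hM, hneg,
    if_neg (show ¬(n = n ∧ (0 : ℤ) ≤ -1) from fun h => by omega)]
  simp only [mul_add]
  rw [integral_add]
  · ring
  · exact integrable_fullWeight_mul G hn hi
      ((integrableMul_segmentDiff hf hint (by omega) (by omega) hBT hDB).mono (by omega))
  · exact integrable_fullWeight_mul G hn hi
      ((integrableMul_iteratedDeriv hint (by omega) (hDB.trans hBT)).mono (by omega))

end Pointwise

end Step

/-! ### The expansion of the sums over genograms -/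

theorem nestedSum_eq_pred {d n : ℕ} (C : ℕ → (ℕ → Fin d → ℤ) → Finset (Fin d → ℤ)) (hn : 1 ≤ n)
    (F : (ℕ → Fin d → ℤ) → ℝ) :
    nestedSum C n F = nestedSum C (n - 1) fun i => ∑ x ∈ C n i, F (Function.update i n x) := by
  obtain ⟨n, rfl⟩ : ∃ l, n = l + 1 := ⟨n - 1, by omega⟩
  rfl

section Expansion

variable {Ω : Type*} [MeasurableSpace Ω] {P : Measure Ω} {d : ℕ} {T : Finset (Fin d → ℤ)}
  {X : (Fin d → ℤ) → Ω → ℝ} {m : ℕ} {prec : (Fin d → ℤ) → (Fin d → ℤ) → Prop} {f : ℝ → ℝ}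
  {K n M : ℕ}

theorem constraint_subset (G : Genogram n) {j : ℕ} (hj : j ∈ Finset.Icc 1 n)
    (i : ℕ → Fin d → ℤ) : G.B T m prec i j \ G.D T m prec i j ⊆ T :=
  Finset.sdiff_subset.trans (G.B_subset T m prec i hj)

theorem S_eq_nestedSum (h1 : IntegrableMul P T X n fun _ => 1) (G : Genogram n) (hn : 1 ≤ n) :
    G.S P T X m prec = ((sigma P T X) ^ n)⁻¹ *
      nestedSum (fun j i => G.B T m prec i j \ G.D T m prec i j) n fun i =>
        ∫ ω, G.fullWeight P X i ω ∂P := by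
  unfold Genogram.S
  congr 1
  refine nestedSum_congr (T := T) (fun j hj i => constraint_subset G hj i) (fun _ _ _ => rfl)
    fun i hi => ?_
  rw [Genogram.opE, Genogram.opESub_eq_integral G hn]
  · rfl
  · intro S hS
    have hc := Finset.card_le_card hS
    rw [Nat.card_Icc, Nat.add_sub_cancel] at hc
    simpa using h1.blockProd_mul hc fun j hj => hi j (hS hj)

section

variable (hf : ContDiff ℝ (K : ℕ∞) f) (hint : ExpectationsExist P T X K f)
  (h1 : IntegrableMul P T X (K + 1) fun _ => 1)
include hf hint h1

theorem U_eq_nestedSum (G : Genogram n) (hn : 2 ≤ n) (hnK : n ≤ K + 2) :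
    G.U P T X m prec f = ((sigma P T X) ^ (n - 1))⁻¹ *
      nestedSum (fun j i => G.B T m prec i j \ G.D T m prec i j) (n - 1) fun i =>
        ∫ ω, G.weight P (fun j => X (i j)) n ω * G.fDiff P T X m prec f i ω ∂P := by
  unfold Genogram.U
  congr 1
  refine nestedSum_congr (T := T) (fun j hj i => constraint_subset G ?_ i) (fun _ _ _ => rfl)
    fun i hi => ?_
  · rw [Finset.mem_Icc] at hj ⊢; omega
  · refine opE_eq_integral (by omega) G (h1.mono (by omega))
      (integrableMul_fDiff hf hint G hn hnK i) fun l hl => hi l ?_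
    rw [Finset.mem_Ico] at hl
    rw [Finset.mem_Icc]
    omega

theorem U_eq_nestedSum_slotTerm (G : Genogram (n + 1)) (hn : 1 ≤ n) (hnK : n ≤ K + 1) :
    G.U P T X m prec f = ((sigma P T X) ^ n)⁻¹ *
      nestedSum (fun j i => G.restrict.B T m prec i j \ G.restrict.D T m prec i j) n fun i =>
        G.restrict.slotTerm P T X m prec f i (G.p (n + 1)) (G.s (n + 1)) := by
  rw [U_eq_nestedSum hf hint h1 G (by omega) (by omega), Nat.add_sub_cancel]
  congr 1
  refine nestedSum_congr (T := T) (fun j hj i => constraint_subset G ?_ i) ?_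
    fun i _ => G.integral_weight_mul_fDiff hn i
  · rw [Finset.mem_Icc] at hj ⊢; omega
  · intro j hj i
    have := (Genogram.constraints_congr T m prec G G.restrict (by omega) le_rfl
      (fun _ h => (G.restrict_p h).symm) (fun _ h => (G.restrict_s h).symm) hj).2.2 i i
      fun _ _ => rfl
    rw [this.2.1, this.2.2]

/-- The expansion of `𝒰_f(G)`: the sum over all genograms which arise from `G` by adding a last
vertex, and the contribution of `𝒮(G)`. -/
theorem b_mul_U_eq [IsProbabilityMeasure P]
    (hM : ∀ J ⊆ T, ∀ s : ℤ, (M : ℤ) ≤ s → nbhdRk T m prec s J = T)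
    (G : Genogram n) (hn : 2 ≤ n) (hnK : n ≤ K + 1) (hG : G ∈ Genogram.bounded n M) :
    G.b * G.U P T X m prec f =
      ∑ G' ∈ (Genogram.bounded (n + 1) M).filter (fun G' => G'.restrict = G),
        G'.b * G'.U P T X m prec f -
      G.b / ((n : ℝ) + 1 - G.u n) * G.S P T X m prec *
        ∫ ω, iteratedDeriv (n - 1) f (normSum P T X ∅ ω) ∂P := by
  set C : ℕ → (ℕ → Fin d → ℤ) → Finset (Fin d → ℤ) :=
    fun j i => G.B T m prec i j \ G.D T m prec i j with hC
  set e := ∫ ω, iteratedDeriv (n - 1) f (normSum P T X ∅ ω) ∂P with he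
  set R : (ℕ → Fin d → ℤ) → ℝ := fun i => ∫ ω, G.fullWeight P X i ω *
    (segmentDiff P T X f (n - 1) (n - G.u n) (G.B T m prec i n) (G.D T m prec i n) ω +
      iteratedDeriv (n - 1) f (normSum P T X (G.D T m prec i n) ω)) ∂P with hR
  have hnn : n ∈ Finset.Icc 1 n := Finset.mem_Icc.2 (by omega)
  have hCT : ∀ j ∈ Finset.Icc 1 n, ∀ i, C j i ⊆ T := fun j hj i => constraint_subset G hj i
  have hsig : ((sigma P T X) ^ n)⁻¹ = ((sigma P T X) ^ (n - 1))⁻¹ * (sigma P T X)⁻¹ := by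
    rw [← mul_inv, ← pow_succ, Nat.sub_add_cancel (by omega)]
  set Q : (ℕ → Fin d → ℤ) → ℝ := fun i =>
    ∑ s ∈ Finset.Icc (-1) (M : ℤ), (if n = n ∧ 0 ≤ s then 1 else -1) *
      G.slotTerm P T X m prec f i n s +
    ∑ c ∈ G.chain n, ∑ s ∈ Finset.Ico 0 (G.s c), (if G.p c = n ∧ 0 ≤ s then 1 else -1) *
      G.slotTerm P T X m prec f i (G.p c) s with hQ
  have hext : ∑ G' ∈ (Genogram.bounded (n + 1) M).filter (fun G' => G'.restrict = G),
      G'.b * G'.U P T X m prec f =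
      G.b / ((n : ℝ) + 1 - G.u n) * ((sigma P T X) ^ n)⁻¹ * nestedSum C n Q := by
    have h2 : ∀ i, Q i =
        ∑ G' ∈ (Genogram.bounded (n + 1) M).filter (fun G' => G'.restrict = G),
          (if G'.p (n + 1) = n ∧ 0 ≤ G'.s (n + 1) then 1 else -1) *
            G.slotTerm P T X m prec f i (G'.p (n + 1)) (G'.s (n + 1)) := fun i => by
      rw [hQ, Genogram.sum_extensions G (by omega) hG fun q s =>
        (if q = n ∧ 0 ≤ s then 1 else -1) * G.slotTerm P T X m prec f i q s,
        if_neg (by omega)]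
    rw [show Q = _ from funext h2, nestedSum_finsetSum, Finset.mul_sum]
    refine Finset.sum_congr rfl fun G' hG' => ?_
    obtain rfl := (Finset.mem_filter.1 hG').2
    rw [nestedSum_const_mul, G'.b_eq hn, U_eq_nestedSum_slotTerm hf hint h1 G' (by omega) hnK]
    ring
  have hU : G.U P T X m prec f =
      -((n : ℝ) + 1 - G.u n)⁻¹ * ((sigma P T X) ^ n)⁻¹ * nestedSum C n R := by
    suffices h : (nestedSum C (n - 1) fun i =>
        ∫ ω, G.weight P (fun j => X (i j)) n ω * G.fDiff P T X m prec f i ω ∂P) =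
        -((n : ℝ) + 1 - G.u n)⁻¹ * (sigma P T X)⁻¹ * nestedSum C n R by
      rw [U_eq_nestedSum hf hint h1 G hn (by omega), hsig, h]
      ring
    rw [nestedSum_eq_pred C (by omega) R, ← nestedSum_const_mul]
    refine nestedSum_congr (T := T) (fun j hj i => hCT j ?_ i) (fun _ _ _ => rfl) fun i hi => ?_
    · rw [Finset.mem_Icc] at hj ⊢; omega
    have hupd : ∀ x, ∀ l ∈ Finset.Ico 1 n, i l = Function.update i n x l := fun x l hl => by
      rw [Function.update_of_ne (by rw [Finset.mem_Ico] at hl; omega)]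
    have hset : ∀ x, G.D T m prec (Function.update i n x) n = G.D T m prec i n ∧
        G.B T m prec (Function.update i n x) n = G.B T m prec i n := fun x => by
      have := (Genogram.constraints_congr T m prec G G le_rfl le_rfl (fun _ _ => rfl)
        (fun _ _ => rfl) hnn).2.2 _ _ (hupd x)
      exact ⟨this.2.1.symm, this.2.2.symm⟩
    have hfw : ∀ x, G.fullWeight P X (Function.update i n x) = fun ω =>
        G.weight P (fun j => X (i j)) n ω * X x ω := fun x => by
      funext ω
      rw [Genogram.fullWeight, Function.update_self]
      congr 1
      refine congrFun (Genogram.weight_congr P G G (fun _ _ => rfl) (fun _ _ => rfl)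
        fun j hj => ?_) ω
      rw [← hupd x j hj]
    have hB := G.B_subset T m prec i hnn
    have hDB := G.D_subset_B T m prec i hnn
    have hu := G.two_le_u (Finset.mem_Icc.2 ⟨hn, le_rfl⟩)
    simp only [hR, hset, hfw]
    rw [← integral_finsetSum]
    · rw [← integral_const_mul]
      refine integral_congr_ae (Filter.Eventually.of_forall fun ω => ?_)
      simp only []
      rw [fDiff_eq hf G hn hnK, ← Finset.sum_mul, ← Finset.mul_sum]
      ring
    · intro x hx
      have hxT := hCT n hnn i hx
      have hi' : ∀ l ∈ Finset.Icc 1 n, Function.update i n x l ∈ T := by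
        have := update_mem_of_mem hi hxT
        rwa [Nat.sub_add_cancel (by omega)] at this
      have h3 := integrable_fullWeight_mul G (by omega) hi' (P := P) (X := X)
        ((integrableMul_segmentDiff hf hint (l := n - 1) (r := n - G.u n) (by omega) (by omega)
          hB hDB).mono (by omega))
      have h4 := integrable_fullWeight_mul G (by omega) hi' (P := P) (X := X)
        ((integrableMul_iteratedDeriv hint (l := n - 1) (by omega) (hDB.trans hB)).mono
          (by omega))
      rw [hfw] at h3 h4
      refine (h3.add h4).congr (Filter.Eventually.of_forall fun ω => ?_)
      simp only [Pi.add_apply]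
      ring
  have hRsum : nestedSum C n R = -nestedSum C n Q +
      e * nestedSum C n fun i => ∫ ω, G.fullWeight P X i ω ∂P := by
    rw [← neg_one_mul, ← nestedSum_const_mul, ← nestedSum_const_mul, ← nestedSum_add]
    refine nestedSum_congr hCT (fun _ _ _ => rfl) fun i hi => ?_
    simp only [hR]
    rw [sum_slotTerm hf hint G (by omega) hnK hi hn (h1.mono hnK) hM, mul_comm e, neg_one_mul]
  rw [hU, hext, hRsum, S_eq_nestedSum (h1.mono hnK) G (by omega)]
  ring

end

/-- The coefficient of `E[f^{(n-1)}(W)]` produced by the genograms of order `n`. -/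
def genogramCoeff (P : Measure Ω) (T : Finset (Fin d → ℤ)) (X : (Fin d → ℤ) → Ω → ℝ) (m : ℕ)
    (prec : (Fin d → ℤ) → (Fin d → ℤ) → Prop) (M n : ℕ) : ℝ :=
  -∑ G ∈ Genogram.bounded n M, G.b / ((n : ℝ) + 1 - G.u n) * G.S P T X m prec

section

variable [IsProbabilityMeasure P] (hf : ContDiff ℝ (K : ℕ∞) f)
  (hint : ExpectationsExist P T X K f)
  (h1 : IntegrableMul P T X (K + 1) fun _ => 1)
  (hM : ∀ J ⊆ T, ∀ s : ℤ, (M : ℤ) ≤ s → nbhdRk T m prec s J = T)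
include hf hint h1 hM

/-- One more order of the expansion: `b_mul_U_eq` summed over all genograms of order `n`. -/
theorem sum_b_mul_U_succ (hn : 2 ≤ n) (hnK : n ≤ K + 1) :
    ∑ G ∈ Genogram.bounded n M, G.b * G.U P T X m prec f =
      genogramCoeff P T X m prec M n *
        ∫ ω, iteratedDeriv (n - 1) f (normSum P T X ∅ ω) ∂P +
      ∑ G ∈ Genogram.bounded (n + 1) M, G.b * G.U P T X m prec f := by
  rw [← Finset.sum_fiberwise_of_maps_to (s := Genogram.bounded (n + 1) M)
    fun G hG => Genogram.restrict_mem_bounded hG,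
    Finset.sum_congr rfl fun G hG => b_mul_U_eq hf hint h1 hM G hn hnK hG,
    Finset.sum_sub_distrib, genogramCoeff, neg_mul, Finset.sum_mul]
  ring

/-- The expansion begins with the genograms of order two: attaching children with all identifiers
to the root telescopes to `E[X_x f(W)]`, as the `X_x` are centred. -/
theorem integral_mul_eq_sum_two (hmean : ∀ x ∈ T, ∫ ω, X x ω ∂P = 0) :
    ∫ ω, normSum P T X ∅ ω * f (normSum P T X ∅ ω) ∂P =
      ∑ G ∈ Genogram.bounded 2 M, G.b * G.U P T X m prec f := by
  have hb : ∀ G : Genogram 2, G.b = -1 := fun G => by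
    have hp := G.p_mem 2 (by simp)
    have hp1 : G.p 2 = 1 := by omega
    have hs := G.s_child_root 2 (by simp) hp1
    have hl : G.leaves = 1 := by
      rw [Genogram.leaves_child (n := 1) G le_rfl hp1]
      simp [Genogram.leaves]
    have hneg : G.negatives = 0 := by
      unfold Genogram.negatives
      rw [Finset.card_eq_zero, Finset.filter_eq_empty_iff]
      intro j hj
      rw [Finset.mem_Icc] at hj
      rcases (show j = 1 ∨ j = 2 by omega) with rfl | rfl
      · rw [G.s_root]; omega
      · omega
    simp [Genogram.b, hl, hneg]
  rw [← Finset.sum_fiberwise_of_maps_to (s := Genogram.bounded 2 M)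
    (t := Genogram.bounded 1 M) fun G hG => Genogram.restrict_mem_bounded hG]
  have huniq : ∀ G G' : Genogram 1, G = G' := fun G G' => by
    ext j
    · rw [G.p_out j (by simp), G'.p_out j (by simp)]
    · by_cases hj : j = 1
      · rw [hj, G.s_root, G'.s_root]
      · rw [G.s_out j (by simp; omega), G'.s_out j (by simp; omega)]
  obtain ⟨G, hG⟩ : ∃ G, G ∈ Genogram.bounded 1 M := by
    refine ⟨⟨fun _ => 0, fun _ => 0, fun _ _ => rfl, fun _ _ => rfl, ?_, rfl, ?_, ?_, ?_, ?_, ?_⟩,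
      Genogram.mem_bounded.2 fun _ => by simp⟩
    all_goals
      intro j hj
      first | omega | (rw [Finset.mem_Icc] at hj; omega)
  rw [show Genogram.bounded 1 M = {G} from
    Finset.eq_singleton_iff_unique_mem.2 ⟨hG, fun G' _ => huniq _ _⟩, Finset.sum_singleton]
  set C : ℕ → (ℕ → Fin d → ℤ) → Finset (Fin d → ℤ) :=
    fun j i => G.B T m prec i j \ G.D T m prec i j with hC
  have hint0 := integrableMul_iteratedDeriv (P := P) (X := X) (T := T) hint (Nat.zero_le K)
    (Finset.empty_subset T)
  simp only [iteratedDeriv_zero] at hint0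
  have hsum : ∀ i : ℕ → Fin d → ℤ, (∀ l ∈ Finset.Icc 1 1, i l ∈ T) →
      ∑ G' ∈ (Genogram.bounded (1 + 1) M).filter (fun G' => G'.restrict = G),
        G.slotTerm P T X m prec f i (G'.p (1 + 1)) (G'.s (1 + 1)) =
      -∫ ω, X (i 1) ω * f (normSum P T X ∅ ω) ∂P := by
    intro i hi
    have hfw : G.fullWeight P X i = X (i 1) := by
      funext ω
      simp [Genogram.fullWeight, Genogram.weight]
    rw [Genogram.sum_extensions G le_rfl hG fun q s => G.slotTerm P T X m prec f i q s,
      if_pos rfl, Genogram.chain_one, Finset.sum_empty, add_zero,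
      sum_slotTerm_child hint G le_rfl (by omega) hi _ hM, hfw, hmean _ (hi 1 (by simp)),
      Genogram.D_one]
    · simp
    · rw [hfw]
      have := (h1.mono (show 1 ≤ K + 1 by omega)).factor_mul (r := 0) (hi 1 (by simp))
      simpa using this.integrable
  have hterm : ∀ G' ∈ (Genogram.bounded 2 M).filter (fun G' => G'.restrict = G),
      G'.b * G'.U P T X m prec f = -((sigma P T X) ^ 1)⁻¹ * nestedSum C 1 fun i =>
        G.slotTerm P T X m prec f i (G'.p (1 + 1)) (G'.s (1 + 1)) := fun G' hG' => by
    obtain rfl := (Finset.mem_filter.1 hG').2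
    rw [hb, U_eq_nestedSum_slotTerm hf hint h1 G' le_rfl (by omega)]
    ring
  rw [Finset.sum_congr rfl hterm, ← Finset.mul_sum, ← nestedSum_finsetSum,
    nestedSum_congr (T := T) (fun j hj i => constraint_subset G hj i) (fun _ _ _ => rfl) hsum]
  simp only [nestedSum, zero_add, Function.update_self, Genogram.B_one, Genogram.D_one,
    Finset.sdiff_empty, pow_one, Finset.sum_neg_distrib, neg_mul_neg]
  rw [← integral_finsetSum, ← integral_const_mul]
  · refine integral_congr_ae (Filter.Eventually.of_forall fun ω => ?_)
    simp only [← Finset.sum_mul]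
    conv_lhs => enter [1]; rw [normSum, Finset.sdiff_empty]
    ring
  · intro x hx
    exact (hint0.factor_mul (r := 0) hx).integrable

theorem integral_mul_eq_expansion (hmean : ∀ x ∈ T, ∫ ω, X x ω ∂P = 0) {l : ℕ} (hl : l ≤ K) :
    ∫ ω, normSum P T X ∅ ω * f (normSum P T X ∅ ω) ∂P =
      ∑ j ∈ Finset.Icc 1 l, genogramCoeff P T X m prec M (j + 1) *
        ∫ ω, iteratedDeriv j f (normSum P T X ∅ ω) ∂P +
      ∑ G ∈ Genogram.bounded (l + 2) M, G.b * G.U P T X m prec f := by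
  induction l with
  | zero => simpa using integral_mul_eq_sum_two hf hint h1 hM hmean
  | succ l ih =>
    rw [ih (by omega), sum_b_mul_U_succ hf hint h1 hM (by omega) (by omega),
      Finset.sum_Icc_succ_top (by omega)]
    simp only [show l + 2 - 1 = l + 1 by omega]
    ring

end

/-! ### Large identifiers do not contribute -/

section

theorem exists_large {G : Genogram n} (hG : G ∉ Genogram.bounded n (M + 1)) :
    ∃ j ∈ Finset.Icc 2 n, (M : ℤ) + 1 < G.s j := by
  rw [Genogram.mem_bounded, not_forall] at hG
  obtain ⟨j, hj⟩ := hG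
  push_cast at hj
  refine ⟨j, ?_, by omega⟩
  by_contra h
  rw [Finset.mem_Icc] at h
  by_cases h1 : j = 1
  · rw [h1, G.s_root] at hj; omega
  · rw [G.s_out j (by rw [Finset.mem_Icc]; omega)] at hj; omega

variable (hM : ∀ J ⊆ T, ∀ s : ℤ, (M : ℤ) ≤ s → nbhdRk T m prec s J = T)
include hM

/-- For an identifier above `M + 1`, both neighborhoods in `B_j` and `D_j` are all of `T`. -/
theorem constraints_eq_of_large (G : Genogram n) {j : ℕ} (hj : j ∈ Finset.Icc 2 n)
    (hs : (M : ℤ) + 1 < G.s j) {i : ℕ → Fin d → ℤ} (hi : ∀ l ∈ Finset.Ico 1 j, i l ∈ T) :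
    G.B T m prec i j = G.D T m prec i j := by
  have hJ : G.ancestorIndices i j ⊆ T := by
    intro x hx
    obtain ⟨l, hl, rfl⟩ := Finset.mem_image.1 hx
    exact hi l (Finset.mem_Ico.2 (G.ancestors_lt hl))
  rw [G.B_eq T m prec i hj, G.D_eq T m prec i hj, if_pos (by omega), if_pos (by omega),
    hM _ hJ _ (by omega), hM _ hJ _ (by omega)]

theorem S_eq_zero {G : Genogram n} (hG : G ∉ Genogram.bounded n (M + 1)) :
    G.S P T X m prec = 0 := by
  obtain ⟨j, hj, hs⟩ := exists_large hG
  rw [Genogram.S, nestedSum_eq_zero (T := T) (fun j hj i => constraint_subset G hj i) (j := j)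
    (by rw [Finset.mem_Icc] at hj ⊢; omega), mul_zero]
  intro i hi
  rw [constraints_eq_of_large hM G hj hs hi, Finset.sdiff_self]

theorem U_eq_zero (hf : ContDiff ℝ (K : ℕ∞) f) (hint : ExpectationsExist P T X K f)
    (h1 : IntegrableMul P T X (K + 1) fun _ => 1) (hn : 2 ≤ n) (hnK : n ≤ K + 2)
    {G : Genogram n} (hG : G ∉ Genogram.bounded n (M + 1)) : G.U P T X m prec f = 0 := by
  obtain ⟨j, hj, hs⟩ := exists_large hG
  rw [U_eq_nestedSum hf hint h1 G hn hnK]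
  by_cases hjn : j = n
  · subst hjn
    rw [nestedSum_congr (T := T) (F' := fun _ => 0 * 0) (fun l hl i => constraint_subset G ?_ i)
      (fun _ _ _ => rfl) fun i hi => ?_, nestedSum_const_mul, zero_mul, mul_zero]
    · rw [Finset.mem_Icc] at hl ⊢; omega
    · rw [fDiff_eq_ite G hn, if_pos (G.u_of_nonneg (by omega)),
        constraints_eq_of_large hM G hj hs fun l hl => hi l (by
          rw [Finset.mem_Ico] at hl; rw [Finset.mem_Icc]; omega)]
      simp
  · rw [nestedSum_eq_zero (T := T) (fun l hl i => constraint_subset G ?_ i) (j := j)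
      (by rw [Finset.mem_Icc] at hj ⊢; omega), mul_zero]
    · intro i hi
      rw [constraints_eq_of_large hM G hj hs hi, Finset.sdiff_self]
    · rw [Finset.mem_Icc] at hl ⊢; omega

end

end Expansion

/-! ### Moments and cumulants -/

section Cumulants

variable {Ω : Type*} [MeasurableSpace Ω] {P : Measure Ω} [IsProbabilityMeasure P]

/-- The recursion between moments and cumulants: the Leibniz rule for `φ' = (log φ)' φ`, where `φ`
is the characteristic function. -/
theorem integral_pow_succ_eq_sum_cumulant {Y : Ω → ℝ} {n : ℕ}
    (hY : MemLp Y ((n + 1 : ℕ) : ENNReal) P) :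
    ∫ ω, Y ω ^ (n + 1) ∂P =
      ∑ j ∈ Finset.range (n + 1), (n.choose j : ℝ) * cumulant P Y (j + 1) *
        ∫ ω, Y ω ^ (n - j) ∂P := by
  have hYm : AEMeasurable Y P := hY.aestronglyMeasurable.aemeasurable
  have : IsProbabilityMeasure (P.map Y) := Measure.isProbabilityMeasure_map hYm
  have hid : ∀ l ≤ n + 1, MemLp id (l : ENNReal) (P.map Y) := fun l hl => by
    rw [memLp_map_measure_iff aestronglyMeasurable_id hYm]
    exact hY.mono_exponent (by exact_mod_cast hl)
  set φ := charFun (P.map Y) with hφ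
  have hφ0 : φ 0 = 1 := by simp [hφ]
  have hφs : ContDiff ℝ ((n + 1 : ℕ) : WithTop ℕ∞) φ := contDiff_charFun (hid _ le_rfl)
  have hφs' : ContDiff ℝ (n : WithTop ℕ∞) φ := hφs.of_le (by exact_mod_cast Nat.le_succ n)
  have hdφ : ContDiff ℝ (n : WithTop ℕ∞) (deriv φ) := by
    have := (contDiff_succ_iff_deriv (n := (n : WithTop ℕ∞))).1 (by exact_mod_cast hφs)
    exact this.2.2
  have hdiff : Differentiable ℝ φ := hφs.differentiable (by simp)
  have hslit : ∀ᶠ t in nhds (0 : ℝ), φ t ∈ Complex.slitPlane :=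
    hdiff.continuous.continuousAt.eventually_mem
      (Complex.isOpen_slitPlane.mem_nhds (by rw [hφ0]; exact Complex.one_mem_slitPlane))
  have hL : deriv (fun t => Complex.log (φ t)) =ᶠ[nhds 0] fun t => deriv φ t / φ t := by
    filter_upwards [hslit] with t ht
    exact ((hdiff t).hasDerivAt.clog_real ht).deriv
  have hLs : ContDiffAt ℝ (n : WithTop ℕ∞) (deriv fun t => Complex.log (φ t)) 0 :=
    (hdφ.contDiffAt.mul
      (hφs'.contDiffAt.inv (by rw [hφ0]; exact one_ne_zero))).congr_of_eventuallyEq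
      (hL.trans (Filter.Eventually.of_forall fun t => div_eq_mul_inv _ _))
  have hmul : deriv φ =ᶠ[nhds 0] (deriv fun t => Complex.log (φ t)) * φ := by
    filter_upwards [hslit, hL] with t ht hLt
    rw [Pi.mul_apply, hLt, div_mul_cancel₀ _ (Complex.slitPlane_ne_zero ht)]
  have hmom : ∀ l ≤ n + 1, iteratedDeriv l φ 0 = Complex.I ^ l * ((∫ ω, Y ω ^ l ∂P : ℝ) : ℂ) :=
    fun l hl => by
    rw [hφ, iteratedDeriv_charFun_zero (hid l hl), integral_map hYm (by fun_prop)]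
  have key : iteratedDeriv (n + 1) φ 0 = ∑ j ∈ Finset.range (n + 1), n.choose j *
      iteratedDeriv j (deriv fun t => Complex.log (φ t)) 0 * iteratedDeriv (n - j) φ 0 := by
    rw [iteratedDeriv_succ', hmul.iteratedDeriv_eq, iteratedDeriv_mul hLs hφs'.contDiffAt]
  rw [hmom _ le_rfl] at key
  have hI : ∀ l : ℕ, Complex.I ^ l ≠ 0 := fun l => pow_ne_zero _ Complex.I_ne_zero
  have key' : ((∫ ω, Y ω ^ (n + 1) ∂P : ℝ) : ℂ) = ∑ j ∈ Finset.range (n + 1),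
      (iteratedDeriv (j + 1) (fun t => Complex.log (φ t)) 0 / Complex.I ^ (j + 1)) *
        (((n.choose j : ℝ) * ∫ ω, Y ω ^ (n - j) ∂P : ℝ) : ℂ) := by
    rw [← mul_right_inj' (hI (n + 1)), key, Finset.mul_sum]
    refine Finset.sum_congr rfl fun j hj => ?_
    rw [Finset.mem_range] at hj
    rw [hmom _ (by omega), ← iteratedDeriv_succ', show n + 1 = (j + 1) + (n - j) by omega, pow_add]
    have h1 := hI (j + 1)
    push_cast
    field_simp
  have hre := congrArg Complex.re key'
  rw [Complex.ofReal_re, Complex.re_sum] at hre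
  rw [hre]
  refine Finset.sum_congr rfl fun j _ => ?_
  rw [Complex.re_mul_ofReal, cumulant]
  ring

end Cumulants

/-! ### Powers as test functions -/

section Powers

variable {Ω : Type*} [MeasurableSpace Ω] {P : Measure Ω} {d : ℕ}
  {T : Finset (Fin d → ℤ)} {X : (Fin d → ℤ) → Ω → ℝ} {k l : ℕ}

theorem memLp_normSum (hX : ∀ x ∈ T, MemLp (X x) ((k + 1 : ℕ) : ENNReal) P)
    (J : Finset (Fin d → ℤ)) : MemLp (normSum P T X J) ((k + 1 : ℕ) : ENNReal) P :=
  (memLp_finsetSum _ fun x hx => hX x (Finset.mem_sdiff.1 hx).1).const_mul _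

variable [IsProbabilityMeasure P]

theorem integrable_prod_of_memLp {ι : Type*} (s : Finset ι) {Y : ι → Ω → ℝ} {q : ℕ}
    (hY : ∀ a ∈ s, MemLp (Y a) (q : ENNReal) P) (hs : s.card ≤ q) :
    Integrable (fun ω => ∏ a ∈ s, Y a ω) P := by
  rw [← memLp_one_iff_integrable]
  refine (MemLp.prod' hY).mono_exponent ?_
  rw [Finset.sum_const, nsmul_eq_mul, ENNReal.le_inv_iff_mul_le, one_mul]
  calc (s.card : ENNReal) * (q : ENNReal)⁻¹ ≤ q * (q : ENNReal)⁻¹ := by gcongr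
    _ ≤ 1 := ENNReal.mul_inv_le_one _

theorem integrableMul_normSum_pow (hX : ∀ x ∈ T, MemLp (X x) ((k + 1 : ℕ) : ENNReal) P)
    {r a b : ℕ} (h : r + (a + b) ≤ k + 1) (D B : Finset (Fin d → ℤ)) :
    IntegrableMul P T X r fun ω => normSum P T X D ω ^ a * normSum P T X B ω ^ b := by
  intro n hn i hi
  have := integrable_prod_of_memLp (P := P) (Finset.univ : Finset (Fin n ⊕ (Fin a ⊕ Fin b)))
    (Y := Sum.elim (fun c => X (i c)) (Sum.elim (fun _ => normSum P T X D)
      fun _ => normSum P T X B)) (q := k + 1) ?_ ?_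
  · simpa using this
  · rintro (c | c | c) -
    · exact hX _ (hi c)
    · exact memLp_normSum hX D
    · exact memLp_normSum hX B
  · simp only [Finset.card_univ, Fintype.card_sum, Fintype.card_fin]
    omega

theorem integrableMul_one (hX : ∀ x ∈ T, MemLp (X x) ((k + 1 : ℕ) : ENNReal) P) {r : ℕ}
    (hr : r ≤ k + 1) : IntegrableMul P T X r fun _ => 1 := by
  simpa using integrableMul_normSum_pow hX (r := r) (a := 0) (b := 0) (by omega) ∅ ∅

theorem expectationsExist_pow (hX : ∀ x ∈ T, MemLp (X x) ((k + 1 : ℕ) : ENNReal) P)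
    (hl : l ≤ k) : ExpectationsExist P T X l fun x => x ^ l := by
  intro j hj n hn i hi
  simp only [iteratedDeriv_pow]
  refine ⟨fun J _ => ?_, fun r _ B _ D _ => ?_⟩
  · have h := (integrableMul_normSum_pow hX (r := j + 1) (a := l - j) (b := 0) (by omega) J
      ∅).const_mul (l.descFactorial j : ℝ)
    simpa using h n hn i hi
  · have hexp : ∀ x y : ℝ, ∫ v in (0 : ℝ)..1, v ^ r *
        ((l.descFactorial j : ℝ) * (v * x + (1 - v) * y) ^ (l - j)) =
        ∑ c ∈ Finset.range (l - j + 1), (∫ v in (0 : ℝ)..1, v ^ r *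
          ((l.descFactorial j : ℝ) * (v ^ c * (1 - v) ^ (l - j - c) * (l - j).choose c))) *
          (x ^ c * y ^ (l - j - c)) := fun x y => by
      simp only [← intervalIntegral.integral_mul_const]
      rw [← intervalIntegral.integral_finsetSum]
      · refine intervalIntegral.integral_congr fun v _ => ?_
        simp only [add_pow, Finset.mul_sum, mul_pow]
        refine Finset.sum_congr rfl fun c _ => ?_
        ring
      · intro c _
        exact Continuous.intervalIntegrable (by fun_prop) _ _
    simp only [hexp, Finset.mul_sum]
    refine integrable_finsetSum _ fun c hc => ?_
    rw [Finset.mem_range] at hc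
    exact ((integrableMul_normSum_pow hX (r := j + 1) (a := c) (b := l - j - c) (by omega) D
      B).const_mul _) n hn i hi

variable {m M : ℕ} {prec : (Fin d → ℤ) → (Fin d → ℤ) → Prop}

/-- The moments of `W` satisfy the recursion with the coefficients `genogramCoeff` in place of the
cumulants: for the test function `x ^ l` the remainder of the expansion vanishes. -/
theorem integral_pow_succ_eq_sum_genogramCoeff
    (hX : ∀ x ∈ T, MemLp (X x) ((k + 1 : ℕ) : ENNReal) P)
    (hmean : ∀ x ∈ T, ∫ ω, X x ω ∂P = 0)
    (hM : ∀ J ⊆ T, ∀ s : ℤ, (M : ℤ) ≤ s → nbhdRk T m prec s J = T) (hl : l ≤ k) :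
    ∫ ω, normSum P T X ∅ ω ^ (l + 1) ∂P =
      ∑ j ∈ Finset.Icc 1 l, genogramCoeff P T X m prec M (j + 1) *
        ((l.descFactorial j : ℝ) * ∫ ω, normSum P T X ∅ ω ^ (l - j) ∂P) := by
  have hf : ContDiff ℝ (l : ℕ∞) fun x : ℝ => x ^ l := contDiff_id.pow l
  have h1 := integrableMul_one hX (r := l + 1) (by omega)
  have hint := expectationsExist_pow hX hl
  have h := integral_mul_eq_expansion (prec := prec) (m := m) hf hint h1 hM hmean le_rfl
  rw [Finset.sum_eq_zero (s := Genogram.bounded (l + 2) M), add_zero] at h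
  · simp only [iteratedDeriv_pow, integral_const_mul] at h
    rw [← h]
    refine integral_congr_ae (Filter.Eventually.of_forall fun ω => ?_)
    simp only []
    ring
  · intro G _
    have h0 : ∀ i, G.fDiff P T X m prec (fun x : ℝ => x ^ l) i = fun _ => 0 := fun i => by
      rw [fDiff_eq_ite G (by omega)]
      split_ifs
      · simp
      · funext ω
        simp [segmentDiff]
    rw [U_eq_nestedSum hf hint h1 G (by omega) le_rfl]
    have : nestedSum (fun j i => G.B T m prec i j \ G.D T m prec i j) (l + 2 - 1)
        (fun _ => (0 : ℝ)) = 0 := by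
      simpa using nestedSum_const_mul (C := fun j i => G.B T m prec i j \ G.D T m prec i j)
        (n := l + 2 - 1) (F := fun _ => (0 : ℝ)) 0
    simp only [h0, mul_zero, integral_zero, this]

/-- The coefficients of the expansion and the cumulants are determined by the moments through the
same recursion. -/
theorem genogramCoeff_eq_cumulant (hX : ∀ x ∈ T, MemLp (X x) ((k + 1 : ℕ) : ENNReal) P)
    (hmean : ∀ x ∈ T, ∫ ω, X x ω ∂P = 0)
    (hM : ∀ J ⊆ T, ∀ s : ℤ, (M : ℤ) ≤ s → nbhdRk T m prec s J = T) (h1 : 1 ≤ l) (hl : l ≤ k) :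
    genogramCoeff P T X m prec M (l + 1) =
      cumulant P (normSum P T X ∅) (l + 1) / (l.factorial : ℝ) := by
  induction l using Nat.strong_induction_on with
  | _ l ih =>
  have hW : ∀ {j}, j ≤ k → MemLp (normSum P T X ∅) ((j + 1 : ℕ) : ENNReal) P := fun hj =>
    (memLp_normSum hX ∅).mono_exponent (by exact_mod_cast Nat.succ_le_succ hj)
  have hmeanW : ∫ ω, normSum P T X ∅ ω ∂P = 0 := by
    simp only [normSum, Finset.sdiff_empty]
    rw [integral_const_mul, integral_finsetSum, Finset.sum_eq_zero hmean, mul_zero]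
    intro x hx
    exact (hX x hx).integrable (by exact_mod_cast Nat.succ_pos k)
  have hκ1 : cumulant P (normSum P T X ∅) 1 = 0 := by
    have := integral_pow_succ_eq_sum_cumulant (hW (Nat.zero_le k))
    simp [hmeanW] at this
    exact this.symm
  have hA := integral_pow_succ_eq_sum_genogramCoeff (prec := prec) (m := m) hX hmean hM hl
  rw [integral_pow_succ_eq_sum_cumulant (hW hl), Finset.range_eq_Ico,
    Finset.sum_eq_sum_Ico_succ_bot (by omega), zero_add, hκ1, mul_zero, zero_mul, zero_add,
    Finset.Ico_add_one_right_eq_Icc] at hA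
  obtain ⟨l, rfl⟩ : ∃ j, l = j + 1 := ⟨l - 1, by omega⟩
  rw [Finset.sum_Icc_succ_top (by omega), Finset.sum_Icc_succ_top (by omega)] at hA
  have hlow : ∑ j ∈ Finset.Icc 1 l, ((l + 1).choose j : ℝ) *
      cumulant P (normSum P T X ∅) (j + 1) * ∫ ω, normSum P T X ∅ ω ^ (l + 1 - j) ∂P =
      ∑ j ∈ Finset.Icc 1 l, genogramCoeff P T X m prec M (j + 1) *
        (((l + 1).descFactorial j : ℝ) * ∫ ω, normSum P T X ∅ ω ^ (l + 1 - j) ∂P) := by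
    refine Finset.sum_congr rfl fun j hj => ?_
    rw [Finset.mem_Icc] at hj
    rw [ih j (by omega) hj.1 (by omega), Nat.descFactorial_eq_factorial_mul_choose]
    have : (j.factorial : ℝ) ≠ 0 := by positivity
    push_cast
    field_simp
  rw [hlow] at hA
  have hfac : ((l + 1).factorial : ℝ) ≠ 0 := by positivity
  simp only [Nat.choose_self, Nat.cast_one, one_mul, Nat.sub_self, pow_zero, integral_const,
    probReal_univ, smul_eq_mul, mul_one, Nat.descFactorial_self] at hA
  rw [eq_div_iff hfac]
  linarith

end Powers

/-! ### The two expansions -/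

namespace Genogram

variable {n M : ℕ}

theorem finsum_eq_sum_bounded {φ : Genogram n → ℝ} (h : ∀ G ∉ bounded n M, φ G = 0) :
    ∑ᶠ G, φ G = ∑ G ∈ bounded n M, φ G := by
  refine finsum_eq_sum_of_support_subset _ fun G hG => ?_
  by_contra hG'
  exact hG (h G hG')

theorem finsum_mem_eq_sum_bounded {φ : Genogram n → ℝ} (h : ∀ G ∉ bounded n M, φ G = 0)
    (A : Set (Genogram n)) :
    ∑ᶠ G ∈ A, φ G = ∑ G ∈ (bounded n M).filter (· ∈ A), φ G := by
  refine finsum_mem_eq_sum_of_inter_support_eq _ ?_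
  ext G
  simp only [Set.mem_inter_iff, Finset.coe_filter, Set.mem_ofPred_eq, Function.mem_support]
  constructor
  · rintro ⟨h1, h2⟩
    exact ⟨⟨by_contra fun h3 => h2 (h G h3), h1⟩, h2⟩
  · rintro ⟨⟨-, h1⟩, h2⟩
    exact ⟨h1, h2⟩

/-- The extensions of genograms without positive vertex are the genograms without positive vertex
and those whose only positive vertex is the last one. -/
theorem sum_restrict_mem_P₀ (φ : Genogram (n + 1) → ℝ) :
    ∑ G ∈ (bounded (n + 1) M).filter (fun G => G.restrict ∈ P₀ n), φ G =
      ∑ G ∈ (bounded (n + 1) M).filter (· ∈ P₀ (n + 1)), φ G +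
        ∑ G ∈ (bounded (n + 1) M).filter (· ∈ P₁ (n + 1)), φ G := by
  have hr : ∀ G : Genogram (n + 1), G.restrict ∈ P₀ n ↔ ∀ j ∈ Finset.Icc 1 n, G.s j ≤ 0 :=
    fun G => forall₂_congr fun j hj => by rw [restrict_s _ (Finset.mem_Icc.1 hj).2]
  have h0 : ∀ G : Genogram (n + 1), G ∈ P₀ (n + 1) ↔
      (∀ j ∈ Finset.Icc 1 n, G.s j ≤ 0) ∧ G.s (n + 1) ≤ 0 := fun G => by
    constructor
    · intro h
      exact ⟨fun j hj => h j (Finset.Icc_subset_Icc_right (by omega) hj), h _ (by simp)⟩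
    · rintro ⟨h1, h2⟩ j hj
      rw [Finset.mem_Icc] at hj
      by_cases hjn : j = n + 1
      · rw [hjn]; exact h2
      · exact h1 j (Finset.mem_Icc.2 (by omega))
  rw [← Finset.sum_union]
  · refine Finset.sum_congr ?_ fun _ _ => rfl
    ext G
    simp only [Finset.mem_union, Finset.mem_filter, hr, h0, ← and_or_left]
    refine and_congr_right fun _ => ?_
    change _ ↔ _ ∨ ((∀ j ∈ Finset.Icc 1 n, G.s j ≤ 0) ∧ 1 ≤ G.s (n + 1))
    rw [← and_or_left]
    exact (and_iff_left (by omega)).symm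
  · rw [Finset.disjoint_filter]
    intro G _ h h'
    have := ((h0 G).1 h).2
    have := h'.2
    omega

end Genogram

end

theorem corollaryE3 {Ω : Type*} [MeasurableSpace Ω] (P : Measure Ω) [IsProbabilityMeasure P]
    {d : ℕ} (T : Finset (Fin d → ℤ)) (X : (Fin d → ℤ) → Ω → ℝ)
    (prec : (Fin d → ℤ) → (Fin d → ℤ) → Prop) [IsStrictTotalOrder (Fin d → ℤ) prec]
    (m : ℕ) (hm : 1 ≤ m) (k : ℕ) (hk : 2 ≤ k)
    (hX : ∀ i ∈ T, MemLp (X i) ((k + 1 : ℕ) : ENNReal) P)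
    (hmean : ∀ i ∈ T, ∫ ω, X i ω ∂P = 0)
    (hvar : 0 < variance (fun ω => ∑ i ∈ T, X i ω) P)
    (f : ℝ → ℝ) (hf : ContDiff ℝ (k : ℕ∞) f) (hint : ExpectationsExist P T X k f) :
    let W : Ω → ℝ := normSum P T X ∅
    -- only finitely many terms of the sums over genograms are nonzero
    {H : Genogram (k + 2) | H.U P T X m prec f ≠ 0}.Finite ∧
    {H : Genogram (k + 1) | H.U P T X m prec f ≠ 0}.Finite ∧
    {H : Genogram (k + 1) | H.S P T X m prec ≠ 0}.Finite ∧
    ∫ ω, W ω * f (W ω) ∂P =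
      ∑ j ∈ Finset.Icc 1 k, cumulant P W (j + 1) / (j.factorial : ℝ) *
          ∫ ω, iteratedDeriv j f (W ω) ∂P +
        ∑ᶠ H : Genogram (k + 2), H.b * H.U P T X m prec f ∧
    ∫ ω, W ω * f (W ω) ∂P =
      ∑ j ∈ Finset.Icc 1 (k - 1), cumulant P W (j + 1) / (j.factorial : ℝ) *
          ∫ ω, iteratedDeriv j f (W ω) ∂P +
        modifiedCumulant P T X m prec k / (k.factorial : ℝ) *
          ∫ ω, iteratedDeriv k f (W ω) ∂P +
        ((∑ᶠ H ∈ Genogram.P₀ (k + 2), H.b * H.U P T X m prec f) +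
          (∑ᶠ H ∈ Genogram.P₁ (k + 2), H.b * H.U P T X m prec f) +
          (∑ᶠ H ∈ Genogram.G₀ (k + 1), H.b * H.U P T X m prec f)) := by
  intro W
  obtain ⟨M₀, hM₀⟩ := exists_nbhdRk_eq T m prec
  -- for an identifier `s > M₀ + 1`, both `s` and `s - 1` exceed `M₀`
  set M := M₀ + 1 with hMdef
  have hM : ∀ J ⊆ T, ∀ s : ℤ, (M : ℤ) ≤ s → nbhdRk T m prec s J = T := fun J hJ s hs =>
    hM₀ J hJ s (by rw [hMdef] at hs; push_cast at hs; omega)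
  have h1 := integrableMul_one hX le_rfl
  have hU : ∀ {n}, 2 ≤ n → n ≤ k + 2 → ∀ G : Genogram n, G ∉ Genogram.bounded n M →
      G.U P T X m prec f = 0 := fun hn hnk G hG => U_eq_zero hM₀ hf hint h1 hn hnk hG
  have hbU : ∀ {n}, 2 ≤ n → n ≤ k + 2 → ∀ G : Genogram n, G ∉ Genogram.bounded n M →
      G.b * G.U P T X m prec f = 0 := fun hn hnk G hG => by rw [hU hn hnk G hG, mul_zero]
  have hκ : ∀ j ∈ Finset.Icc 1 k, genogramCoeff P T X m prec M (j + 1) =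
      cumulant P W (j + 1) / (j.factorial : ℝ) := fun j hj =>
    genogramCoeff_eq_cumulant hX hmean hM (Finset.mem_Icc.1 hj).1 (Finset.mem_Icc.1 hj).2
  have hfinU : ∀ {n}, 2 ≤ n → n ≤ k + 2 → {H : Genogram n | H.U P T X m prec f ≠ 0}.Finite :=
    fun hn hnk => (Genogram.bounded _ M).finite_toSet.subset fun G hG =>
      by_contra fun h => hG (hU hn hnk G h)
  refine ⟨hfinU (by omega) le_rfl, hfinU (by omega) (by omega),
    (Genogram.bounded _ M).finite_toSet.subset fun G hG =>
      by_contra fun h => hG (S_eq_zero hM₀ h), ?_, ?_⟩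
  · rw [Genogram.finsum_eq_sum_bounded (hbU (by omega) le_rfl),
      integral_mul_eq_expansion hf hint h1 hM hmean le_rfl]
    congr 1
    exact Finset.sum_congr rfl fun j hj => by rw [hκ j hj]
  · have hexp := integral_mul_eq_expansion hf hint h1 hM hmean (show k - 1 ≤ k by omega)
    rw [show k - 1 + 2 = k + 1 by omega] at hexp
    have hsum : ∑ j ∈ Finset.Icc 1 (k - 1), genogramCoeff P T X m prec M (j + 1) *
        ∫ ω, iteratedDeriv j f (W ω) ∂P = ∑ j ∈ Finset.Icc 1 (k - 1),
        cumulant P W (j + 1) / (j.factorial : ℝ) * ∫ ω, iteratedDeriv j f (W ω) ∂P :=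
      Finset.sum_congr rfl fun j hj => by
        rw [Finset.mem_Icc] at hj
        rw [hκ j (Finset.mem_Icc.2 (by omega))]
    rw [Genogram.finsum_mem_eq_sum_bounded (hbU (by omega) le_rfl),
      Genogram.finsum_mem_eq_sum_bounded (hbU (by omega) le_rfl),
      Genogram.finsum_mem_eq_sum_bounded (hbU (by omega) (by omega)),
      ← Genogram.sum_restrict_mem_P₀, hexp, hsum, add_assoc]
    congr 1
    -- only the genograms without positive vertex are expanded further
    have hsplit : ∀ φ : Genogram (k + 1) → ℝ, ∑ G ∈ Genogram.bounded (k + 1) M, φ G =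
        ∑ G ∈ (Genogram.bounded (k + 1) M).filter (· ∈ Genogram.P₀ (k + 1)), φ G +
        ∑ G ∈ (Genogram.bounded (k + 1) M).filter (· ∈ Genogram.G₀ (k + 1)), φ G := fun φ => by
      rw [← Finset.sum_filter_add_sum_filter_not _ (· ∈ Genogram.P₀ (k + 1)) φ]
      congr 1
      refine Finset.sum_congr ?_ fun _ _ => rfl
      ext G
      simp [Genogram.G₀]
    have hfiber : ∑ G ∈ (Genogram.bounded (k + 1) M).filter (· ∈ Genogram.P₀ (k + 1)),
        ∑ G' ∈ (Genogram.bounded (k + 2) M).filter (fun G' => G'.restrict = G),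
          G'.b * G'.U P T X m prec f =
        ∑ G' ∈ (Genogram.bounded (k + 2) M).filter (fun G' => G'.restrict ∈ Genogram.P₀ (k + 1)),
          G'.b * G'.U P T X m prec f := by
      rw [← Finset.sum_fiberwise_of_maps_to
        (s := (Genogram.bounded (k + 2) M).filter fun G' => G'.restrict ∈ Genogram.P₀ (k + 1))
        (t := (Genogram.bounded (k + 1) M).filter (· ∈ Genogram.P₀ (k + 1)))
        (g := Genogram.restrict)]
      · refine Finset.sum_congr rfl fun G hG => Finset.sum_congr ?_ fun _ _ => rfl
        rw [Finset.filter_filter]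
        refine Finset.filter_congr fun G' _ => ?_
        constructor
        · rintro rfl
          exact ⟨(Finset.mem_filter.1 hG).2, rfl⟩
        · exact fun h => h.2
      · intro G' hG'
        rw [Finset.mem_filter] at hG' ⊢
        exact ⟨Genogram.restrict_mem_bounded hG'.1, hG'.2⟩
    have hP₀ : ∑ G ∈ (Genogram.bounded (k + 1) M).filter (· ∈ Genogram.P₀ (k + 1)),
        G.b * G.U P T X m prec f =
        ∑ G' ∈ (Genogram.bounded (k + 2) M).filter (fun G' => G'.restrict ∈ Genogram.P₀ (k + 1)),
          G'.b * G'.U P T X m prec f -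
        (∑ G ∈ (Genogram.bounded (k + 1) M).filter (· ∈ Genogram.P₀ (k + 1)),
          G.b / (((k + 1 : ℕ) : ℝ) + 1 - G.u (k + 1)) * G.S P T X m prec) *
          ∫ ω, iteratedDeriv k f (W ω) ∂P := by
      rw [← hfiber, Finset.sum_mul, ← Finset.sum_sub_distrib]
      refine Finset.sum_congr rfl fun G hG => ?_
      exact b_mul_U_eq hf hint h1 hM G (by omega) le_rfl (Finset.mem_filter.1 hG).1
    have hcoeff := hκ k (Finset.mem_Icc.2 (by omega))
    rw [genogramCoeff, hsplit] at hcoeff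
    have hmod : modifiedCumulant P T X m prec k / (k.factorial : ℝ) =
        cumulant P W (k + 1) / (k.factorial : ℝ) +
        ∑ G ∈ (Genogram.bounded (k + 1) M).filter (· ∈ Genogram.G₀ (k + 1)),
          G.b / (((k + 1 : ℕ) : ℝ) + 1 - G.u (k + 1)) * G.S P T X m prec := by
      have hfac : (k.factorial : ℝ) ≠ 0 := by positivity
      rw [modifiedCumulant, Genogram.finsum_mem_eq_sum_bounded (M := M) fun G hG => by
        rw [S_eq_zero hM₀ hG, mul_zero], add_div, Finset.sum_div]
      congr 1
      refine Finset.sum_congr rfl fun G _ => ?_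
      rw [show ((k + 1 : ℕ) : ℝ) + 1 - G.u (k + 1) = (k : ℝ) + 2 - G.u (k + 1) by
        push_cast; ring]
      field_simp
    rw [hsplit, hP₀, hmod, ← hcoeff]
    ring
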